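/- Let $\mathbb S=\mathbb R/2\pi\mathbb Z$ with the arc-length distance $d_{\mathbb S}$ and arc-length measure, $I=[0,1]$, and $G=\mathbb S\times\mathbb R\times I$ with the distance $d_G(P,P')=\sqrt{d_{\mathbb S}(\theta,\theta')^2+(\omega-\omega')^2+(x-x')^2}$ for $P=(\theta,\omega,x)$, $P'=(\theta',\omega',x')$. For Borel probability measures $\mu,\nu$ on $G$ let $d(\mu,\nu)=\sup_f\left|\int_G f\,d\mu-\int_G f\,d\nu\right|$, the supremum being over all $f:G\to[0,1]$ with $|f(P)-f(Q)|\le d_G(P,Q)$ for all $P,Q\in G$. Let $K\in\mathbb R$, let $W:I^2\to\mathbb R$ be symmetric and Lipschitz continuous, and let $\xi_{ni}\in I$ ($n\ge1$, $1\le i\le n$) be points with $\lim_{n\to\infty}n^{-1}\sum_{i=1}^n f(\xi_{ni})=\int_I f(x)\,dx$ for all $f\in C(I)$. Let $g$ be a continuous probability density on $\mathbb R$, and let $\hat\rho^0_{\theta|\omega}(\theta,\omega,\xi)\ge 0$ be a continuous function on $G$ which is uniformly continuous in $\xi$, uniformly with respect to $(\theta,\omega)\in\mathbb S\times\mathbb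 R$, with $\int_{\mathbb S}\hat\rho^0_{\theta|\omega}(\phi,\omega,\xi)\,d\phi=1$ for all $(\omega,\xi)\in\mathbb R\times I$. Let $\omega_1,\omega_2,\dots$ be IID random variables with density $g$. For every $n$ let $\theta^0_{n1},\dots,\theta^0_{nn}$ be $\mathbb S$-valued random variables on the same probability space which, conditionally on $\omega_1,\dots,\omega_n$, are independent with densities $\hat\rho^0_{\theta|\omega}(\cdot,\omega_i,\xi_{ni})$, $1\le i\le n$ (no assumption is made on the joint law for different $n$). Let $T>0$ and let $\theta_{ni}(t)\in\mathbb S$, $t\in[0,T]$, solve $$\dot\theta_{ni}=\omega_i+\frac Kn\sum_{j=1}^n W(\xi_{ni},\xi_{nj})\sin(\theta_{nj}-\theta_{ni}),\qquad \theta_{ni}(0)=\theta^0_{ni},\qquad 1\le i\le n,$$ and put $\mu^n_t=n^{-1}\sum_{i=1}^n\delta_{(\theta_{ni}(t),\,\omega_i,\,\xi_{ni})}$. A weak solution on $[0,T]$ of the initial value problem $$\partial_t\hat\rho+\partial_\theta(\hat\rho\,V)=0,\qquad V(t,\theta,\omega,x)=\omega+K\int_I\int_{\mathbb R}\int_{\mathbb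 S}W(x,y)\sin(\phi-\theta)\,\hat\rho(t,\phi,\lambda,y)\,d\phi\,d\lambda\,dy,$$ $$\hat\rho(0,\theta,\omega,x)=\hat\rho^0_{\theta|\omega}(\theta,\omega,x)\,g(\omega)=:\hat\rho^0(\theta,\omega,x)$$ is a family $\hat\rho(t,\cdot)$, $t\in[0,T]$, of probability densities on $G$ such that $t\mapsto\int_G f\,\hat\rho(t,P)\,dP$ is continuous on $[0,T]$ for every bounded continuous $f$ on $G$ and $$\int_G\psi(\tau,P)\hat\rho(\tau,P)\,dP=\int_G\psi(0,P)\hat\rho^0(P)\,dP+\int_0^\tau\!\int_G\left(\partial_t\psi+V\,\partial_\theta\psi\right)\hat\rho\,dP\,dt$$ for all $\tau\in[0,T]$ and all $C^1$ functions $\psi(t,\theta,\omega,x)$ that vanish for large $|\omega|$. Then such a weak solution exists, and for every weak solution $\hat\rho$, with $\mu_t(A)=\int_A\hat\rho(t,P)\,dP$, $$\lim_{n\to\infty}\ \sup_{t\in[0,T]}d(\mu^n_t,\mu_t)=0\quad\text{almost surely}.$$ -/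

import Mathlib

open MeasureTheory ProbabilityTheory Filter Topology
open scoped Real

namespace KuramotoMF

noncomputable section

/-- The unit interval `I = [0,1]`. -/
abbrev I : Type := unitInterval

/-- The circle `ℝ / 2πℤ`. Its Mathlib distance is the arc-length distance
`min (|θ - θ'|, 2π - |θ - θ'|)` (for representatives in `[0, 2π)`), and its `volume` is the
arc-length measure, of total mass `2π`. -/
abbrev Phase : Type := AddCircle (2 * π)

instance factTwoPiPos : Fact ((0 : ℝ) < 2 * π) := ⟨Real.two_pi_pos⟩

/-- The sine function on the circle. -/
def sinPhase : Phase → ℝ := Real.sin_periodic.lift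

/-- The state space `G = 𝕊 × ℝ × I` of triples (phase, intrinsic frequency, position). -/
abbrev G : Type := Phase × ℝ × I

/-- The Euclidean product distance on `G`. -/
def distG (P Q : G) : ℝ :=
  √(dist P.1 Q.1 ^ 2 + (P.2.1 - Q.2.1) ^ 2 + ((P.2.2 : ℝ) - (Q.2.2 : ℝ)) ^ 2)

/-- The class of functions `f : G → [0,1]` with `|f P - f Q| ≤ d_G (P, Q)`. -/
def lipClass : Set (G → ℝ) :=
  {f | (∀ P, f P ∈ Set.Icc (0 : ℝ) 1) ∧ ∀ P Q, |f P - f Q| ≤ distG P Q}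

/-- The bounded Lipschitz distance between (probability) measures on `G`. -/
def blDist (μ ν : Measure G) : ℝ :=
  ⨆ f : lipClass, |∫ P, f.1 P ∂μ - ∫ P, f.1 P ∂ν|

/-- The empirical measure `n⁻¹ ∑ᵢ δ_{Pᵢ}` of `n` points of `G`. -/
def empiricalMeasure {n : ℕ} (p : Fin n → G) : Measure G :=
  (n : ENNReal)⁻¹ • ∑ i, Measure.dirac (p i)

/-- The triangular array `ξ` of points of `I` is asymptotically uniformly distributed:
`n⁻¹ ∑ᵢ f (ξ n i) → ∫_I f` for every continuous `f`. -/
def Equidistributed (ξ : (n : ℕ) → Fin n → I) : Prop :=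
  ∀ f : C(I, ℝ), Tendsto (fun n : ℕ => (n : ℝ)⁻¹ * ∑ i, f (ξ n i)) atTop (𝓝 (∫ x, f x))

/-- `θ` solves on `[0,T]` the Kuramoto system
`θᵢ' = wᵢ + (K / n) ∑ⱼ W (ξᵢ, ξⱼ) sin (θⱼ - θᵢ)`, `θᵢ(0) = θ⁰ᵢ`.
The derivative of a circle-valued curve is that of a real-valued lift. -/
def IsKuramotoSolution (K : ℝ) (W : I → I → ℝ) (T : ℝ) {n : ℕ} (ξ : Fin n → I)
    (w : Fin n → ℝ) (θ₀ : Fin n → Phase) (θ : Fin n → ℝ → Phase) : Prop :=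
  (∀ i, θ i 0 = θ₀ i) ∧
  ∃ ϑ : Fin n → ℝ → ℝ,
    (∀ i, ∀ t ∈ Set.Icc 0 T, (ϑ i t : Phase) = θ i t) ∧
    ∀ i, ∀ t ∈ Set.Icc 0 T,
      HasDerivWithinAt (ϑ i)
        (w i + K * (n : ℝ)⁻¹ * ∑ j, W (ξ i) (ξ j) * Real.sin (ϑ j t - ϑ i t))
        (Set.Icc 0 T) t

/-- The mean-field velocity at the point `P = (θ, ω, x)` generated by the density `r` on `G`:
`V = ω + K ∫ W (x, y) sin (φ - θ) r (φ, λ, y) dφ dλ dy`. -/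
def velocity (K : ℝ) (W : I → I → ℝ) (r : G → ℝ) (P : G) : ℝ :=
  P.2.1 + K * ∫ Q : G, W P.2.2 Q.2.2 * sinPhase (Q.1 - P.1) * r Q

/-- The derivative of a real function on the circle. -/
def derivPhase (f : Phase → ℝ) (θ : Phase) : ℝ :=
  deriv (fun s : ℝ => f (θ + (s : Phase))) 0

/-- Test functions `ψ (t, θ, ω, x)`: of class `C¹` in all variables and vanishing for large `|ω|`.
Only their values for `t ∈ [0,T]` and `x ∈ I` matter, so that no condition on the support in the
other variables is needed; the composition with `ℝ → ℝ / 2πℤ` expresses regularity in `θ`. -/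
structure IsTestFunction (ψ : ℝ → Phase → ℝ → ℝ → ℝ) : Prop where
  contDiff : ContDiff ℝ 1
    (fun p : ℝ × ℝ × ℝ × ℝ => ψ p.1 (p.2.1 : Phase) p.2.2.1 p.2.2.2)
  support : ∃ R : ℝ, ∀ t θ ω x, R < |ω| → ψ t θ ω x = 0

/-- `ρ` is a weak solution on `[0,T]`, in the class of weakly continuous curves of probability
densities on `G`, of `∂ₜ ρ + ∂_θ (ρ V) = 0`, where `V = V[ρ]` is the mean-field velocity, with
initial density `ρ₀`. -/
structure IsWeakSolution (K : ℝ) (W : I → I → ℝ) (T : ℝ) (ρ₀ : G → ℝ) (ρ : ℝ → G → ℝ) :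
    Prop where
  measurable : ∀ t ∈ Set.Icc 0 T, Measurable (ρ t)
  nonneg : ∀ t ∈ Set.Icc 0 T, ∀ P, 0 ≤ ρ t P
  integrable : ∀ t ∈ Set.Icc 0 T, Integrable (ρ t)
  integral_eq_one : ∀ t ∈ Set.Icc 0 T, ∫ P, ρ t P = 1
  weaklyContinuous : ∀ f : BoundedContinuousFunction G ℝ,
    ContinuousOn (fun t => ∫ P, f P * ρ t P) (Set.Icc 0 T)
  weak : ∀ ψ, IsTestFunction ψ → ∀ τ ∈ Set.Icc 0 T,
    ∫ P : G, ψ τ P.1 P.2.1 P.2.2 * ρ τ P =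
      (∫ P : G, ψ 0 P.1 P.2.1 P.2.2 * ρ₀ P) +
      ∫ t in (0 : ℝ)..τ, ∫ P : G,
        (deriv (fun s => ψ s P.1 P.2.1 P.2.2) t +
          velocity K W (ρ t) P * derivPhase (fun θ => ψ t θ P.2.1 P.2.2) P.1) * ρ t P

/-- The measure `μ (A) = ∫_A r dP` on `G` with density `r`. -/
def densityMeasure (r : G → ℝ) : Measure G :=
  volume.withDensity (fun P => ENNReal.ofReal (r P))

/-- The sampling of the random data. The frequencies `ω 0, ω 1, …` are IID with density `g`, and
for every `n`, conditionally on the frequencies, the `n` initial phases are independent, the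
`i`-th one having the density `q (·, ωᵢ, ξ n i)`. -/
structure IsSampled {Ω : Type*} [MeasurableSpace Ω] (Pr : Measure Ω) [IsFiniteMeasure Pr]
    (g : ℝ → ℝ) (q : Phase → ℝ → I → ℝ) (ξ : (n : ℕ) → Fin n → I)
    (ω : ℕ → Ω → ℝ) (θ₀ : (n : ℕ) → Fin n → Ω → Phase) : Prop where
  measurable_freq : ∀ i, Measurable (ω i)
  indep_freq : iIndepFun ω Pr
  law_freq : ∀ i, Pr.map (ω i) = volume.withDensity (fun s => ENNReal.ofReal (g s))
  measurable_phase : ∀ n i, Measurable (θ₀ n i)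
  condLaw_phase : ∀ n : ℕ,
    ∀ᵐ w ∂(Pr.map (fun z (i : Fin n) => ω i z)),
      condDistrib (fun z (i : Fin n) => θ₀ n i z) (fun z (i : Fin n) => ω i z) Pr w =
        Measure.pi (fun i : Fin n =>
          volume.withDensity (fun φ : Phase => ENNReal.ofReal (q φ (w i) (ξ n i))))

end

end KuramotoMF

namespace KuramotoMF

noncomputable section

/-! ### The circle -/

/-- The cosine function on the circle. -/
def cosPhase : Phase → ℝ := Real.cos_periodic.lift

@[simp] lemma sinPhase_coe (x : ℝ) : sinPhase (x : Phase) = Real.sin x := rfl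

@[simp] lemma cosPhase_coe (x : ℝ) : cosPhase (x : Phase) = Real.cos x := rfl

lemma continuous_sinPhase : Continuous sinPhase :=
  continuous_quot_lift _ Real.continuous_sin

lemma continuous_cosPhase : Continuous cosPhase :=
  continuous_quot_lift _ Real.continuous_cos

lemma abs_sinPhase_le_one (a : Phase) : |sinPhase a| ≤ 1 := by
  induction a using QuotientAddGroup.induction_on with
  | H x => exact Real.abs_sin_le_one x

lemma abs_cosPhase_le_one (a : Phase) : |cosPhase a| ≤ 1 := by
  induction a using QuotientAddGroup.induction_on with
  | H x => exact Real.abs_cos_le_one x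

lemma sinPhase_sub (a b : Phase) :
    sinPhase (a - b) = sinPhase a * cosPhase b - cosPhase a * sinPhase b := by
  induction a using QuotientAddGroup.induction_on with
  | H x =>
    induction b using QuotientAddGroup.induction_on with
    | H y => exact Real.sin_sub x y

lemma abs_sin_sub_sin_le (x y : ℝ) : |Real.sin x - Real.sin y| ≤ |x - y| := by
  have h := Real.lipschitzWith_sin.dist_le_mul x y
  simpa [Real.dist_eq] using h

lemma exists_coe_sub_eq (a b : Phase) : ∃ u : ℝ, a = b + (u : Phase) ∧ |u| = dist a b := by
  obtain ⟨x, hx⟩ := QuotientAddGroup.mk_surjective (a - b)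
  refine ⟨x - round ((2 * π)⁻¹ * x) * (2 * π), ?_, ?_⟩
  · have h : ((x - round ((2 * π)⁻¹ * x) * (2 * π) : ℝ) : Phase) = (x : Phase) := by
      rw [AddCircle.coe_sub, ← zsmul_eq_mul, AddCircle.coe_zsmul, AddCircle.coe_period]
      simp
    rw [h]
    have : ((x : ℝ) : Phase) = a - b := hx
    rw [this]; abel
  · rw [dist_eq_norm, ← hx]
    exact (AddCircle.norm_eq (2 * π)).symm

lemma abs_sinPhase_sub_le (a b : Phase) : |sinPhase a - sinPhase b| ≤ dist a b := by
  obtain ⟨u, rfl, hu⟩ := exists_coe_sub_eq a b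
  rw [← hu]
  induction b using QuotientAddGroup.induction_on with
  | H y =>
    have := abs_sin_sub_sin_le (y + u) y
    rwa [add_sub_cancel_left] at this

lemma norm_coe_phase_le (u : ℝ) : ‖(u : Phase)‖ ≤ |u| := by
  exact QuotientAddGroup.norm_mk_le_norm (S := AddSubgroup.zmultiples (2 * π)) (m := u)

lemma dist_add_coe_le (a b : Phase) (u v : ℝ) :
    dist (a + (u : Phase)) (b + (v : Phase)) ≤ dist a b + |u - v| := by
  rw [dist_eq_norm, dist_eq_norm]
  have h : a + (u : Phase) - (b + (v : Phase)) = (a - b) + ((u - v : ℝ) : Phase) := by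
    rw [AddCircle.coe_sub]; abel
  rw [h]
  exact (norm_add_le _ _).trans (by gcongr; exact norm_coe_phase_le _)

/-! ### The distance on the state space and bounded Lipschitz functions -/

lemma dist_fst_le_distG (P Q : G) : dist P.1 Q.1 ≤ distG P Q :=
  Real.le_sqrt_of_sq_le (by nlinarith [sq_nonneg (P.2.1 - Q.2.1), sq_nonneg ((P.2.2 : ℝ) - Q.2.2)])

lemma abs_freq_sub_le_distG (P Q : G) : |P.2.1 - Q.2.1| ≤ distG P Q :=
  Real.le_sqrt_of_sq_le (by
    rw [sq_abs]
    nlinarith [sq_nonneg (dist P.1 Q.1), sq_nonneg ((P.2.2 : ℝ) - Q.2.2)])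

lemma abs_pos_sub_le_distG (P Q : G) : |(P.2.2 : ℝ) - Q.2.2| ≤ distG P Q :=
  Real.le_sqrt_of_sq_le (by
    rw [sq_abs]
    nlinarith [sq_nonneg (dist P.1 Q.1), sq_nonneg (P.2.1 - Q.2.1)])

lemma distG_nonneg (P Q : G) : 0 ≤ distG P Q := Real.sqrt_nonneg _

lemma distG_le_of_fst {P Q P' Q' : G} (c : ℝ) (hc : 0 ≤ c)
    (h : dist P'.1 Q'.1 ≤ dist P.1 Q.1 + c) (h' : P'.2 = P.2) (h'' : Q'.2 = Q.2) :
    distG P' Q' ≤ distG P Q + c := by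
  have h1 := distG_nonneg P Q
  have h2 : distG P Q ^ 2 = dist P.1 Q.1 ^ 2 + (P.2.1 - Q.2.1) ^ 2 + ((P.2.2 : ℝ) - Q.2.2) ^ 2 :=
    Real.sq_sqrt (by positivity)
  have h3 := dist_fst_le_distG P Q
  have h4 : 0 ≤ dist P'.1 Q'.1 := dist_nonneg
  refine Real.sqrt_le_iff.mpr ⟨by positivity, ?_⟩
  rw [h', h'']
  nlinarith

lemma distG_eq_dist_fst (a b : Phase) (p : ℝ × I) : distG (a, p) (b, p) = dist a b := by
  simp [distG, Real.sqrt_sq dist_nonneg]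

lemma distG_le_add (P Q : G) :
    distG P Q ≤ dist P.1 Q.1 + |P.2.1 - Q.2.1| + |(P.2.2 : ℝ) - Q.2.2| := by
  refine Real.sqrt_le_iff.mpr ⟨by positivity, ?_⟩
  have h1 : 0 ≤ dist P.1 Q.1 := dist_nonneg
  nlinarith [sq_abs (P.2.1 - Q.2.1), sq_abs ((P.2.2 : ℝ) - Q.2.2), abs_nonneg (P.2.1 - Q.2.1),
    abs_nonneg ((P.2.2 : ℝ) - Q.2.2), mul_nonneg h1 (abs_nonneg (P.2.1 - Q.2.1)),
    mul_nonneg h1 (abs_nonneg ((P.2.2 : ℝ) - Q.2.2)),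
    mul_nonneg (abs_nonneg (P.2.1 - Q.2.1)) (abs_nonneg ((P.2.2 : ℝ) - Q.2.2))]

lemma distG_le_mul_dist (P Q : G) : distG P Q ≤ 3 * dist P Q := by
  have h := distG_le_add P Q
  have h1 : dist P.1 Q.1 ≤ dist P Q := le_max_left _ _
  have h0 : dist P.2 Q.2 ≤ dist P Q := le_max_right _ _
  have h2 : |P.2.1 - Q.2.1| ≤ dist P.2 Q.2 := le_max_left _ _
  have h3 : |(P.2.2 : ℝ) - Q.2.2| ≤ dist P.2 Q.2 := le_max_right _ _
  linarith

lemma continuous_of_distG {F : G → ℝ} {c : ℝ} (h : ∀ P Q, |F P - F Q| ≤ c * distG P Q) :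
    Continuous F := by
  have : LipschitzWith (Real.toNNReal (3 * |c|)) F := by
    refine LipschitzWith.of_dist_le' fun P Q => ?_
    rw [Real.dist_eq]
    calc |F P - F Q| ≤ c * distG P Q := h P Q
      _ ≤ |c| * distG P Q := mul_le_mul_of_nonneg_right (le_abs_self c) (distG_nonneg _ _)
      _ ≤ |c| * (3 * dist P Q) := mul_le_mul_of_nonneg_left (distG_le_mul_dist _ _) (abs_nonneg c)
      _ = 3 * |c| * dist P Q := by ring
  exact this.continuous

lemma continuous_of_mem_lipClass {f : G → ℝ} (hf : f ∈ lipClass) : Continuous f :=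
  continuous_of_distG (c := 1) (by simpa using hf.2)

lemma integrable_of_abs_le {α : Type*} [MeasurableSpace α] {μ : Measure α} [IsFiniteMeasure μ]
    {F : α → ℝ} (hF : AEStronglyMeasurable F μ) {c : ℝ} (h : ∀ P, |F P| ≤ c) : Integrable F μ :=
  Integrable.of_bound hF c (Eventually.of_forall h)

lemma abs_integral_le_of_abs_le {α : Type*} [MeasurableSpace α] {μ : Measure α}
    [IsProbabilityMeasure μ] {F : α → ℝ} {c : ℝ} (h : ∀ P, |F P| ≤ c) : |∫ P, F P ∂μ| ≤ c := by
  simpa using norm_integral_le_of_norm_le_const (μ := μ) (f := F) (Eventually.of_forall h)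

lemma abs_le_one_of_mem_lipClass {f : G → ℝ} (hf : f ∈ lipClass) (P : G) : |f P| ≤ 1 :=
  abs_le.mpr ⟨by linarith [(hf.1 P).1], (hf.1 P).2⟩

lemma zero_mem_lipClass : (fun _ => 0 : G → ℝ) ∈ lipClass :=
  ⟨fun _ => by simp, fun P Q => by simpa using distG_nonneg P Q⟩

instance : Nonempty lipClass := ⟨⟨_, zero_mem_lipClass⟩⟩

lemma bddAbove_blDist (μ ν : Measure G) [IsProbabilityMeasure μ] [IsProbabilityMeasure ν] :
    BddAbove (Set.range fun f : lipClass => |∫ P, f.1 P ∂μ - ∫ P, f.1 P ∂ν|) := by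
  refine ⟨2, ?_⟩
  rintro _ ⟨f, rfl⟩
  have h1 := abs_integral_le_of_abs_le (μ := μ) (abs_le_one_of_mem_lipClass f.2)
  have h2 := abs_integral_le_of_abs_le (μ := ν) (abs_le_one_of_mem_lipClass f.2)
  exact (abs_sub _ _).trans (by linarith)

lemma abs_integral_sub_le_blDist (μ ν : Measure G) [IsProbabilityMeasure μ]
    [IsProbabilityMeasure ν] {f : G → ℝ} (hf : f ∈ lipClass) :
    |∫ P, f P ∂μ - ∫ P, f P ∂ν| ≤ blDist μ ν :=
  le_ciSup (bddAbove_blDist μ ν) ⟨f, hf⟩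

lemma blDist_le {μ ν : Measure G} {c : ℝ}
    (h : ∀ f ∈ lipClass, |∫ P, f P ∂μ - ∫ P, f P ∂ν| ≤ c) : blDist μ ν ≤ c :=
  ciSup_le fun f => h f.1 f.2

lemma blDist_nonneg (μ ν : Measure G) : 0 ≤ blDist μ ν :=
  Real.iSup_nonneg fun _ => abs_nonneg _

lemma div_mem_lipClass {F : G → ℝ} {c : ℝ} (hc : 0 < c) (h0 : ∀ P, F P ∈ Set.Icc 0 c)
    (h : ∀ P Q, |F P - F Q| ≤ c * distG P Q) : (fun P => F P / c) ∈ lipClass := by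
  refine ⟨fun P => ⟨div_nonneg (h0 P).1 hc.le, (div_le_one hc).mpr (h0 P).2⟩, fun P Q => ?_⟩
  rw [← sub_div, abs_div, abs_of_pos hc, div_le_iff₀ hc]
  linarith [h P Q]

lemma abs_integral_sub_le_mul_blDist (μ ν : Measure G) [IsProbabilityMeasure μ]
    [IsProbabilityMeasure ν] {F : G → ℝ} {c : ℝ} (hc : 0 ≤ c) (hb : ∀ P, |F P| ≤ c)
    (h : ∀ P Q, |F P - F Q| ≤ 2 * c * distG P Q) :
    |∫ P, F P ∂μ - ∫ P, F P ∂ν| ≤ 2 * c * blDist μ ν := by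
  rcases hc.eq_or_lt with rfl | hc
  · have : F = fun _ => 0 := by
      funext P; exact abs_eq_zero.mp (le_antisymm (hb P) (abs_nonneg _))
    simp [this]
  have hm : (fun P => (F P + c) / (2 * c)) ∈ lipClass := by
    refine div_mem_lipClass (by positivity) (fun P => ?_) (fun P Q => ?_)
    · have := abs_le.mp (hb P)
      exact ⟨by linarith, by linarith⟩
    · simpa using h P Q
  have hF : ∀ η : Measure G, IsProbabilityMeasure η →
      ∫ P, (F P + c) / (2 * c) ∂η = (∫ P, F P ∂η + c) / (2 * c) := by
    intro η _
    rw [integral_div, integral_add]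
    · simp
    · exact integrable_of_abs_le (continuous_of_distG h).aestronglyMeasurable hb
    · exact integrable_const _
  have := abs_integral_sub_le_blDist μ ν hm
  rw [hF μ inferInstance, hF ν inferInstance, ← sub_div, abs_div, abs_of_pos (by positivity : 0 < 2 * c),
    div_le_iff₀ (by positivity)] at this
  calc _ = |∫ P, F P ∂μ + c - (∫ P, F P ∂ν + c)| := by congr 1; ring
    _ ≤ _ := by linarith

/-! ### The interaction kernel and the velocity generated by a measure -/

/-- `W` is bounded and Lipschitz continuous with constant `B`. -/
structure KernelBound (W : I → I → ℝ) (B : ℝ) : Prop where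
  bound : ∀ x y, |W x y| ≤ B
  lip : ∀ x₁ y₁ x₂ y₂ : I,
    |W x₁ y₁ - W x₂ y₂| ≤ B * (|(x₁ : ℝ) - x₂| + |(y₁ : ℝ) - y₂|)

lemma exists_kernelBound (W : I → I → ℝ) (L : ℝ) (hW : ∀ x₁ y₁ x₂ y₂ : I, |W x₁ y₁ - W x₂ y₂| ≤
      L * √(((x₁ : ℝ) - (x₂ : ℝ)) ^ 2 + ((y₁ : ℝ) - (y₂ : ℝ)) ^ 2)) : ∃ B, KernelBound W B := by
  have key : ∀ x₁ y₁ x₂ y₂ : I,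
      |W x₁ y₁ - W x₂ y₂| ≤ |L| * (|(x₁ : ℝ) - x₂| + |(y₁ : ℝ) - y₂|) := by
    intro x₁ y₁ x₂ y₂
    refine (hW _ _ _ _).trans (mul_le_mul (le_abs_self L) ?_ (Real.sqrt_nonneg _) (abs_nonneg _))
    refine Real.sqrt_le_iff.mpr ⟨by positivity, ?_⟩
    nlinarith [sq_abs ((x₁ : ℝ) - x₂), sq_abs ((y₁ : ℝ) - y₂), mul_nonneg
      (abs_nonneg ((x₁ : ℝ) - x₂)) (abs_nonneg ((y₁ : ℝ) - y₂))]
  refine ⟨|W 0 0| + 2 * |L|, fun x y => ?_, fun x₁ y₁ x₂ y₂ => ?_⟩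
  · have h := key x y 0 0
    have hx : |(x : ℝ) - (0 : I)| ≤ 1 := by
      simpa [abs_of_nonneg x.2.1] using x.2.2
    have hy : |(y : ℝ) - (0 : I)| ≤ 1 := by
      simpa [abs_of_nonneg y.2.1] using y.2.2
    have h2 : |W x y| ≤ |W x y - W 0 0| + |W 0 0| := by
      simpa using abs_add_le (W x y - W 0 0) (W 0 0)
    nlinarith [abs_nonneg L]
  · refine (key x₁ y₁ x₂ y₂).trans ?_
    gcongr
    nlinarith [abs_nonneg L, abs_nonneg (W 0 0)]

namespace KernelBound

variable {W : I → I → ℝ} {B : ℝ}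

lemma nonneg (hW : KernelBound W B) : 0 ≤ B := (abs_nonneg _).trans (hW.bound 0 0)

lemma continuous (hW : KernelBound W B) : Continuous fun p : I × I => W p.1 p.2 := by
  have : LipschitzWith (Real.toNNReal (2 * B)) fun p : I × I => W p.1 p.2 := by
    refine LipschitzWith.of_dist_le' fun p q => ?_
    rw [Real.dist_eq]
    refine (hW.lip _ _ _ _).trans ?_
    have h1 : |(p.1 : ℝ) - q.1| ≤ dist p q := le_max_left _ _
    have h2 : |(p.2 : ℝ) - q.2| ≤ dist p q := le_max_right _ _
    nlinarith [hW.nonneg]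
  exact this.continuous

end KernelBound

/-- The interaction of an oscillator at `P` with an oscillator at `Q`. -/
def coupling (W : I → I → ℝ) (P Q : G) : ℝ := W P.2.2 Q.2.2 * sinPhase (Q.1 - P.1)

/-- The mean coupling of an oscillator at `P` with oscillators distributed according to `μ`. -/
def drift (W : I → I → ℝ) (μ : Measure G) (P : G) : ℝ := ∫ Q, coupling W P Q ∂μ

/-- The velocity at `P` generated by the measure `μ`. -/
def vel (K : ℝ) (W : I → I → ℝ) (μ : Measure G) (P : G) : ℝ := P.2.1 + K * drift W μ P

section coupling

variable {K : ℝ} {W : I → I → ℝ} {B : ℝ}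

lemma continuous_coupling (hW : KernelBound W B) :
    Continuous fun p : G × G => coupling W p.1 p.2 := by
  unfold coupling
  refine Continuous.mul ?_ (continuous_sinPhase.comp (by fun_prop))
  exact hW.continuous.comp (f := fun p : G × G => (p.1.2.2, p.2.2.2)) (by fun_prop)

lemma abs_coupling_le (hW : KernelBound W B) (P Q : G) : |coupling W P Q| ≤ B := by
  rw [coupling, abs_mul]
  calc _ ≤ B * 1 := mul_le_mul (hW.bound _ _) (abs_sinPhase_le_one _) (abs_nonneg _) hW.nonneg
    _ = B := mul_one B

lemma abs_coupling_sub_le (hW : KernelBound W B) (P Q P' Q' : G) :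
    |coupling W P Q - coupling W P' Q'| ≤
      B * (dist P.1 P'.1 + |(P.2.2 : ℝ) - P'.2.2| + (dist Q.1 Q'.1 + |(Q.2.2 : ℝ) - Q'.2.2|)) := by
  have h1 : coupling W P Q - coupling W P' Q' =
      (W P.2.2 Q.2.2 - W P'.2.2 Q'.2.2) * sinPhase (Q.1 - P.1) +
      W P'.2.2 Q'.2.2 * (sinPhase (Q.1 - P.1) - sinPhase (Q'.1 - P'.1)) := by
    unfold coupling; ring
  have h2 : dist (Q.1 - P.1) (Q'.1 - P'.1) ≤ dist Q.1 Q'.1 + dist P.1 P'.1 :=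
    dist_sub_sub_le _ _ _ _
  rw [h1]
  refine (abs_add_le _ _).trans ?_
  rw [abs_mul, abs_mul]
  have h3 := hW.lip P.2.2 Q.2.2 P'.2.2 Q'.2.2
  have h4 := abs_sinPhase_le_one (Q.1 - P.1)
  have h5 := hW.bound P'.2.2 Q'.2.2
  have h6 := (abs_sinPhase_sub_le (Q.1 - P.1) (Q'.1 - P'.1)).trans h2
  have h7 := mul_le_mul h3 h4 (abs_nonneg _) ((abs_nonneg _).trans h3)
  have h8 := mul_le_mul h5 h6 (abs_nonneg _) hW.nonneg
  linarith

lemma abs_coupling_sub_left_le (hW : KernelBound W B) (P P' Q : G) :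
    |coupling W P Q - coupling W P' Q| ≤ B * (dist P.1 P'.1 + |(P.2.2 : ℝ) - P'.2.2|) := by
  simpa using abs_coupling_sub_le hW P Q P' Q

lemma abs_coupling_sub_right_le (hW : KernelBound W B) (P Q Q' : G) :
    |coupling W P Q - coupling W P Q'| ≤ B * (dist Q.1 Q'.1 + |(Q.2.2 : ℝ) - Q'.2.2|) := by
  simpa using abs_coupling_sub_le hW P Q P Q'

lemma abs_coupling_sub_right_le_distG (hW : KernelBound W B) (P Q Q' : G) :
    |coupling W P Q - coupling W P Q'| ≤ 2 * B * distG Q Q' := by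
  refine (abs_coupling_sub_right_le hW P Q Q').trans ?_
  nlinarith [dist_fst_le_distG Q Q', abs_pos_sub_le_distG Q Q', hW.nonneg]

lemma integrable_coupling (hW : KernelBound W B) (μ : Measure G) [IsFiniteMeasure μ] (P : G) :
    Integrable (coupling W P) μ :=
  integrable_of_abs_le ((continuous_coupling hW).comp (by fun_prop :
    Continuous fun Q : G => (P, Q))).aestronglyMeasurable (abs_coupling_le hW P)

variable (μ ν : Measure G) [IsProbabilityMeasure μ] [IsProbabilityMeasure ν]

lemma abs_drift_le (hW : KernelBound W B) (P : G) : |drift W μ P| ≤ B :=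
  abs_integral_le_of_abs_le (abs_coupling_le hW P)

lemma abs_drift_sub_le (hW : KernelBound W B) (P P' : G) :
    |drift W μ P - drift W μ P'| ≤ B * (dist P.1 P'.1 + |(P.2.2 : ℝ) - P'.2.2|) := by
  rw [drift, drift, ← integral_sub (integrable_coupling hW μ P) (integrable_coupling hW μ P')]
  exact abs_integral_le_of_abs_le (abs_coupling_sub_left_le hW P P')

lemma abs_drift_sub_le_distG (hW : KernelBound W B) (P P' : G) :
    |drift W μ P - drift W μ P'| ≤ 2 * B * distG P P' := by
  refine (abs_drift_sub_le μ hW P P').trans ?_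
  nlinarith [dist_fst_le_distG P P', abs_pos_sub_le_distG P P', hW.nonneg]

lemma continuous_drift (hW : KernelBound W B) : Continuous (drift W μ) :=
  continuous_of_distG (abs_drift_sub_le_distG μ hW)

lemma continuous_vel (hW : KernelBound W B) : Continuous (vel K W μ) := by
  have := continuous_drift μ hW
  unfold vel
  fun_prop

lemma abs_vel_sub_le_distG (hW : KernelBound W B) (P P' : G) :
    |vel K W μ P - vel K W μ P'| ≤ (1 + 2 * |K| * B) * distG P P' := by
  have h : vel K W μ P - vel K W μ P' =
      (P.2.1 - P'.2.1) + K * (drift W μ P - drift W μ P') := by unfold vel; ring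
  rw [h]
  refine (abs_add_le _ _).trans ?_
  rw [abs_mul]
  nlinarith [abs_freq_sub_le_distG P P',
    mul_le_mul_of_nonneg_left (abs_drift_sub_le_distG μ hW P P') (abs_nonneg K)]

lemma abs_drift_sub_drift_le (hW : KernelBound W B) (P : G) :
    |drift W μ P - drift W ν P| ≤ 2 * B * blDist μ ν :=
  abs_integral_sub_le_mul_blDist μ ν hW.nonneg (abs_coupling_le hW P)
    (abs_coupling_sub_right_le_distG hW P)

lemma abs_vel_sub_vel_le (hW : KernelBound W B) (P : G) :
    |vel K W μ P - vel K W ν P| ≤ 2 * |K| * B * blDist μ ν := by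
  have h : vel K W μ P - vel K W ν P = K * (drift W μ P - drift W ν P) := by unfold vel; ring
  rw [h, abs_mul]
  nlinarith [mul_le_mul_of_nonneg_left (abs_drift_sub_drift_le μ ν hW P) (abs_nonneg K)]

end coupling

/-! ### Stability of curves of measures that are consistent with Euler steps -/

/-- A `C¹` cutoff function. -/
structure IsCutoff (χ : ℝ → ℝ) : Prop where
  contDiff : ContDiff ℝ 1 χ
  nonneg : ∀ s, 0 ≤ χ s
  le_one : ∀ s, χ s ≤ 1
  support : ∃ R, 0 ≤ R ∧ ∀ s, R < |s| → χ s = 0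

/-- One Euler step of length `h` along the velocity generated by `μ`. -/
def eulerMap (K : ℝ) (W : I → I → ℝ) (μ : Measure G) (h : ℝ) (P : G) : G :=
  (P.1 + ((h * vel K W μ P : ℝ) : Phase), P.2)

/-- Up to an error `o(h)`, uniform in the time and the observable, the curve `μ` of measures is
transported by Euler steps. -/
def EulerConsistent (K : ℝ) (W : I → I → ℝ) (T : ℝ) (χ : ℝ → ℝ) (μ : ℝ → Measure G) : Prop :=
  ∀ ε > 0, ∃ h₀ > 0, ∀ t h, 0 ≤ t → 0 < h → h ≤ h₀ → t + h ≤ T → ∀ f ∈ lipClass,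
    |∫ P, χ P.2.1 * f P ∂(μ (t + h)) - ∫ P, χ P.2.1 * f (eulerMap K W (μ t) h P) ∂(μ t)| ≤ ε * h

/-- The bounded Lipschitz distance seen through the cutoff `χ` of the frequencies. -/
def cutDist (χ : ℝ → ℝ) (μ ν : Measure G) : ℝ :=
  ⨆ f : lipClass, |∫ P, χ P.2.1 * f.1 P ∂μ - ∫ P, χ P.2.1 * f.1 P ∂ν|

lemma discrete_gronwall {a : ℕ → ℝ} {x b : ℝ} (hx : 0 ≤ x) (hb : 0 ≤ b) (ha : 0 ≤ a 0) (N : ℕ)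
    (h : ∀ k < N, a (k + 1) ≤ (1 + x) * a k + b) :
    a N ≤ Real.exp (x * N) * (a 0 + N * b) := by
  induction N with
  | zero => simp
  | succ k ih =>
    have ih := ih fun j hj => h j (by omega)
    have h1 := h k (by omega)
    have h2 : 1 + x ≤ Real.exp x := by linarith [Real.add_one_le_exp x]
    have h3 : Real.exp (x * (k + 1 : ℕ)) = Real.exp x * Real.exp (x * k) := by
      rw [← Real.exp_add]; congr 1; push_cast; ring
    have h4 : 1 ≤ Real.exp x * Real.exp (x * k) := by
      rw [← Real.exp_add]; exact Real.one_le_exp (by positivity)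
    rw [h3]
    push_cast
    have h5 : 0 ≤ Real.exp (x * k) * (a 0 + k * b) := by positivity
    nlinarith [mul_le_mul_of_nonneg_left ih (by linarith : 0 ≤ 1 + x),
      mul_le_mul_of_nonneg_right h2 h5, mul_le_mul_of_nonneg_right h4 hb]

section

variable {K : ℝ} {W : I → I → ℝ} {B : ℝ} {χ : ℝ → ℝ}

lemma continuous_eulerMap (hW : KernelBound W B) (μ : Measure G) [IsProbabilityMeasure μ] (h : ℝ) :
    Continuous (eulerMap K W μ h) := by
  have := continuous_vel (K := K) μ hW
  unfold eulerMap
  exact (continuous_fst.add ((AddCircle.continuous_mk' _).comp (by fun_prop))).prodMk continuous_snd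

lemma distG_eulerMap_le (hW : KernelBound W B) (μ : Measure G) [IsProbabilityMeasure μ] {h : ℝ}
    (hh : 0 ≤ h) (P Q : G) :
    distG (eulerMap K W μ h P) (eulerMap K W μ h Q) ≤ (1 + (1 + 2 * |K| * B) * h) * distG P Q := by
  have hB := hW.nonneg
  have h1 := abs_vel_sub_le_distG (K := K) μ hW P Q
  have h2 : distG (eulerMap K W μ h P) (eulerMap K W μ h Q) ≤
      distG P Q + h * ((1 + 2 * |K| * B) * distG P Q) := by
    have hd := distG_nonneg P Q
    refine distG_le_of_fst _ (by positivity) ?_ rfl rfl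
    refine (dist_add_coe_le _ _ _ _).trans ?_
    rw [← mul_sub, abs_mul, abs_of_nonneg hh]
    gcongr
  linarith

lemma abs_cutoff_mul_le (hχ : IsCutoff χ) {f : G → ℝ} {c : ℝ} (h : ∀ P, |f P| ≤ c) (P : G) :
    |χ P.2.1 * f P| ≤ c := by
  rw [abs_mul, abs_of_nonneg (hχ.nonneg _)]
  calc _ ≤ 1 * |f P| := mul_le_mul_of_nonneg_right (hχ.le_one _) (abs_nonneg _)
    _ ≤ c := by simpa using h P

lemma IsCutoff.continuous_freq (hχ : IsCutoff χ) : Continuous fun P : G => χ P.2.1 :=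
  hχ.contDiff.continuous.comp (by fun_prop)

lemma integrable_cutoff_mul (hχ : IsCutoff χ) {f : G → ℝ} (hf : Continuous f) {c : ℝ}
    (h : ∀ P, |f P| ≤ c) (μ : Measure G) [IsProbabilityMeasure μ] :
    Integrable (fun P => χ P.2.1 * f P) μ :=
  integrable_of_abs_le (hχ.continuous_freq.mul hf).aestronglyMeasurable (abs_cutoff_mul_le hχ h)

lemma bddAbove_cutDist (hχ : IsCutoff χ) (μ ν : Measure G) [IsProbabilityMeasure μ]
    [IsProbabilityMeasure ν] : BddAbove (Set.range fun f : lipClass =>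
      |∫ P, χ P.2.1 * f.1 P ∂μ - ∫ P, χ P.2.1 * f.1 P ∂ν|) := by
  refine ⟨2, ?_⟩
  rintro _ ⟨f, rfl⟩
  have h := abs_cutoff_mul_le hχ (abs_le_one_of_mem_lipClass f.2)
  have h1 := abs_integral_le_of_abs_le (μ := μ) h
  have h2 := abs_integral_le_of_abs_le (μ := ν) h
  exact (abs_sub _ _).trans (by linarith)

lemma abs_integral_sub_le_cutDist (hχ : IsCutoff χ) (μ ν : Measure G) [IsProbabilityMeasure μ]
    [IsProbabilityMeasure ν] {f : G → ℝ} (hf : f ∈ lipClass) :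
    |∫ P, χ P.2.1 * f P ∂μ - ∫ P, χ P.2.1 * f P ∂ν| ≤ cutDist χ μ ν :=
  le_ciSup (bddAbove_cutDist hχ μ ν) ⟨f, hf⟩

lemma cutDist_le {μ ν : Measure G} {c : ℝ}
    (h : ∀ f ∈ lipClass, |∫ P, χ P.2.1 * f P ∂μ - ∫ P, χ P.2.1 * f P ∂ν| ≤ c) :
    cutDist χ μ ν ≤ c :=
  ciSup_le fun f => h f.1 f.2

lemma cutDist_nonneg (μ ν : Measure G) : 0 ≤ cutDist χ μ ν :=
  Real.iSup_nonneg fun _ => abs_nonneg _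

lemma abs_integral_sub_cutoff_le (hχ : IsCutoff χ) (μ : Measure G) [IsProbabilityMeasure μ]
    {f : G → ℝ} (hf : f ∈ lipClass) :
    |∫ P, f P ∂μ - ∫ P, χ P.2.1 * f P ∂μ| ≤ 1 - ∫ P, χ P.2.1 ∂μ := by
  have hfc := continuous_of_mem_lipClass hf
  have hf1 := abs_le_one_of_mem_lipClass hf
  have hi : Integrable (fun P : G => χ P.2.1) μ :=
    integrable_of_abs_le hχ.continuous_freq.aestronglyMeasurable (c := 1) fun P => by
      rw [abs_of_nonneg (hχ.nonneg _)]; exact hχ.le_one _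
  have h1 : 1 - ∫ P, χ P.2.1 ∂μ = ∫ P, (1 - χ P.2.1) ∂μ := by
    rw [integral_sub (integrable_const _) hi]; simp
  have hif : Integrable f μ := integrable_of_abs_le hfc.aestronglyMeasurable hf1
  have hig := integrable_cutoff_mul hχ hfc hf1 μ
  rw [← integral_sub hif hig, h1]
  refine (abs_integral_le_integral_abs).trans
    (integral_mono (hif.sub hig).abs ((integrable_const _).sub hi) fun P => ?_)
  have h2 : f P - χ P.2.1 * f P = (1 - χ P.2.1) * f P := by ring
  have h3 := hχ.le_one P.2.1
  simp only
  rw [h2, abs_mul, abs_of_nonneg (by linarith)]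
  nlinarith [hf1 P]

lemma blDist_le_cutDist_add (hχ : IsCutoff χ) (μ ν : Measure G) [IsProbabilityMeasure μ]
    [IsProbabilityMeasure ν] :
    blDist μ ν ≤ cutDist χ μ ν + ((1 - ∫ P, χ P.2.1 ∂μ) + (1 - ∫ P, χ P.2.1 ∂ν)) :=
  blDist_le fun f hf => by
    have h1 := abs_integral_sub_cutoff_le hχ μ hf
    have h2 := abs_integral_sub_cutoff_le hχ ν hf
    have h3 := abs_integral_sub_le_cutDist hχ μ ν hf
    rw [abs_le] at *
    constructor <;> linarith

lemma cutDist_le_blDist_add (hχ : IsCutoff χ) (μ ν : Measure G) [IsProbabilityMeasure μ]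
    [IsProbabilityMeasure ν] :
    cutDist χ μ ν ≤ blDist μ ν + ((1 - ∫ P, χ P.2.1 ∂μ) + (1 - ∫ P, χ P.2.1 ∂ν)) :=
  cutDist_le fun f hf => by
    have h1 := abs_integral_sub_cutoff_le hχ μ hf
    have h2 := abs_integral_sub_cutoff_le hχ ν hf
    have h3 := abs_integral_sub_le_blDist μ ν hf
    rw [abs_le] at *
    constructor <;> linarith

lemma abs_integral_sub_le_mul_cutDist (hχ : IsCutoff χ) (μ ν : Measure G) [IsProbabilityMeasure μ]
    [IsProbabilityMeasure ν] {F : G → ℝ} {c : ℝ} (hc : 1 ≤ c) (h0 : ∀ P, F P ∈ Set.Icc (0 : ℝ) 1)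
    (h : ∀ P Q, |F P - F Q| ≤ c * distG P Q) :
    |∫ P, χ P.2.1 * F P ∂μ - ∫ P, χ P.2.1 * F P ∂ν| ≤ c * cutDist χ μ ν := by
  have hc0 : 0 < c := by linarith
  have hm := div_mem_lipClass hc0 (fun P => ⟨(h0 P).1, (h0 P).2.trans hc⟩) h
  have := abs_integral_sub_le_cutDist hχ μ ν hm
  simp_rw [← mul_div_assoc, integral_div] at this
  rw [← sub_div, abs_div, abs_of_pos hc0, div_le_iff₀ hc0] at this
  linarith

lemma abs_integral_eulerMap_sub_le (hW : KernelBound W B) (hχ : IsCutoff χ) (μ ν : Measure G)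
    [IsProbabilityMeasure μ] [IsProbabilityMeasure ν] {h : ℝ} (hh : 0 ≤ h) {f : G → ℝ}
    (hf : f ∈ lipClass) :
    |∫ P, χ P.2.1 * f (eulerMap K W μ h P) ∂μ - ∫ P, χ P.2.1 * f (eulerMap K W ν h P) ∂ν| ≤
      (1 + (1 + 2 * |K| * B) * h) * cutDist χ μ ν + h * (2 * |K| * B * blDist μ ν) := by
  have hB := hW.nonneg
  have h1 : |∫ P, χ P.2.1 * f (eulerMap K W μ h P) ∂μ -
      ∫ P, χ P.2.1 * f (eulerMap K W μ h P) ∂ν| ≤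
        (1 + (1 + 2 * |K| * B) * h) * cutDist χ μ ν := by
    refine abs_integral_sub_le_mul_cutDist hχ μ ν ?_ (fun P => hf.1 _) fun P Q => ?_
    · have : 0 ≤ (1 + 2 * |K| * B) * h := by positivity
      linarith
    · exact (hf.2 _ _).trans (distG_eulerMap_le hW μ hh P Q)
  have hc := continuous_of_mem_lipClass hf
  have hb := abs_le_one_of_mem_lipClass hf
  have h2 : |∫ P, χ P.2.1 * f (eulerMap K W μ h P) ∂ν -
      ∫ P, χ P.2.1 * f (eulerMap K W ν h P) ∂ν| ≤ h * (2 * |K| * B * blDist μ ν) := by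
    have hi : ∀ (η : Measure G) [IsProbabilityMeasure η],
        Integrable (fun P => χ P.2.1 * f (eulerMap K W η h P)) ν := fun η _ =>
      integrable_cutoff_mul hχ (hc.comp (continuous_eulerMap hW η h)) (fun P => hb _) ν
    rw [← integral_sub (hi μ) (hi ν)]
    simp_rw [← mul_sub]
    refine abs_integral_le_of_abs_le (abs_cutoff_mul_le hχ fun P => ?_)
    refine (hf.2 _ _).trans ?_
    have h3 : distG (eulerMap K W μ h P) (eulerMap K W ν h P) ≤
        |h * vel K W μ P - h * vel K W ν P| := by
      unfold eulerMap
      rw [distG_eq_dist_fst]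
      simpa using dist_add_coe_le P.1 P.1 (h * vel K W μ P) (h * vel K W ν P)
    refine h3.trans ?_
    rw [← mul_sub, abs_mul, abs_of_nonneg hh]
    exact mul_le_mul_of_nonneg_left (abs_vel_sub_vel_le μ ν hW P) hh
  calc _ ≤ _ := abs_sub_le _ _ _
    _ ≤ _ := add_le_add h1 h2

/-- Two Euler consistent curves of probability measures stay close if they start close and have
small tails. -/
theorem cutDist_le_of_eulerConsistent (hW : KernelBound W B) (hχ : IsCutoff χ) {T : ℝ}
    {μ ν : ℝ → Measure G} (hμ : ∀ t ∈ Set.Icc 0 T, IsProbabilityMeasure (μ t))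
    (hν : ∀ t ∈ Set.Icc 0 T, IsProbabilityMeasure (ν t))
    (hμs : EulerConsistent K W T χ μ) (hνs : EulerConsistent K W T χ ν) {κ : ℝ}
    (hμκ : ∀ t ∈ Set.Icc 0 T, 1 - ∫ P, χ P.2.1 ∂(μ t) ≤ κ)
    (hνκ : ∀ t ∈ Set.Icc 0 T, 1 - ∫ P, χ P.2.1 ∂(ν t) ≤ κ) {t : ℝ} (ht : t ∈ Set.Icc 0 T) :
    cutDist χ (μ t) (ν t) ≤ Real.exp (2 * (1 + 2 * |K| * B) * t) *
      (cutDist χ (μ 0) (ν 0) + t * (2 * (1 + 2 * |K| * B) * κ)) := by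
  have hB := hW.nonneg
  set C := 1 + 2 * |K| * B with hC
  have hC1 : 2 * |K| * B ≤ C := by simp [hC]
  have hC0 : 0 ≤ 2 * |K| * B := by positivity
  rcases ht.1.eq_or_lt with rfl | ht0
  · simp
  have hκ0 : 0 ≤ κ := by
    have := hμ t ht
    refine le_trans ?_ (hμκ t ht)
    have := abs_integral_le_of_abs_le (μ := μ t) (F := fun P => χ P.2.1) (c := 1) fun P => by
      rw [abs_of_nonneg (hχ.nonneg _)]; exact hχ.le_one _
    linarith [(abs_le.mp this).2]
  have key : ∀ ε > 0, cutDist χ (μ t) (ν t) ≤ Real.exp (2 * C * t) *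
      (cutDist χ (μ 0) (ν 0) + t * (2 * C * κ + 2 * ε)) := by
    intro ε hε
    obtain ⟨h₁, hh₁, H₁⟩ := hμs ε hε
    obtain ⟨h₂, hh₂, H₂⟩ := hνs ε hε
    obtain ⟨N, hN⟩ := exists_nat_gt (t / min h₁ h₂)
    have hm : 0 < min h₁ h₂ := lt_min hh₁ hh₂
    have hN0 : (0 : ℝ) < N := lt_of_le_of_lt (by positivity) hN
    set h := t / N with hh
    have hpos : 0 < h := by positivity
    have hNh : N * h = t := by rw [hh]; field_simp
    have hle : h ≤ min h₁ h₂ := by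
      rw [div_lt_iff₀ hm] at hN
      rw [hh, div_le_iff₀ hN0]; linarith
    have G := discrete_gronwall (a := fun k : ℕ => cutDist χ (μ (k * h)) (ν (k * h)))
      (x := 2 * C * h) (b := h * (2 * C * κ + 2 * ε)) (by positivity) (by positivity)
      (cutDist_nonneg _ _) N ?_
    · simp only [hNh, Nat.cast_zero, zero_mul] at G
      have e1 : 2 * C * h * N = 2 * C * t := by rw [← hNh]; ring
      have e2 : N * (h * (2 * C * κ + 2 * ε)) = t * (2 * C * κ + 2 * ε) := by rw [← hNh]; ring
      rwa [e1, e2] at G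
    · intro k hk
      have hk' : (k : ℝ) + 1 ≤ N := by exact_mod_cast hk
      have ek : ((k + 1 : ℕ) : ℝ) * h = k * h + h := by push_cast; ring
      have hk0 : 0 ≤ k * h := by positivity
      have hkT : k * h + h ≤ T := by
        refine le_trans ?_ ht.2
        rw [← hNh]; nlinarith
      have hmem : k * h ∈ Set.Icc 0 T := ⟨hk0, by linarith⟩
      have := hμ _ hmem
      have := hν _ hmem
      simp only [ek]
      refine cutDist_le fun f hf => ?_
      have s1 := H₁ (k * h) h hk0 hpos (hle.trans (min_le_left _ _)) hkT f hf
      have s2 := H₂ (k * h) h hk0 hpos (hle.trans (min_le_right _ _)) hkT f hf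
      have s3 := abs_integral_eulerMap_sub_le (K := K) hW hχ (μ (k * h)) (ν (k * h)) hpos.le hf
      have s4 := blDist_le_cutDist_add hχ (μ (k * h)) (ν (k * h))
      have s5 := hμκ _ hmem
      have s6 := hνκ _ hmem
      have s7 := cutDist_nonneg (χ := χ) (μ (k * h)) (ν (k * h))
      have s8 : 2 * |K| * B * blDist (μ (k * h)) (ν (k * h)) ≤
          C * (cutDist χ (μ (k * h)) (ν (k * h)) + 2 * κ) := by
        refine mul_le_mul hC1 (by linarith) (blDist_nonneg _ _) (by linarith)
      have s9 := mul_le_mul_of_nonneg_left s8 hpos.le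
      rw [abs_le] at *
      constructor <;> nlinarith
  refine le_of_forall_pos_le_add fun δ hδ => ?_
  have hE := Real.exp_pos (2 * C * t)
  have := key (δ / (2 * t * Real.exp (2 * C * t))) (by positivity)
  refine this.trans (le_of_eq ?_)
  field_simp
  ring

end

/-! ### Empirical measures of solutions of the Kuramoto system -/

lemma integral_empiricalMeasure {n : ℕ} (p : Fin n → G) (f : G → ℝ) :
    ∫ P, f P ∂(empiricalMeasure p) = (n : ℝ)⁻¹ * ∑ i, f (p i) := by
  unfold empiricalMeasure
  rw [integral_smul_measure, integral_finsetSum_measure]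
  · simp [integral_dirac]
  · intro i _
    exact integrable_dirac (by simp)

lemma isProbabilityMeasure_empiricalMeasure {n : ℕ} (hn : n ≠ 0) (p : Fin n → G) :
    IsProbabilityMeasure (empiricalMeasure p) := by
  constructor
  simp only [empiricalMeasure, Measure.smul_apply, Measure.coe_finsetSum, Finset.sum_apply,
    measure_univ, Finset.sum_const, Finset.card_univ, Fintype.card_fin, nsmul_eq_mul, mul_one,
    smul_eq_mul]
  exact ENNReal.inv_mul_cancel (by exact_mod_cast hn) (ENNReal.natCast_ne_top n)

theorem IsKuramotoSolution.eulerConsistent {K : ℝ} {W : I → I → ℝ}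
    {χ : ℝ → ℝ} (hχ : IsCutoff χ) {T : ℝ} {n : ℕ} (hn : n ≠ 0) {ξ : Fin n → I} {w : Fin n → ℝ}
    {θ₀ : Fin n → Phase} {θ : Fin n → ℝ → Phase} (hθ : IsKuramotoSolution K W T ξ w θ₀ θ) :
    EulerConsistent K W T χ fun t => empiricalMeasure fun i => (θ i t, w i, ξ i) := by
  obtain ⟨-, ϑ, hlift, hderiv⟩ := hθ
  set v : ℝ → Fin n → ℝ := fun t i =>
    w i + K * (n : ℝ)⁻¹ * ∑ j, W (ξ i) (ξ j) * Real.sin (ϑ j t - ϑ i t) with hv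
  have hϑ : ∀ i, ContinuousOn (ϑ i) (Set.Icc 0 T) := fun i t ht =>
    (hderiv i t ht).continuousWithinAt
  have hvc : ContinuousOn v (Set.Icc 0 T) := by
    refine continuousOn_pi.mpr fun i => ?_
    refine continuousOn_const.add (continuousOn_const.mul (continuousOn_finsetSum _ fun j _ => ?_))
    exact continuousOn_const.mul (Real.continuous_sin.comp_continuousOn ((hϑ j).sub (hϑ i)))
  have hvel : ∀ t ∈ Set.Icc 0 T, ∀ i,
      vel K W (empiricalMeasure fun i => (θ i t, w i, ξ i)) (θ i t, w i, ξ i) = v t i := by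
    intro t ht i
    have hc : ∀ j, coupling W (θ i t, w i, ξ i) (θ j t, w j, ξ j) =
        W (ξ i) (ξ j) * Real.sin (ϑ j t - ϑ i t) := fun j => by
      rw [← hlift i t ht, ← hlift j t ht]
      rfl
    simp only [vel, drift, integral_empiricalMeasure, hv, hc, mul_assoc]
  have huc := isCompact_Icc.uniformContinuousOn_of_continuous hvc
  rw [Metric.uniformContinuousOn_iff_le] at huc
  intro ε hε
  obtain ⟨δ, hδ, H⟩ := huc ε hε
  refine ⟨δ, hδ, fun t h ht hh hhδ hT f hf => ?_⟩
  have ht' : t ∈ Set.Icc 0 T := ⟨ht, by linarith⟩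
  have hth : t + h ∈ Set.Icc 0 T := ⟨by linarith, hT⟩
  have hfc := continuous_of_mem_lipClass hf
  have := isProbabilityMeasure_empiricalMeasure hn fun i => (θ i t, w i, ξ i)
  rw [integral_empiricalMeasure, integral_empiricalMeasure, ← mul_sub, ← Finset.sum_sub_distrib,
    abs_mul]
  have hterm : ∀ i, |χ (w i) * f (θ i (t + h), w i, ξ i) - χ (w i) * f (eulerMap K W
      (empiricalMeasure fun i => (θ i t, w i, ξ i)) h (θ i t, w i, ξ i))| ≤ ε * h := by
    intro i
    rw [← mul_sub, abs_mul, abs_of_nonneg (hχ.nonneg _)]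
    have h1 : |ϑ i (t + h) - (ϑ i t + h * v t i)| ≤ ε * h := by
      have hd : ∀ s ∈ Set.Icc t (t + h), HasDerivWithinAt (fun s => ϑ i s - s * v t i)
          (v s i - v t i) (Set.Icc t (t + h)) s := by
        intro s hs
        have hs' : s ∈ Set.Icc 0 T := ⟨ht.trans hs.1, hs.2.trans hT⟩
        have h4 := (hasDerivWithinAt_id s (Set.Icc t (t + h))).mul_const (v t i)
        rw [one_mul] at h4
        exact ((hderiv i s hs').mono (Set.Icc_subset_Icc ht hT)).sub h4
      have hb : ∀ s ∈ Set.Icc t (t + h), ‖v s i - v t i‖ ≤ ε := by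
        intro s hs
        have hs' : s ∈ Set.Icc 0 T := ⟨ht.trans hs.1, hs.2.trans hT⟩
        have h3 := H s hs' t ht' (by
          rw [Real.dist_eq, abs_of_nonneg (by linarith [hs.1])]; linarith [hs.2])
        exact (dist_le_pi_dist (v s) (v t) i).trans h3
      have := (convex_Icc t (t + h)).norm_image_sub_le_of_norm_hasDerivWithin_le hd hb
        (Set.left_mem_Icc.mpr (by linarith)) (Set.right_mem_Icc.mpr (by linarith))
      rw [Real.norm_eq_abs, Real.norm_eq_abs, add_sub_cancel_left, abs_of_pos hh] at this
      calc _ = |ϑ i (t + h) - (t + h) * v t i - (ϑ i t - t * v t i)| := by congr 1; ring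
        _ ≤ _ := this
    have h2 : |f (θ i (t + h), w i, ξ i) - f (eulerMap K W
        (empiricalMeasure fun i => (θ i t, w i, ξ i)) h (θ i t, w i, ξ i))| ≤ ε * h := by
      refine (hf.2 _ _).trans ?_
      unfold eulerMap
      rw [hvel t ht' i, distG_eq_dist_fst]
      refine le_trans ?_ h1
      rw [← hlift i t ht', ← hlift i _ hth]
      have := dist_add_coe_le 0 0 (ϑ i (t + h)) (ϑ i t + h * v t i)
      simpa only [dist_self, zero_add, AddCircle.coe_add] using this
    calc _ ≤ 1 * |_| := mul_le_mul_of_nonneg_right (hχ.le_one _) (abs_nonneg _)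
      _ ≤ _ := by rw [one_mul]; exact h2
  have hn0 : (0 : ℝ) < n := by exact_mod_cast Nat.pos_of_ne_zero hn
  rw [abs_of_pos (inv_pos.mpr hn0), inv_mul_le_iff₀ hn0]
  refine (Finset.abs_sum_le_sum_abs _ _).trans ?_
  refine (Finset.sum_le_sum fun i _ => hterm i).trans ?_
  simp

/-! ### Mollification and test functions -/

/-- The lift to `ℝ³` of a function on the state space, extended in the position variable. -/
def liftG (f : G → ℝ) (p : ℝ × ℝ × ℝ) : ℝ :=
  f ((p.1 : Phase), p.2.1, Set.projIcc 0 1 zero_le_one p.2.2)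

lemma abs_projIcc_sub_le (x y : ℝ) :
    |((Set.projIcc (0 : ℝ) 1 zero_le_one x : I) : ℝ) - (Set.projIcc (0 : ℝ) 1 zero_le_one y : I)| ≤
      |x - y| := by
  have := (LipschitzWith.projIcc (zero_le_one (α := ℝ))).dist_le_mul x y
  simpa [Real.dist_eq, Subtype.dist_eq] using this

lemma abs_liftG_sub_le {f : G → ℝ} (hf : f ∈ lipClass) (p q : ℝ × ℝ × ℝ) :
    |liftG f p - liftG f q| ≤ 3 * dist p q := by
  refine (hf.2 _ _).trans ((distG_le_add _ _).trans ?_)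
  have h1 : |p.1 - q.1| ≤ dist p q := le_max_left _ _
  have h0 : dist p.2 q.2 ≤ dist p q := le_max_right _ _
  have h2 : |p.2.1 - q.2.1| ≤ dist p.2 q.2 := le_max_left _ _
  have h3 : |p.2.2 - q.2.2| ≤ dist p.2 q.2 := le_max_right _ _
  have h4 := abs_projIcc_sub_le p.2.2 q.2.2
  have h5 : dist (p.1 : Phase) (q.1 : Phase) ≤ |p.1 - q.1| := by
    rw [dist_eq_norm, ← AddCircle.coe_sub]
    exact norm_coe_phase_le _
  simp only
  linarith

lemma continuous_liftG {f : G → ℝ} (hf : f ∈ lipClass) : Continuous (liftG f) :=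
  (LipschitzWith.of_dist_le' (abs_liftG_sub_le hf)).continuous

lemma isAddHaarMeasure_volume_prod : (volume : Measure (ℝ × ℝ × ℝ)).IsAddHaarMeasure := by
  have h : (volume : Measure (ℝ × ℝ)).IsAddHaarMeasure :=
    Measure.prod.instIsAddHaarMeasure (volume : Measure ℝ) (volume : Measure ℝ)
  exact Measure.prod.instIsAddHaarMeasure (volume : Measure ℝ) (volume : Measure (ℝ × ℝ))

/-- Functions in `lipClass` are uniform limits of `C¹` functions that are `1`-Lipschitz in the
phase. -/
lemma exists_smooth_approx {f : G → ℝ} (hf : f ∈ lipClass) {ε : ℝ} (hε : 0 < ε) :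
    ∃ F : Phase → ℝ → ℝ → ℝ, ContDiff ℝ 1 (fun p : ℝ × ℝ × ℝ => F (p.1 : Phase) p.2.1 p.2.2) ∧
      (∀ P : G, |F P.1 P.2.1 P.2.2 - f P| ≤ ε) ∧
      ∀ a b s x, |F a s x - F b s x| ≤ dist a b := by
  have := isAddHaarMeasure_volume_prod
  let φ : ContDiffBump (0 : ℝ × ℝ × ℝ) := ⟨ε / 6, ε / 3, by positivity, by linarith⟩
  let F : Phase → ℝ → ℝ → ℝ := fun a s x => ∫ u : ℝ × ℝ × ℝ, φ.normed volume u *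
    f (a - (u.1 : Phase), s - u.2.1, Set.projIcc 0 1 zero_le_one (x - u.2.2))
  have hc := continuous_liftG hf
  have hconv : ∀ p : ℝ × ℝ × ℝ, F (p.1 : Phase) p.2.1 p.2.2 =
      convolution (φ.normed volume) (liftG f) (ContinuousLinearMap.lsmul ℝ ℝ) volume p := by
    intro p
    simp only [F, convolution, liftG, ContinuousLinearMap.lsmul_apply, smul_eq_mul, Prod.fst_sub,
      Prod.snd_sub, AddCircle.coe_sub]
  have hφi : Integrable (φ.normed volume) (volume : Measure (ℝ × ℝ × ℝ)) := φ.integrable_normed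
  have hfc := continuous_of_mem_lipClass hf
  have hint : ∀ a s x, Integrable (fun u : ℝ × ℝ × ℝ => φ.normed volume u *
      f (a - (u.1 : Phase), s - u.2.1, Set.projIcc 0 1 zero_le_one (x - u.2.2))) := by
    intro a s x
    refine hφi.mul_bdd (c := 1) ?_ (Eventually.of_forall fun u => abs_le_one_of_mem_lipClass hf _)
    refine (hfc.comp ?_).aestronglyMeasurable
    have h1 : Continuous fun u : ℝ × ℝ × ℝ => (u.1 : Phase) :=
      (AddCircle.continuous_mk' _).comp continuous_fst
    have h2 : Continuous fun u : ℝ × ℝ × ℝ =>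
        Set.projIcc (0 : ℝ) 1 zero_le_one (x - u.2.2) := continuous_projIcc.comp (by fun_prop)
    exact (continuous_const.sub h1).prodMk ((by fun_prop : Continuous fun u : ℝ × ℝ × ℝ =>
      s - u.2.1).prodMk h2)
  refine ⟨F, ?_, fun P => ?_, fun a b s x => ?_⟩
  · simp_rw [hconv]
    exact φ.hasCompactSupport_normed.contDiff_convolution_left _ φ.contDiff_normed
      hc.locallyIntegrable
  · obtain ⟨a, s, x⟩ := P
    induction a using QuotientAddGroup.induction_on with
    | H y =>
      have h1 : f ((y : Phase), s, x) = liftG f (y, s, x) := by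
        simp [liftG, Set.projIcc_val]
      have h2 : F (y : Phase) s x = _ := hconv (y, s, x)
      change |F (y : Phase) s x - f ((y : Phase), s, x)| ≤ ε
      rw [h1, h2]
      refine φ.dist_normed_convolution_le hc.aestronglyMeasurable fun p hp => ?_
      rw [Metric.mem_ball] at hp
      have h3 := abs_liftG_sub_le hf p (y, s, x)
      have h4 : φ.rOut = ε / 3 := rfl
      rw [Real.dist_eq]
      linarith
  · simp only [F]
    rw [← integral_sub (hint a s x) (hint b s x)]
    calc _ ≤ ∫ u : ℝ × ℝ × ℝ, φ.normed volume u * dist a b := by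
          rw [← Real.norm_eq_abs]
          refine norm_integral_le_of_norm_le (hφi.mul_const _) (Eventually.of_forall fun u => ?_)
          rw [← mul_sub, norm_mul, Real.norm_of_nonneg (φ.nonneg_normed u)]
          refine mul_le_mul_of_nonneg_left ((hf.2 _ _).trans ?_) (φ.nonneg_normed u)
          rw [distG_eq_dist_fst, dist_sub_right]
      _ = dist a b := by
          rw [integral_mul_const, φ.integral_normed, one_mul]

namespace IsTestFunction

variable {ψ : ℝ → Phase → ℝ → ℝ → ℝ}

/-- The lift of a test function. -/
def lift (ψ : ℝ → Phase → ℝ → ℝ → ℝ) (p : ℝ × ℝ × ℝ × ℝ) : ℝ := ψ p.1 (p.2.1 : Phase) p.2.2.1 p.2.2.2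

lemma hasFDerivAt (hψ : IsTestFunction ψ) (p : ℝ × ℝ × ℝ × ℝ) :
    HasFDerivAt (lift ψ) (fderiv ℝ (lift ψ) p) p :=
  (hψ.contDiff.differentiable one_ne_zero p).hasFDerivAt

lemma deriv_time_eq (hψ : IsTestFunction ψ) (t y s x : ℝ) :
    deriv (fun t => ψ t (y : Phase) s x) t = fderiv ℝ (lift ψ) (t, y, s, x) (1, 0, 0, 0) := by
  have h : HasDerivAt (fun t : ℝ => (t, y, s, x)) ((1 : ℝ), (0 : ℝ), (0 : ℝ), (0 : ℝ)) t :=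
    (hasDerivAt_id t).prodMk (hasDerivAt_const t _)
  exact ((hψ.hasFDerivAt (t, y, s, x)).comp_hasDerivAt t h).deriv

lemma derivPhase_eq (hψ : IsTestFunction ψ) (t y s x : ℝ) :
    derivPhase (fun θ => ψ t θ s x) (y : Phase) =
      fderiv ℝ (lift ψ) (t, y, s, x) (0, 1, 0, 0) := by
  have h : HasDerivAt (fun u : ℝ => (t, y + u, s, x)) ((0 : ℝ), (1 : ℝ), (0 : ℝ), (0 : ℝ)) 0 :=
    (hasDerivAt_const _ t).prodMk (((hasDerivAt_id (0 : ℝ)).const_add y).prodMk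
      (hasDerivAt_const _ _))
  have h' := hψ.hasFDerivAt (t, y + 0, s, x)
  rw [add_zero] at h'
  have h'' : HasFDerivAt (lift ψ) (fderiv ℝ (lift ψ) (t, y, s, x))
    ((fun u : ℝ => (t, y + u, s, x)) 0) := by simpa using h'
  exact (h''.comp_hasDerivAt (0 : ℝ) h).deriv

lemma isOpenQuotientMap_coe :
    IsOpenQuotientMap fun p : ℝ × ℝ × ℝ × ℝ => (p.1, (p.2.1 : Phase), p.2.2) :=
  IsOpenQuotientMap.prodMap .id (QuotientAddGroup.isOpenQuotientMap_mk.prodMap .id)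

lemma continuous_fderiv_apply (hψ : IsTestFunction ψ) (v : ℝ × ℝ × ℝ × ℝ) :
    Continuous fun p => fderiv ℝ (lift ψ) p v :=
  (hψ.contDiff.continuous_fderiv one_ne_zero).clm_apply continuous_const

lemma continuous_G {F : ℝ → Phase → ℝ → ℝ → ℝ}
    (hF : Continuous fun p : ℝ × ℝ × ℝ × ℝ => F p.1 (p.2.1 : Phase) p.2.2.1 p.2.2.2) :
    Continuous fun q : ℝ × G => F q.1 q.2.1 q.2.2.1 q.2.2.2 := by
  have h : Continuous fun q : ℝ × Phase × ℝ × ℝ => F q.1 q.2.1 q.2.2.1 q.2.2.2 :=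
    (isOpenQuotientMap_coe.isQuotientMap.continuous_iff).mpr hF
  exact h.comp (f := fun q : ℝ × G => (q.1, q.2.1, q.2.2.1, (q.2.2.2 : ℝ))) (by fun_prop)

lemma continuous (hψ : IsTestFunction ψ) :
    Continuous fun q : ℝ × G => ψ q.1 q.2.1 q.2.2.1 q.2.2.2 :=
  continuous_G hψ.contDiff.continuous

lemma continuous_deriv_time (hψ : IsTestFunction ψ) :
    Continuous fun q : ℝ × G => deriv (fun t => ψ t q.2.1 q.2.2.1 q.2.2.2) q.1 := by
  refine continuous_G (F := fun t a s x => deriv (fun t => ψ t a s x) t) ?_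
  simp_rw [hψ.deriv_time_eq]
  exact hψ.continuous_fderiv_apply _

lemma continuous_derivPhase (hψ : IsTestFunction ψ) :
    Continuous fun q : ℝ × G => derivPhase (fun θ => ψ q.1 θ q.2.2.1 q.2.2.2) q.2.1 := by
  refine continuous_G (F := fun t a s x => derivPhase (fun θ => ψ t θ s x) a) ?_
  simp_rw [hψ.derivPhase_eq]
  exact hψ.continuous_fderiv_apply _

/-- The chain rule along a curve of phases. -/
lemma hasDerivAt_comp (hψ : IsTestFunction ψ) {γ : ℝ → ℝ} {t v : ℝ} (hγ : HasDerivAt γ v t)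
    (s x : ℝ) : HasDerivAt (fun t => ψ t (γ t : Phase) s x)
      (deriv (fun t' => ψ t' (γ t : Phase) s x) t +
        v * derivPhase (fun θ => ψ t θ s x) (γ t : Phase)) t := by
  have h : HasDerivAt (fun t : ℝ => (t, γ t, s, x)) ((1 : ℝ), v, (0 : ℝ), (0 : ℝ)) t :=
    (hasDerivAt_id t).prodMk (hγ.prodMk (hasDerivAt_const _ _))
  have h' := (hψ.hasFDerivAt (t, γ t, s, x)).comp_hasDerivAt t h
  refine h'.congr_deriv ?_
  rw [hψ.deriv_time_eq, hψ.derivPhase_eq]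
  have : ((1 : ℝ), v, (0 : ℝ), (0 : ℝ)) =
      ((1 : ℝ), (0 : ℝ), (0 : ℝ), (0 : ℝ)) + v • ((0 : ℝ), (1 : ℝ), (0 : ℝ), (0 : ℝ)) := by simp
  rw [this, map_add, map_smul, smul_eq_mul]

lemma deriv_time_eq_zero {R : ℝ} (hR : ∀ t θ ω x, R < |ω| → ψ t θ ω x = 0) (t : ℝ) (a : Phase)
    {s : ℝ} (hs : R < |s|) (x : ℝ) : deriv (fun t => ψ t a s x) t = 0 := by
  simp [hR _ _ _ _ hs]

lemma derivPhase_eq_zero {R : ℝ} (hR : ∀ t θ ω x, R < |ω| → ψ t θ ω x = 0) (t : ℝ) (a : Phase)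
    {s : ℝ} (hs : R < |s|) (x : ℝ) : derivPhase (fun θ => ψ t θ s x) a = 0 := by
  simp [derivPhase, hR _ _ _ _ hs]

end IsTestFunction

/-! ### Measure-valued weak solutions -/

/-- Measure-valued weak solutions with initial measure `m`. -/
structure IsMeasureSolution (K : ℝ) (W : I → I → ℝ) (T : ℝ) (m : Measure G) (μ : ℝ → Measure G) :
    Prop where
  prob : ∀ t ∈ Set.Icc 0 T, IsProbabilityMeasure (μ t)
  cont : ∀ f : BoundedContinuousFunction G ℝ, ContinuousOn (fun t => ∫ P, f P ∂(μ t)) (Set.Icc 0 T)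
  weak : ∀ ψ, IsTestFunction ψ → ∀ τ ∈ Set.Icc 0 T,
    ∫ P : G, ψ τ P.1 P.2.1 P.2.2 ∂(μ τ) = (∫ P : G, ψ 0 P.1 P.2.1 P.2.2 ∂m) +
      ∫ t in (0 : ℝ)..τ, ∫ P : G,
        (deriv (fun s => ψ s P.1 P.2.1 P.2.2) t +
          vel K W (μ t) P * derivPhase (fun θ => ψ t θ P.2.1 P.2.2) P.1) ∂(μ t)

lemma integral_densityMeasure {r : G → ℝ} (hr : Measurable r) (hr0 : ∀ P, 0 ≤ r P) (f : G → ℝ) :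
    ∫ P, f P ∂(densityMeasure r) = ∫ P, f P * r P := by
  unfold densityMeasure
  rw [integral_withDensity_eq_integral_toReal_smul hr.ennreal_ofReal
    (Eventually.of_forall fun _ => ENNReal.ofReal_lt_top)]
  refine integral_congr_ae (Eventually.of_forall fun P => ?_)
  simp [ENNReal.toReal_ofReal (hr0 P), mul_comm]

lemma isProbabilityMeasure_densityMeasure {r : G → ℝ} (hr0 : ∀ P, 0 ≤ r P)
    (hri : Integrable r) (hr1 : ∫ P, r P = 1) : IsProbabilityMeasure (densityMeasure r) := by
  constructor
  rw [densityMeasure, withDensity_apply _ MeasurableSet.univ, Measure.restrict_univ,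
    ← ofReal_integral_eq_lintegral_ofReal hri (Eventually.of_forall hr0), hr1, ENNReal.ofReal_one]

lemma velocity_eq_vel {r : G → ℝ} (hr : Measurable r) (hr0 : ∀ P, 0 ≤ r P) (K : ℝ)
    (W : I → I → ℝ) (P : G) : velocity K W r P = vel K W (densityMeasure r) P := by
  rw [velocity, vel, drift, integral_densityMeasure hr hr0]
  rfl

theorem IsWeakSolution.isMeasureSolution {K : ℝ} {W : I → I → ℝ} {T : ℝ} {ρ₀ : G → ℝ}
    {ρ : ℝ → G → ℝ} (hρ₀ : Measurable ρ₀) (hρ₀' : ∀ P, 0 ≤ ρ₀ P)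
    (h : IsWeakSolution K W T ρ₀ ρ) :
    IsMeasureSolution K W T (densityMeasure ρ₀) fun t => densityMeasure (ρ t) where
  prob t ht := isProbabilityMeasure_densityMeasure (h.nonneg t ht) (h.integrable t ht)
    (h.integral_eq_one t ht)
  cont f := (h.weaklyContinuous f).congr fun t ht =>
    integral_densityMeasure (h.measurable t ht) (h.nonneg t ht) _
  weak ψ hψ τ hτ := by
    rw [integral_densityMeasure (h.measurable τ hτ) (h.nonneg τ hτ),
      integral_densityMeasure hρ₀ hρ₀', h.weak ψ hψ τ hτ]
    congr 1
    refine intervalIntegral.integral_congr fun t ht => ?_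
    rw [Set.uIcc_of_le hτ.1] at ht
    have ht' : t ∈ Set.Icc 0 T := ⟨ht.1, ht.2.trans hτ.2⟩
    rw [integral_densityMeasure (h.measurable t ht') (h.nonneg t ht')]
    simp_rw [velocity_eq_vel (h.measurable t ht') (h.nonneg t ht')]

lemma isCompact_freq_le (R : ℝ) : IsCompact {P : G | |P.2.1| ≤ R} := by
  have : {P : G | |P.2.1| ≤ R} = Set.univ ×ˢ (Set.Icc (-R) R ×ˢ Set.univ) := by
    ext P; simp [abs_le]
  rw [this]
  exact isCompact_univ.prod (isCompact_Icc.prod isCompact_univ)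

section

variable {T : ℝ} {H : ℝ → G → ℝ} {R : ℝ}

lemma exists_uniform_modulus
    (hH : ContinuousOn (fun q : ℝ × G => H q.1 q.2) (Set.Icc 0 T ×ˢ Set.univ))
    (hR : ∀ t P, R < |P.2.1| → H t P = 0) {ε : ℝ} (hε : 0 < ε) :
    ∃ δ > 0, ∀ s ∈ Set.Icc 0 T, ∀ t ∈ Set.Icc 0 T, |s - t| < δ → ∀ P, |H s P - H t P| < ε := by
  have hc : IsCompact (Set.Icc 0 T ×ˢ {P : G | |P.2.1| ≤ R}) :=
    isCompact_Icc.prod (isCompact_freq_le R)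
  have := hc.uniformContinuousOn_of_continuous
    (hH.mono (Set.prod_mono subset_rfl (Set.subset_univ _)))
  rw [Metric.uniformContinuousOn_iff] at this
  obtain ⟨δ, hδ, h⟩ := this ε hε
  refine ⟨δ, hδ, fun s hs t ht hst P => ?_⟩
  by_cases hP : |P.2.1| ≤ R
  · exact h (s, P) ⟨hs, hP⟩ (t, P) ⟨ht, hP⟩ (by simpa [Prod.dist_eq, Real.dist_eq, hδ] using hst)
  · rw [not_le] at hP
    simpa [hR _ _ hP] using hε

lemma exists_uniform_bound
    (hH : ContinuousOn (fun q : ℝ × G => H q.1 q.2) (Set.Icc 0 T ×ˢ Set.univ))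
    (hR : ∀ t P, R < |P.2.1| → H t P = 0) : ∃ c, ∀ t ∈ Set.Icc 0 T, ∀ P, |H t P| ≤ c := by
  have hc : IsCompact (Set.Icc 0 T ×ˢ {P : G | |P.2.1| ≤ R}) :=
    isCompact_Icc.prod (isCompact_freq_le R)
  obtain ⟨c, h⟩ := hc.exists_bound_of_continuousOn
    (hH.mono (Set.prod_mono subset_rfl (Set.subset_univ _)))
  refine ⟨max c 0, fun t ht P => ?_⟩
  by_cases hP : |P.2.1| ≤ R
  · exact (h (t, P) ⟨ht, hP⟩).trans (le_max_left _ _)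
  · rw [not_le] at hP
    simp [hR _ _ hP]

lemma continuous_slice
    (hH : ContinuousOn (fun q : ℝ × G => H q.1 q.2) (Set.Icc 0 T ×ˢ Set.univ)) {t : ℝ}
    (ht : t ∈ Set.Icc 0 T) : Continuous (H t) :=
  hH.comp_continuous (f := fun P : G => (t, P)) (by fun_prop) fun _ => ⟨ht, trivial⟩

end

namespace IsMeasureSolution

variable {K : ℝ} {W : I → I → ℝ} {B T : ℝ} {m : Measure G} {μ : ℝ → Measure G}

lemma continuousOn_integral (h : IsMeasureSolution K W T m μ) {H : ℝ → G → ℝ} {R : ℝ}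
    (hH : ContinuousOn (fun q : ℝ × G => H q.1 q.2) (Set.Icc 0 T ×ˢ Set.univ))
    (hR : ∀ t P, R < |P.2.1| → H t P = 0) :
    ContinuousOn (fun t => ∫ P, H t P ∂(μ t)) (Set.Icc 0 T) := by
  obtain ⟨c, hc⟩ := exists_uniform_bound hH hR
  rw [Metric.continuousOn_iff]
  intro t ht ε hε
  obtain ⟨δ, hδ, h₁⟩ := exists_uniform_modulus hH hR (half_pos hε)
  have h₂ := h.cont (BoundedContinuousFunction.ofNormedAddCommGroup (H t) (continuous_slice hH ht) c
    (hc t ht))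
  rw [Metric.continuousOn_iff] at h₂
  obtain ⟨δ', hδ', h₃⟩ := h₂ t ht (ε / 2) (half_pos hε)
  refine ⟨min δ δ', lt_min hδ hδ', fun s hs hst => ?_⟩
  have h₄ := h₃ s hs (hst.trans_le (min_le_right _ _))
  have := h.prob s hs
  have h₅ : |∫ P, H s P ∂(μ s) - ∫ P, H t P ∂(μ s)| ≤ ε / 2 := by
    rw [← integral_sub
      (integrable_of_abs_le (continuous_slice hH hs).aestronglyMeasurable (hc s hs))
      (integrable_of_abs_le (continuous_slice hH ht).aestronglyMeasurable (hc t ht))]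
    exact abs_integral_le_of_abs_le fun P =>
      (h₁ s hs t ht (hst.trans_le (min_le_left _ _)) P).le
  simp only [BoundedContinuousFunction.coe_ofNormedAddCommGroup, Real.dist_eq] at h₄ ⊢
  calc _ ≤ _ := abs_sub_le _ (∫ P, H t P ∂(μ s)) _
    _ < ε / 2 + ε / 2 := add_lt_add_of_le_of_lt h₅ h₄
    _ = ε := add_halves ε

end IsMeasureSolution

/-- The `W`-weighted mean of a function of the phase. -/
def phaseMean (W : I → I → ℝ) (c : Phase → ℝ) (μ : Measure G) (x : I) : ℝ :=
  ∫ Q : G, W x Q.2.2 * c Q.1 ∂μ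

section

variable {W : I → I → ℝ} {B : ℝ} {c : Phase → ℝ}

lemma continuous_weight (hW : KernelBound W B) (hc : Continuous c) (x : I) :
    Continuous fun Q : G => W x Q.2.2 * c Q.1 :=
  (hW.continuous.comp (f := fun Q : G => (x, Q.2.2)) (by fun_prop)).mul (by fun_prop)

lemma abs_weight_le (hW : KernelBound W B) (hc1 : ∀ a, |c a| ≤ 1) (x : I) (Q : G) :
    |W x Q.2.2 * c Q.1| ≤ B := by
  rw [abs_mul]
  calc _ ≤ B * 1 := mul_le_mul (hW.bound _ _) (hc1 _) (abs_nonneg _) hW.nonneg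
    _ = B := mul_one B

lemma integrable_weight (hW : KernelBound W B) (hc : Continuous c) (hc1 : ∀ a, |c a| ≤ 1)
    (μ : Measure G) [IsProbabilityMeasure μ] (x : I) :
    Integrable (fun Q : G => W x Q.2.2 * c Q.1) μ :=
  integrable_of_abs_le (continuous_weight hW hc x).aestronglyMeasurable (abs_weight_le hW hc1 x)

lemma abs_phaseMean_le (hW : KernelBound W B) (hc1 : ∀ a, |c a| ≤ 1) (μ : Measure G)
    [IsProbabilityMeasure μ] (x : I) : |phaseMean W c μ x| ≤ B :=
  abs_integral_le_of_abs_le (abs_weight_le hW hc1 x)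

lemma abs_phaseMean_sub_le (hW : KernelBound W B) (hc : Continuous c) (hc1 : ∀ a, |c a| ≤ 1)
    (μ : Measure G) [IsProbabilityMeasure μ] (x y : I) :
    |phaseMean W c μ x - phaseMean W c μ y| ≤ B * dist x y := by
  rw [phaseMean, phaseMean, ← integral_sub (integrable_weight hW hc hc1 μ x)
    (integrable_weight hW hc hc1 μ y)]
  refine abs_integral_le_of_abs_le fun Q => ?_
  rw [← sub_mul, abs_mul]
  have h := hW.lip x Q.2.2 y Q.2.2
  simp only [sub_self, abs_zero, add_zero] at h
  calc _ ≤ B * |(x : ℝ) - y| * 1 :=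
        mul_le_mul h (hc1 _) (abs_nonneg _) ((abs_nonneg _).trans h)
    _ = _ := by rw [mul_one, Subtype.dist_eq, Real.dist_eq]

lemma drift_eq_phaseMean (hW : KernelBound W B) (μ : Measure G) [IsProbabilityMeasure μ] (P : G) :
    drift W μ P = phaseMean W sinPhase μ P.2.2 * cosPhase P.1 -
      phaseMean W cosPhase μ P.2.2 * sinPhase P.1 := by
  unfold phaseMean drift
  rw [← integral_mul_const, ← integral_mul_const, ← integral_sub]
  · refine integral_congr_ae (Eventually.of_forall fun Q => ?_)
    simp only [coupling, sinPhase_sub]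
    ring
  · exact (integrable_weight hW continuous_sinPhase abs_sinPhase_le_one μ _).mul_const _
  · exact (integrable_weight hW continuous_cosPhase abs_cosPhase_le_one μ _).mul_const _

end

namespace IsMeasureSolution

variable {K : ℝ} {W : I → I → ℝ} {B T : ℝ} {m : Measure G} {μ : ℝ → Measure G}

lemma continuousOn_phaseMean (h : IsMeasureSolution K W T m μ) (hW : KernelBound W B)
    {c : Phase → ℝ} (hc : Continuous c) (hc1 : ∀ a, |c a| ≤ 1) :
    ContinuousOn (fun q : ℝ × I => phaseMean W c (μ q.1) q.2) (Set.Icc 0 T ×ˢ Set.univ) := by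
  refine continuousOn_prod_of_continuousOn_lipschitzOnWith' _ (Real.toNNReal B) (fun t ht => ?_)
    fun x _ => ?_
  · have := h.prob t ht
    refine (LipschitzWith.of_dist_le' (K := B) fun x y => ?_).lipschitzOnWith
    exact abs_phaseMean_sub_le hW hc hc1 (μ t) x y
  · exact h.cont (BoundedContinuousFunction.ofNormedAddCommGroup _ (continuous_weight hW hc x) B
      (abs_weight_le hW hc1 x))

lemma continuousOn_drift (h : IsMeasureSolution K W T m μ) (hW : KernelBound W B) :
    ContinuousOn (fun q : ℝ × G => drift W (μ q.1) q.2) (Set.Icc 0 T ×ˢ Set.univ) := by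
  have key : ∀ c : Phase → ℝ, Continuous c → (∀ a, |c a| ≤ 1) → ContinuousOn
      (fun q : ℝ × G => phaseMean W c (μ q.1) q.2.2.2) (Set.Icc 0 T ×ˢ Set.univ) :=
    fun c hc hc1 => (h.continuousOn_phaseMean hW hc hc1).comp
      (f := fun q : ℝ × G => (q.1, q.2.2.2)) (by fun_prop) fun q hq => ⟨hq.1, trivial⟩
  have hs := key _ continuous_sinPhase abs_sinPhase_le_one
  have hc := key _ continuous_cosPhase abs_cosPhase_le_one
  have hs' : Continuous fun q : ℝ × G => sinPhase q.2.1 := continuous_sinPhase.comp (by fun_prop)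
  have hc' : Continuous fun q : ℝ × G => cosPhase q.2.1 := continuous_cosPhase.comp (by fun_prop)
  refine ((hs.mul hc'.continuousOn).sub (hc.mul hs'.continuousOn)).congr fun q hq => ?_
  have := h.prob q.1 hq.1
  exact drift_eq_phaseMean hW _ _

/-- The integrand of the weak formulation is jointly continuous. -/
lemma continuousOn_integrand (h : IsMeasureSolution K W T m μ) (hW : KernelBound W B)
    {ψ : ℝ → Phase → ℝ → ℝ → ℝ} (hψ : IsTestFunction ψ) :
    ContinuousOn (fun q : ℝ × G => deriv (fun s => ψ s q.2.1 q.2.2.1 q.2.2.2) q.1 +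
      vel K W (μ q.1) q.2 * derivPhase (fun θ => ψ q.1 θ q.2.2.1 q.2.2.2) q.2.1)
      (Set.Icc 0 T ×ˢ Set.univ) := by
  refine hψ.continuous_deriv_time.continuousOn.add
    (ContinuousOn.mul ?_ hψ.continuous_derivPhase.continuousOn)
  unfold vel
  exact (by fun_prop : Continuous fun q : ℝ × G => q.2.2.1).continuousOn.add
    (continuousOn_const.mul (h.continuousOn_drift hW))

lemma weak_sub (h : IsMeasureSolution K W T m μ) (hW : KernelBound W B)
    {ψ : ℝ → Phase → ℝ → ℝ → ℝ} (hψ : IsTestFunction ψ) {s t : ℝ} (hs : s ∈ Set.Icc 0 T)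
    (ht : t ∈ Set.Icc 0 T) :
    ∫ P : G, ψ t P.1 P.2.1 P.2.2 ∂(μ t) - ∫ P : G, ψ s P.1 P.2.1 P.2.2 ∂(μ s) =
      ∫ u in s..t, ∫ P : G, (deriv (fun s => ψ s P.1 P.2.1 P.2.2) u +
          vel K W (μ u) P * derivPhase (fun θ => ψ u θ P.2.1 P.2.2) P.1) ∂(μ u) := by
  obtain ⟨R, hR⟩ := hψ.support
  have hc := h.continuousOn_integral (R := R) (H := fun u P =>
    deriv (fun s => ψ s P.1 P.2.1 P.2.2) u +
      vel K W (μ u) P * derivPhase (fun θ => ψ u θ P.2.1 P.2.2) P.1)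
    (h.continuousOn_integrand hW hψ) fun u P hP => by
      rw [IsTestFunction.deriv_time_eq_zero hR _ _ hP, IsTestFunction.derivPhase_eq_zero hR _ _ hP]
      simp
  have hi : ∀ u ∈ Set.Icc 0 T, IntervalIntegrable (fun u => ∫ P : G,
      (deriv (fun s => ψ s P.1 P.2.1 P.2.2) u +
        vel K W (μ u) P * derivPhase (fun θ => ψ u θ P.2.1 P.2.2) P.1) ∂(μ u)) volume 0 u :=
    fun u hu => (hc.mono (by rw [Set.uIcc_of_le hu.1]; exact Set.Icc_subset_Icc_right hu.2)
      ).intervalIntegrable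
  rw [h.weak ψ hψ t ht, h.weak ψ hψ s hs, add_sub_add_left_eq_sub,
    intervalIntegral.integral_interval_sub_left (hi t ht) (hi s hs)]

end IsMeasureSolution

/-! ### Weak solutions are consistent with Euler steps -/

lemma abs_deriv_le_of_abs_sub_le {f z : ℝ → ℝ} {D v s c : ℝ} (hf : HasDerivAt f D s)
    (hz : HasDerivAt z v s) (h : ∀ u, |f u - f s| ≤ c * |z u - z s|) : |D| ≤ c * |v| := by
  refine le_of_tendsto_of_tendsto' (hasDerivAt_iff_tendsto_slope.mp hf).norm
    ((hasDerivAt_iff_tendsto_slope.mp hz).norm.const_mul c) fun u => ?_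
  simp only [slope_def_field, norm_div, Real.norm_eq_abs, ← mul_div_assoc]
  exact div_le_div_of_nonneg_right (h u) (abs_nonneg _)

lemma le_of_forall_small_le {x A D : ℝ} (hD : 0 ≤ D)
    (h : ∀ e, 0 < e → e ≤ 1 → x ≤ A + e * D) : x ≤ A := by
  refine le_of_forall_pos_le_add fun δ hδ => ?_
  refine (h (min 1 (δ / (D + 1))) (by positivity) (min_le_left _ _)).trans ?_
  gcongr
  calc _ ≤ δ / (D + 1) * (D + 1) := mul_le_mul (min_le_right _ _) (by linarith) hD (by positivity)
    _ = δ := by field_simp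

/-- A smooth approximation of the velocity. -/
def smoothVel (K : ℝ) (a b : ℝ → ℝ) (θ : Phase) (s x : ℝ) : ℝ :=
  s + K * (a x * cosPhase θ - b x * sinPhase θ)

/-- The test function that transports `F` backwards from time `σ` along `smoothVel`. -/
def transportTest (K : ℝ) (χ : ℝ → ℝ) (F : Phase → ℝ → ℝ → ℝ) (a b : ℝ → ℝ) (σ : ℝ)
    (t : ℝ) (θ : Phase) (s x : ℝ) : ℝ :=
  χ s * F (θ + (((σ - t) * smoothVel K a b θ s x : ℝ) : Phase)) s x

section

variable {K : ℝ} {χ : ℝ → ℝ} {F : Phase → ℝ → ℝ → ℝ} {a b : ℝ → ℝ} {σ : ℝ}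

lemma isTestFunction_transportTest (hχ : IsCutoff χ)
    (hF : ContDiff ℝ 1 (fun p : ℝ × ℝ × ℝ => F (p.1 : Phase) p.2.1 p.2.2))
    (ha : ContDiff ℝ 1 a) (hb : ContDiff ℝ 1 b) :
    IsTestFunction (transportTest K χ F a b σ) where
  contDiff := by
    have hz : ContDiff ℝ 1 fun p : ℝ × ℝ × ℝ × ℝ => (p.2.1 + (σ - p.1) *
        (p.2.2.1 + K * (a p.2.2.2 * Real.cos p.2.1 - b p.2.2.2 * Real.sin p.2.1)),
          p.2.2.1, p.2.2.2) := by
      fun_prop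
    have hχ' : ContDiff ℝ 1 fun p : ℝ × ℝ × ℝ × ℝ => χ p.2.2.1 := hχ.contDiff.comp (by fun_prop)
    exact hχ'.mul (hF.comp hz)
  support := by
    obtain ⟨R, -, hR⟩ := hχ.support
    exact ⟨R, fun t θ ω x h => by simp [transportTest, hR _ h]⟩

lemma abs_transport_le (hχ : IsCutoff χ)
    (hF : ContDiff ℝ 1 (fun p : ℝ × ℝ × ℝ => F (p.1 : Phase) p.2.1 p.2.2))
    (hF1 : ∀ θ θ' s x, |F θ s x - F θ' s x| ≤ dist θ θ')
    (ha : ContDiff ℝ 1 a) (hb : ContDiff ℝ 1 b) (t V : ℝ) (θ : Phase) (s x : ℝ) :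
    |deriv (fun t => transportTest K χ F a b σ t θ s x) t +
      V * derivPhase (fun θ => transportTest K χ F a b σ t θ s x) θ| ≤
      χ s * |V - smoothVel K a b θ s x -
        (σ - t) * (K * (a x * sinPhase θ + b x * cosPhase θ) * V)| := by
  induction θ using QuotientAddGroup.induction_on with
  | H y =>
    have hψ := isTestFunction_transportTest (K := K) (σ := σ) hχ hF ha hb
    have hγ : HasDerivAt (fun u : ℝ => y + V * (u - t)) V t := by
      simpa using (((hasDerivAt_id t).sub_const t).const_mul V).const_add y
    have h1 := hψ.hasDerivAt_comp hγ s x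
    have hγt : y + V * (t - t) = y := by ring
    rw [hγt] at h1
    set U : ℝ → ℝ := fun u => s + K * (a x * Real.cos u - b x * Real.sin u) with hU
    have hUd : HasDerivAt (fun u : ℝ => U (y + V * (u - t)))
        (-(K * (a x * Real.sin y + b x * Real.cos y) * V)) t := by
      have hc := hγ.cos
      have hs := hγ.sin
      rw [hγt] at hc hs
      refine ((((hc.const_mul (a x)).sub (hs.const_mul (b x))).const_mul K).const_add s).congr_deriv
        ?_
      ring
    have hz : HasDerivAt (fun u : ℝ => y + V * (u - t) + (σ - u) * U (y + V * (u - t)))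
        (V - U y - (σ - t) * (K * (a x * Real.sin y + b x * Real.cos y) * V)) t := by
      refine (hγ.add (((hasDerivAt_id t).const_sub σ).mul hUd)).congr_deriv ?_
      simp only [hγt, id]
      ring
    refine abs_deriv_le_of_abs_sub_le h1 hz fun u => ?_
    have key : ∀ u : ℝ, transportTest K χ F a b σ u ((y + V * (u - t) : ℝ) : Phase) s x =
        χ s * F ((y + V * (u - t) + (σ - u) * U (y + V * (u - t)) : ℝ) : Phase) s x := fun u => rfl
    rw [key u, key t, ← mul_sub, abs_mul, abs_of_nonneg (hχ.nonneg s)]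
    refine mul_le_mul_of_nonneg_left ((hF1 _ _ _ _).trans ?_) (hχ.nonneg s)
    rw [dist_eq_norm, ← AddCircle.coe_sub]
    exact norm_coe_phase_le _

end

lemma exists_polynomial_approx {c : I → ℝ} (hc : Continuous c) {e : ℝ} (he : 0 < e) :
    ∃ p : ℝ → ℝ, ContDiff ℝ 1 p ∧ ∀ x : I, |p x - c x| ≤ e := by
  have hc' : ContinuousOn (Set.IccExtend zero_le_one c) (Set.Icc (0 : ℝ) 1) :=
    hc.Icc_extend'.continuousOn
  obtain ⟨p, hp⟩ := exists_polynomial_near_of_continuousOn 0 1 _ hc' e he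
  refine ⟨fun x => p.eval x, by simpa using Polynomial.contDiff_aeval (𝕜 := ℝ) p 1, fun x => ?_⟩
  have := hp x x.2
  rw [Set.IccExtend_of_mem _ _ x.2] at this
  exact this.le

namespace IsMeasureSolution

variable {K : ℝ} {W : I → I → ℝ} {B T : ℝ} {m : Measure G} {μ : ℝ → Measure G} {χ : ℝ → ℝ}

lemma abs_smoothVel_sub_le (hW : KernelBound W B) (ν : Measure G) [IsProbabilityMeasure ν]
    {a b : ℝ → ℝ} {e : ℝ} (ha : ∀ x : I, |a x - phaseMean W sinPhase ν x| ≤ e)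
    (hb : ∀ x : I, |b x - phaseMean W cosPhase ν x| ≤ e) (P : G) :
    |vel K W ν P - smoothVel K a b P.1 P.2.1 P.2.2| ≤ |K| * (2 * e) := by
  have h : vel K W ν P - smoothVel K a b P.1 P.2.1 P.2.2 =
      K * (-((a P.2.2 - phaseMean W sinPhase ν P.2.2) * cosPhase P.1) +
        (b P.2.2 - phaseMean W cosPhase ν P.2.2) * sinPhase P.1) := by
    rw [vel, smoothVel, drift_eq_phaseMean hW]
    ring
  rw [h, abs_mul]
  refine mul_le_mul_of_nonneg_left ((abs_add_le _ _).trans ?_) (abs_nonneg K)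
  rw [abs_neg, abs_mul, abs_mul]
  have he : 0 ≤ e := (abs_nonneg _).trans (ha 0)
  have h1 := mul_le_mul (ha P.2.2) (abs_cosPhase_le_one P.1) (abs_nonneg _) he
  have h2 := mul_le_mul (hb P.2.2) (abs_sinPhase_le_one P.1) (abs_nonneg _) he
  linarith

lemma cutoff_mul_abs_vel_le (hW : KernelBound W B) (hχ : IsCutoff χ) {R : ℝ} (hR0 : 0 ≤ R)
    (hR : ∀ s, R < |s| → χ s = 0) (ν : Measure G) [IsProbabilityMeasure ν] (P : G) :
    χ P.2.1 * |vel K W ν P| ≤ R + |K| * B := by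
  have hB := hW.nonneg
  by_cases hP : R < |P.2.1|
  · rw [hR _ hP, zero_mul]; positivity
  · rw [not_lt] at hP
    have h1 : |vel K W ν P| ≤ R + |K| * B := by
      refine (abs_add_le _ _).trans (add_le_add hP ?_)
      rw [abs_mul]
      exact mul_le_mul_of_nonneg_left (abs_drift_le ν hW P) (abs_nonneg K)
    calc _ ≤ 1 * |vel K W ν P| := mul_le_mul_of_nonneg_right (hχ.le_one _) (abs_nonneg _)
      _ ≤ _ := by rw [one_mul]; exact h1

theorem eulerConsistent (hμ : IsMeasureSolution K W T m μ) (hW : KernelBound W B)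
    (hχ : IsCutoff χ) : EulerConsistent K W T χ μ := by
  have hB := hW.nonneg
  obtain ⟨R, hR0, hR⟩ := hχ.support
  intro ε hε
  set C := 2 * |K| * (B + 1) * (R + |K| * B) with hC
  have hC0 : 0 ≤ C := by positivity
  obtain ⟨δ, hδ, hmod⟩ := exists_uniform_modulus (T := T) (R := R)
    (H := fun t P => χ P.2.1 * drift W (μ t) P)
    ((hχ.continuous_freq.comp (by fun_prop : Continuous fun q : ℝ × G => q.2)).continuousOn.mul
      (hμ.continuousOn_drift hW)) (fun t P hP => by simp [hR _ hP])
    (ε := ε / (2 * (|K| + 1))) (by positivity)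
  refine ⟨min (δ / 2) (ε / (2 * (C + 1))), by positivity, fun t h ht hh hh0 hT f hf => ?_⟩
  have hhδ : h < δ := by linarith [hh0.trans (min_le_left _ _)]
  have hhC : h * C ≤ ε / 2 := by
    have h1 := hh0.trans (min_le_right _ _)
    rw [le_div_iff₀ (by positivity)] at h1
    nlinarith
  have ht' : t ∈ Set.Icc 0 T := ⟨ht, by linarith⟩
  have hth : t + h ∈ Set.Icc 0 T := ⟨by linarith, hT⟩
  have := hμ.prob t ht'
  have := hμ.prob _ hth
  have hfc := continuous_of_mem_lipClass hf
  have hf1 := abs_le_one_of_mem_lipClass hf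
  refine le_of_forall_small_le (D := 2 + 4 * h * |K|) (by positivity) fun e he he1 => ?_
  obtain ⟨F, hFs, hFf, hF1⟩ := exists_smooth_approx hf he
  have hcont : ∀ c : Phase → ℝ, Continuous c → (∀ θ, |c θ| ≤ 1) →
      Continuous (phaseMean W c (μ t)) := fun c hc hc1 =>
    (LipschitzWith.of_dist_le' (K := B) fun x y =>
      abs_phaseMean_sub_le hW hc hc1 (μ t) x y).continuous
  obtain ⟨a, has, ha⟩ := exists_polynomial_approx
    (hcont _ continuous_sinPhase abs_sinPhase_le_one) he
  obtain ⟨b, hbs, hb⟩ := exists_polynomial_approx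
    (hcont _ continuous_cosPhase abs_cosPhase_le_one) he
  have hab : ∀ (c : Phase → ℝ) (p : ℝ → ℝ), (∀ θ, |c θ| ≤ 1) →
      (∀ x : I, |p x - phaseMean W c (μ t) x| ≤ e) → ∀ x : I, |p x| ≤ B + 1 := by
    intro c p hc hp x
    have h1 := abs_phaseMean_le hW hc (μ t) x
    have h2 := hp x
    rw [abs_le] at *
    constructor <;> linarith
  have haB := hab _ a abs_sinPhase_le_one ha
  have hbB := hab _ b abs_cosPhase_le_one hb
  set ψ := transportTest K χ F a b (t + h) with hψdef
  have hψ : IsTestFunction ψ := isTestFunction_transportTest hχ hFs has hbs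
  have hψc : ∀ u, Continuous fun P : G => ψ u P.1 P.2.1 P.2.2 := fun u =>
    hψ.continuous.comp (f := fun P : G => (u, P)) (by fun_prop)
  have hend : ∀ P : G, |ψ (t + h) P.1 P.2.1 P.2.2 - χ P.2.1 * f P| ≤ e := by
    intro P
    have h1 : ψ (t + h) P.1 P.2.1 P.2.2 - χ P.2.1 * f P =
        χ P.2.1 * (F P.1 P.2.1 P.2.2 - f P) := by
      simp [hψdef, transportTest, mul_sub]
    rw [h1]
    exact abs_cutoff_mul_le hχ hFf P
  have hstart : ∀ P : G, |ψ t P.1 P.2.1 P.2.2 - χ P.2.1 * f (eulerMap K W (μ t) h P)| ≤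
      e + h * (|K| * (2 * e)) := by
    intro P
    have h1 : ψ t P.1 P.2.1 P.2.2 - χ P.2.1 * f (eulerMap K W (μ t) h P) =
        χ P.2.1 * (F (P.1 + ((h * smoothVel K a b P.1 P.2.1 P.2.2 : ℝ) : Phase)) P.2.1 P.2.2 -
          f (eulerMap K W (μ t) h P)) := by
      simp [hψdef, transportTest, mul_sub]
    rw [h1]
    refine abs_cutoff_mul_le hχ (f := fun P => F (P.1 + ((h * smoothVel K a b P.1 P.2.1 P.2.2 : ℝ) :
      Phase)) P.2.1 P.2.2 - f (eulerMap K W (μ t) h P)) (fun P => ?_) P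
    have h2 := hFf (eulerMap K W (μ t) h P)
    have h3 := hF1 (P.1 + ((h * smoothVel K a b P.1 P.2.1 P.2.2 : ℝ) : Phase))
      (P.1 + ((h * vel K W (μ t) P : ℝ) : Phase)) P.2.1 P.2.2
    have h4 : dist (P.1 + ((h * smoothVel K a b P.1 P.2.1 P.2.2 : ℝ) : Phase))
        (P.1 + ((h * vel K W (μ t) P : ℝ) : Phase)) ≤ h * (|K| * (2 * e)) := by
      refine (dist_add_coe_le _ _ _ _).trans ?_
      rw [dist_self, zero_add, ← mul_sub, abs_mul, abs_of_pos hh, abs_sub_comm]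
      exact mul_le_mul_of_nonneg_left (abs_smoothVel_sub_le hW (μ t) ha hb P) hh.le
    calc _ ≤ _ := abs_sub_le _ (F (P.1 + ((h * vel K W (μ t) P : ℝ) : Phase)) P.2.1 P.2.2) _
      _ ≤ _ := add_le_add (h3.trans h4) h2
      _ = _ := add_comm _ _
  have hmid : |∫ P : G, ψ (t + h) P.1 P.2.1 P.2.2 ∂(μ (t + h)) -
      ∫ P : G, ψ t P.1 P.2.1 P.2.2 ∂(μ t)| ≤ (ε / 2 + |K| * (2 * e) + h * C) * h := by
    rw [hμ.weak_sub hW hψ ht' hth]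
    have := intervalIntegral.norm_integral_le_of_norm_le_const (a := t) (b := t + h)
      (f := fun u => ∫ P : G, (deriv (fun s => ψ s P.1 P.2.1 P.2.2) u +
          vel K W (μ u) P * derivPhase (fun θ => ψ u θ P.2.1 P.2.2) P.1) ∂(μ u))
      (C := ε / 2 + |K| * (2 * e) + h * C) fun u hu => ?_
    · rwa [Real.norm_eq_abs, add_sub_cancel_left, abs_of_pos hh] at this
    · rw [Set.uIoc_of_le (by linarith)] at hu
      have hu' : u ∈ Set.Icc 0 T := ⟨by linarith [hu.1], by linarith [hu.2]⟩
      have := hμ.prob u hu'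
      refine abs_integral_le_of_abs_le fun P => ?_
      refine (abs_transport_le hχ hFs hF1 has hbs u (vel K W (μ u) P) P.1 P.2.1 P.2.2).trans ?_
      have e1 : χ P.2.1 * |vel K W (μ u) P - vel K W (μ t) P| ≤ ε / 2 := by
        have h1 := hmod u hu' t ht' (by rw [abs_of_pos] <;> linarith [hu.1, hu.2]) P
        have h2 : vel K W (μ u) P - vel K W (μ t) P =
          K * (drift W (μ u) P - drift W (μ t) P) := by unfold vel; ring
        rw [← mul_sub, abs_mul, abs_of_nonneg (hχ.nonneg _), lt_div_iff₀ (by positivity)] at h1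
        rw [h2, abs_mul]
        have h3 : 0 ≤ χ P.2.1 * |drift W (μ u) P - drift W (μ t) P| :=
          mul_nonneg (hχ.nonneg _) (abs_nonneg _)
        nlinarith [abs_nonneg K]
      have e2 : χ P.2.1 * |vel K W (μ t) P - smoothVel K a b P.1 P.2.1 P.2.2| ≤
          |K| * (2 * e) := by
        calc _ ≤ 1 * (|K| * (2 * e)) := mul_le_mul (hχ.le_one _)
              (abs_smoothVel_sub_le hW (μ t) ha hb P) (abs_nonneg _) zero_le_one
          _ = _ := one_mul _
      have e3 : χ P.2.1 * |(t + h - u) * (K * (a P.2.2 * sinPhase P.1 + b P.2.2 * cosPhase P.1) *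
          vel K W (μ u) P)| ≤ h * C := by
        have h1 : |a P.2.2 * sinPhase P.1 + b P.2.2 * cosPhase P.1| ≤ 2 * (B + 1) := by
          refine (abs_add_le _ _).trans ?_
          rw [abs_mul, abs_mul]
          have h2 := mul_le_mul (haB P.2.2) (abs_sinPhase_le_one P.1) (abs_nonneg _)
            (by positivity)
          have h3 := mul_le_mul (hbB P.2.2) (abs_cosPhase_le_one P.1) (abs_nonneg _)
            (by positivity)
          linarith
        have h4 := cutoff_mul_abs_vel_le (K := K) hW hχ hR0 hR (μ u) P
        rw [abs_mul, abs_mul, abs_mul, abs_of_nonneg (by linarith [hu.2] : 0 ≤ t + h - u)]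
        calc _ = (t + h - u) * (|K| * |a P.2.2 * sinPhase P.1 + b P.2.2 * cosPhase P.1| *
              (χ P.2.1 * |vel K W (μ u) P|)) := by ring
          _ ≤ h * (|K| * (2 * (B + 1)) * (R + |K| * B)) := by
            have := hχ.nonneg P.2.1
            gcongr
            linarith [hu.1]
          _ = h * C := by rw [hC]; ring
      calc _ ≤ χ P.2.1 * (|vel K W (μ u) P - vel K W (μ t) P| +
            |vel K W (μ t) P - smoothVel K a b P.1 P.2.1 P.2.2| + |(t + h - u) *
              (K * (a P.2.2 * sinPhase P.1 + b P.2.2 * cosPhase P.1) * vel K W (μ u) P)|) := by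
            refine mul_le_mul_of_nonneg_left ?_ (hχ.nonneg _)
            refine (abs_sub _ _).trans (add_le_add_left ?_ _)
            exact abs_sub_le _ _ _
        _ ≤ _ := by rw [mul_add, mul_add]; linarith
  have hψ1 : ∀ u, ∀ ν : Measure G, IsProbabilityMeasure ν →
      Integrable (fun P : G => ψ u P.1 P.2.1 P.2.2) ν := by
    intro u ν _
    refine integrable_of_abs_le (hψc u).aestronglyMeasurable (c := 2) fun P => ?_
    refine abs_cutoff_mul_le hχ (f := fun P => F (P.1 + (((t + h - u) *
      smoothVel K a b P.1 P.2.1 P.2.2 : ℝ) : Phase)) P.2.1 P.2.2) (fun P => ?_) P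
    have h1 := hFf (P.1 + (((t + h - u) * smoothVel K a b P.1 P.2.1 P.2.2 : ℝ) : Phase), P.2)
    have h2 := hf1 (P.1 + (((t + h - u) * smoothVel K a b P.1 P.2.1 P.2.2 : ℝ) : Phase), P.2)
    rw [abs_le] at *
    constructor <;> linarith
  have hend' : |∫ P : G, ψ (t + h) P.1 P.2.1 P.2.2 ∂(μ (t + h)) -
      ∫ P, χ P.2.1 * f P ∂(μ (t + h))| ≤ e := by
    rw [← integral_sub (hψ1 _ _ inferInstance) (integrable_cutoff_mul hχ hfc hf1 _)]
    exact abs_integral_le_of_abs_le hend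
  have hstart' : |∫ P : G, ψ t P.1 P.2.1 P.2.2 ∂(μ t) -
      ∫ P, χ P.2.1 * f (eulerMap K W (μ t) h P) ∂(μ t)| ≤ e + h * (|K| * (2 * e)) := by
    have hi : Integrable (fun P => χ P.2.1 * f (eulerMap K W (μ t) h P)) (μ t) :=
      integrable_cutoff_mul hχ (hfc.comp (continuous_eulerMap hW _ h)) (fun P => hf1 _) _
    rw [← integral_sub (hψ1 _ _ inferInstance) hi]
    exact abs_integral_le_of_abs_le hstart
  have hhC' : h * C * h ≤ ε / 2 * h := mul_le_mul_of_nonneg_right hhC hh.le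
  rw [abs_le] at *
  constructor <;> nlinarith

lemma integral_cutoff_eq (hμ : IsMeasureSolution K W T m μ) (hχ : IsCutoff χ) {t : ℝ}
    (ht : t ∈ Set.Icc 0 T) : ∫ P, χ P.2.1 ∂(μ t) = ∫ P, χ P.2.1 ∂m := by
  have hψ : IsTestFunction fun _ _ s _ => χ s :=
    ⟨hχ.contDiff.comp (by fun_prop : ContDiff ℝ 1 fun p : ℝ × ℝ × ℝ × ℝ => p.2.2.1), by
      obtain ⟨R, -, hR⟩ := hχ.support
      exact ⟨R, fun _ _ s _ h => hR s h⟩⟩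
  simpa [derivPhase] using hμ.weak _ hψ t ht

lemma integral_initial_eq [IsProbabilityMeasure m] (hμ : IsMeasureSolution K W T m μ)
    (hT : 0 ≤ T) (hχ : IsCutoff χ) {f : G → ℝ} (hf : f ∈ lipClass) :
    ∫ P, χ P.2.1 * f P ∂(μ 0) = ∫ P, χ P.2.1 * f P ∂m := by
  have h0 : (0 : ℝ) ∈ Set.Icc 0 T := ⟨le_rfl, hT⟩
  have := hμ.prob 0 h0
  have hfc := continuous_of_mem_lipClass hf
  have hf1 := abs_le_one_of_mem_lipClass hf
  rw [← sub_eq_zero, ← abs_eq_zero]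
  refine le_antisymm (le_of_forall_small_le (D := 2) zero_le_two fun e he he1 => ?_) (abs_nonneg _)
  obtain ⟨F, hFs, hFf, -⟩ := exists_smooth_approx hf he
  have hψ : IsTestFunction fun _ θ s x => χ s * F θ s x := by
    refine ⟨?_, ?_⟩
    · exact (hχ.contDiff.comp (by fun_prop : ContDiff ℝ 1 fun p : ℝ × ℝ × ℝ × ℝ => p.2.2.1)).mul
        (hFs.comp (by fun_prop : ContDiff ℝ 1 fun p : ℝ × ℝ × ℝ × ℝ => p.2))
    · obtain ⟨R, -, hR⟩ := hχ.support
      exact ⟨R, fun _ _ s _ h => by simp [hR s h]⟩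
  have hFc : Continuous fun P : G => χ P.2.1 * F P.1 P.2.1 P.2.2 :=
    hψ.continuous.comp (f := fun P : G => ((0 : ℝ), P)) (by fun_prop)
  have hw := hμ.weak _ hψ 0 h0
  simp only [intervalIntegral.integral_same, add_zero] at hw
  have key : ∀ ν : Measure G, IsProbabilityMeasure ν →
      |∫ P : G, χ P.2.1 * F P.1 P.2.1 P.2.2 ∂ν - ∫ P, χ P.2.1 * f P ∂ν| ≤ e := by
    intro ν _
    rw [← integral_sub _ (integrable_cutoff_mul hχ hfc hf1 _)]
    · simp_rw [← mul_sub]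
      exact abs_integral_le_of_abs_le (abs_cutoff_mul_le hχ hFf)
    · refine integrable_of_abs_le hFc.aestronglyMeasurable (c := 2) (abs_cutoff_mul_le hχ
        (f := fun P => F P.1 P.2.1 P.2.2) fun P => ?_)
      have h1 := hFf P
      have h2 := hf1 P
      rw [abs_le] at *
      constructor <;> linarith
  have h1 := key m inferInstance
  have h2 := key (μ 0) inferInstance
  rw [abs_le] at *
  constructor <;> linarith

end IsMeasureSolution

/-! ### The law of the initial data -/

/-- The standing assumptions on the initial densities. -/
structure IsInitialDensity (g : ℝ → ℝ) (q : Phase → ℝ → I → ℝ) : Prop where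
  cont_freq : Continuous g
  nonneg_freq : ∀ s, 0 ≤ g s
  cont : Continuous (fun P : G => q P.1 P.2.1 P.2.2)
  nonneg : ∀ φ s x, 0 ≤ q φ s x
  unif : ∀ ε > 0, ∃ δ > 0, ∀ x₁ x₂ : I, |(x₁ : ℝ) - (x₂ : ℝ)| < δ →
      ∀ φ s, |q φ s x₁ - q φ s x₂| < ε
  integral_eq_one : ∀ s x, ∫ φ, q φ s x = 1
  prob : IsProbabilityMeasure ((volume : Measure ℝ).withDensity fun s => ENNReal.ofReal (g s))

/-- The law of the frequencies. -/
def freqLaw (g : ℝ → ℝ) : Measure ℝ := volume.withDensity fun s => ENNReal.ofReal (g s)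

/-- The conditional law of the phase. -/
def phaseLaw (q : Phase → ℝ → I → ℝ) (x : I) (s : ℝ) : Measure Phase :=
  volume.withDensity fun φ => ENNReal.ofReal (q φ s x)

/-- The joint law of phase and frequency at the position `x`. -/
def pairLaw (g : ℝ → ℝ) (q : Phase → ℝ → I → ℝ) (x : I) : Measure (Phase × ℝ) :=
  volume.withDensity fun p => ENNReal.ofReal (q p.1 p.2 x * g p.2)

/-- The initial law on the state space. -/
def initialLaw (g : ℝ → ℝ) (q : Phase → ℝ → I → ℝ) : Measure G :=
  densityMeasure fun P => q P.1 P.2.1 P.2.2 * g P.2.1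

namespace IsInitialDensity

variable {g : ℝ → ℝ} {q : Phase → ℝ → I → ℝ}

lemma continuous_pair (h : IsInitialDensity g q) (x : I) :
    Continuous fun p : Phase × ℝ => q p.1 p.2 x :=
  h.cont.comp (f := fun p : Phase × ℝ => (p.1, p.2, x)) (by fun_prop)

lemma measurable_pairDensity (h : IsInitialDensity g q) (x : I) :
    Measurable fun p : Phase × ℝ => ENNReal.ofReal (q p.1 p.2 x * g p.2) :=
  ((h.continuous_pair x).mul (h.cont_freq.comp continuous_snd)).measurable.ennreal_ofReal

lemma continuous_phase (h : IsInitialDensity g q) (s : ℝ) (x : I) :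
    Continuous fun φ : Phase => q φ s x :=
  h.cont.comp (f := fun φ : Phase => (φ, s, x)) (by fun_prop)

lemma isProbabilityMeasure_freqLaw (h : IsInitialDensity g q) :
    IsProbabilityMeasure (freqLaw g) := h.prob

lemma integrable_freq (h : IsInitialDensity g q) : Integrable g := by
  refine ⟨h.cont_freq.aestronglyMeasurable, ?_⟩
  rw [hasFiniteIntegral_iff_ofReal (Eventually.of_forall h.nonneg_freq)]
  have h1 := h.prob.measure_univ
  rw [withDensity_apply _ MeasurableSet.univ, Measure.restrict_univ] at h1
  rw [h1]
  exact ENNReal.one_lt_top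

lemma isProbabilityMeasure_phaseLaw (h : IsInitialDensity g q) (x : I) (s : ℝ) :
    IsProbabilityMeasure (phaseLaw q x s) := by
  have hi : Integrable fun φ : Phase => q φ s x :=
    (h.continuous_phase s x).integrable_of_hasCompactSupport
      (HasCompactSupport.of_compactSpace _)
  constructor
  rw [phaseLaw, withDensity_apply _ MeasurableSet.univ, Measure.restrict_univ,
    ← ofReal_integral_eq_lintegral_ofReal hi (Eventually.of_forall fun _ => h.nonneg _ _ _),
    h.integral_eq_one, ENNReal.ofReal_one]

lemma measurable_phaseLaw_apply (h : IsInitialDensity g q) (x : I) {A : Set (Phase × ℝ)}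
    (hA : MeasurableSet A) : Measurable fun s => phaseLaw q x s {φ | (φ, s) ∈ A} := by
  have h1 : ∀ s, phaseLaw q x s {φ | (φ, s) ∈ A} =
      ∫⁻ φ, A.indicator (fun p => ENNReal.ofReal (q p.1 p.2 x)) (φ, s) := by
    intro s
    have hs : MeasurableSet {φ | (φ, s) ∈ A} := measurable_prodMk_right hA
    rw [phaseLaw, withDensity_apply _ hs, ← lintegral_indicator hs]
    rfl
  simp_rw [h1]
  exact ((h.continuous_pair x).measurable.ennreal_ofReal.indicator hA).lintegral_prod_left'

lemma pairLaw_apply (h : IsInitialDensity g q) (x : I) {A : Set (Phase × ℝ)}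
    (hA : MeasurableSet A) :
    pairLaw g q x A = ∫⁻ s, phaseLaw q x s {φ | (φ, s) ∈ A} ∂(freqLaw g) := by
  have hgm : Measurable fun s => ENNReal.ofReal (g s) := h.cont_freq.measurable.ennreal_ofReal
  have hm := h.measurable_pairDensity x
  rw [pairLaw, withDensity_apply _ hA, ← lintegral_indicator hA, Measure.volume_eq_prod,
    lintegral_prod_symm' _ (hm.indicator hA), freqLaw,
    lintegral_withDensity_eq_lintegral_mul _ hgm (h.measurable_phaseLaw_apply x hA)]
  refine lintegral_congr fun s => ?_
  have hs : MeasurableSet {φ | (φ, s) ∈ A} := measurable_prodMk_right hA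
  rw [Pi.mul_apply, phaseLaw, withDensity_apply _ hs, ← lintegral_indicator hs,
    ← lintegral_const_mul' _ _ ENNReal.ofReal_ne_top]
  refine lintegral_congr fun φ => ?_
  by_cases hφ : (φ, s) ∈ A
  · rw [Set.indicator_of_mem hφ, Set.indicator_of_mem (show φ ∈ {φ | (φ, s) ∈ A} from hφ),
      ENNReal.ofReal_mul (h.nonneg _ _ _), mul_comm]
  · rw [Set.indicator_of_notMem hφ, Set.indicator_of_notMem (show φ ∉ {φ | (φ, s) ∈ A} from hφ),
      mul_zero]

lemma isProbabilityMeasure_pairLaw (h : IsInitialDensity g q) (x : I) :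
    IsProbabilityMeasure (pairLaw g q x) := by
  have := h.isProbabilityMeasure_freqLaw
  constructor
  rw [h.pairLaw_apply x MeasurableSet.univ]
  have h1 : ∀ s, phaseLaw q x s {φ | (φ, s) ∈ (Set.univ : Set (Phase × ℝ))} = 1 := fun s => by
    have := h.isProbabilityMeasure_phaseLaw x s
    simp
  rw [lintegral_congr h1]
  simp

lemma integral_pairLaw (h : IsInitialDensity g q) (x : I) (f : Phase × ℝ → ℝ) :
    ∫ p, f p ∂(pairLaw g q x) = ∫ p : Phase × ℝ, f p * (q p.1 p.2 x * g p.2) := by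
  have hm := h.measurable_pairDensity x
  rw [pairLaw, integral_withDensity_eq_integral_toReal_smul hm
    (Eventually.of_forall fun _ => ENNReal.ofReal_lt_top)]
  refine integral_congr_ae (Eventually.of_forall fun p => ?_)
  simp only [ENNReal.toReal_ofReal (mul_nonneg (h.nonneg _ _ _) (h.nonneg_freq _)), smul_eq_mul]
  ring

lemma continuous_density (h : IsInitialDensity g q) :
    Continuous fun P : G => q P.1 P.2.1 P.2.2 * g P.2.1 :=
  h.cont.mul (h.cont_freq.comp (by fun_prop))

lemma density_nonneg (h : IsInitialDensity g q) (P : G) : 0 ≤ q P.1 P.2.1 P.2.2 * g P.2.1 :=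
  mul_nonneg (h.nonneg _ _ _) (h.nonneg_freq _)

lemma isProbabilityMeasure_initialLaw (h : IsInitialDensity g q) :
    IsProbabilityMeasure (initialLaw g q) := by
  constructor
  have hm : Measurable fun P : G => ENNReal.ofReal (q P.1 P.2.1 P.2.2 * g P.2.1) :=
    h.continuous_density.measurable.ennreal_ofReal
  have e := (volume_preserving_prodAssoc (α₁ := Phase) (β₁ := ℝ) (γ₁ := I))
  rw [initialLaw, densityMeasure, withDensity_apply _ MeasurableSet.univ, Measure.restrict_univ,
    ← e.lintegral_comp hm, Measure.volume_eq_prod (Phase × ℝ) I]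
  refine (lintegral_prod_symm' _ (hm.comp e.measurable)).trans ?_
  have : ∀ x : I, ∫⁻ p : Phase × ℝ, ENNReal.ofReal (q p.1 p.2 x * g p.2) = 1 := fun x => by
    have := h.isProbabilityMeasure_pairLaw x
    have h1 := measure_univ (μ := pairLaw g q x)
    rwa [pairLaw, withDensity_apply _ MeasurableSet.univ, Measure.restrict_univ] at h1
  calc _ = ∫⁻ x : I, ∫⁻ p : Phase × ℝ, ENNReal.ofReal (q p.1 p.2 x * g p.2) := rfl
    _ = 1 := by simp [this]

lemma integral_initialLaw (h : IsInitialDensity g q) {f : G → ℝ} (hf : Continuous f) {c : ℝ}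
    (hc : ∀ P, |f P| ≤ c) :
    ∫ P, f P ∂(initialLaw g q) = ∫ x : I, ∫ p : Phase × ℝ, f (p.1, p.2, x) ∂(pairLaw g q x) := by
  have e := (volume_preserving_prodAssoc (α₁ := Phase) (β₁ := ℝ) (γ₁ := I))
  have := h.isProbabilityMeasure_initialLaw
  have hint : Integrable fun P : G => f P * (q P.1 P.2.1 P.2.2 * g P.2.1) := by
    have h1 : Integrable f (initialLaw g q) := integrable_of_abs_le hf.aestronglyMeasurable hc
    rw [initialLaw, densityMeasure, integrable_withDensity_iff
      h.continuous_density.measurable.ennreal_ofReal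
      (Eventually.of_forall fun _ => ENNReal.ofReal_lt_top)] at h1
    simpa only [ENNReal.toReal_ofReal (h.density_nonneg _)] using h1
  rw [initialLaw, integral_densityMeasure h.continuous_density.measurable h.density_nonneg,
    ← e.integral_comp MeasurableEquiv.prodAssoc.measurableEmbedding,
    Measure.volume_eq_prod (Phase × ℝ) I, integral_prod_symm]
  · refine integral_congr_ae (Eventually.of_forall fun x => ?_)
    simp only [h.integral_pairLaw]
    rfl
  · exact e.integrable_comp_of_integrable hint

/-- The mean of an observable depends continuously on the position. -/
lemma continuous_integral_pairLaw (h : IsInitialDensity g q) {f : G → ℝ} (hf : Continuous f)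
    {c : ℝ} (hc : ∀ P, |f P| ≤ c) :
    Continuous fun x : I => ∫ p : Phase × ℝ, f (p.1, p.2, x) ∂(pairLaw g q x) := by
  have hfx : ∀ x : I, Continuous fun p : Phase × ℝ => f (p.1, p.2, x) := fun x =>
    hf.comp (by fun_prop)
  have hgi : Integrable fun p : Phase × ℝ => g p.2 := h.integrable_freq.comp_snd volume
  have hc0 : 0 ≤ c := (abs_nonneg _).trans (hc (0, 0, 0))
  have hint : ∀ x y, Integrable fun p : Phase × ℝ => f (p.1, p.2, x) * (q p.1 p.2 y * g p.2) := by
    intro x y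
    have := h.isProbabilityMeasure_pairLaw y
    have h1 : Integrable (fun p : Phase × ℝ => f (p.1, p.2, x)) (pairLaw g q y) :=
      integrable_of_abs_le (hfx x).aestronglyMeasurable fun _ => hc _
    rw [pairLaw, integrable_withDensity_iff (h.measurable_pairDensity y)
      (Eventually.of_forall fun _ => ENNReal.ofReal_lt_top)] at h1
    simpa only [ENNReal.toReal_ofReal (mul_nonneg (h.nonneg _ _ _) (h.nonneg_freq _))] using h1
  set J : ℝ := ∫ p : Phase × ℝ, g p.2 with hJ
  have hJ0 : 0 ≤ J := integral_nonneg fun p => h.nonneg_freq _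
  rw [continuous_iff_continuousAt]
  intro x₀
  have := h.isProbabilityMeasure_pairLaw x₀
  have hB : Continuous fun x : I => ∫ p : Phase × ℝ, f (p.1, p.2, x) ∂(pairLaw g q x₀) := by
    refine continuous_of_dominated (bound := fun _ => c) (fun x => (hfx x).aestronglyMeasurable)
      (fun x => Eventually.of_forall fun p => hc _) (integrable_const c)
      (Eventually.of_forall fun p => hf.comp (by fun_prop))
  rw [Metric.continuousAt_iff]
  intro ε hε
  obtain ⟨δ₁, hδ₁, h₁⟩ := Metric.continuousAt_iff.mp hB.continuousAt (ε / 2) (half_pos hε)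
  obtain ⟨δ₂, hδ₂, h₂⟩ := h.unif (ε / (2 * (c * J + 1))) (by positivity)
  refine ⟨min δ₁ δ₂, lt_min hδ₁ hδ₂, fun x hx => ?_⟩
  have h₃ := h₁ (hx.trans_le (min_le_left _ _))
  have h₄ := h₂ x x₀ (hx.trans_le (min_le_right _ _))
  have h₅ : |∫ p, f (p.1, p.2, x) ∂(pairLaw g q x) - ∫ p, f (p.1, p.2, x) ∂(pairLaw g q x₀)| ≤
      ε / 2 := by
    rw [h.integral_pairLaw, h.integral_pairLaw, ← integral_sub (hint x x) (hint x x₀)]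
    calc _ ≤ ∫ p : Phase × ℝ, c * (ε / (2 * (c * J + 1))) * g p.2 := by
          rw [← Real.norm_eq_abs]
          refine norm_integral_le_of_norm_le (hgi.const_mul _) (Eventually.of_forall fun p => ?_)
          have h6 : f (p.1, p.2, x) * (q p.1 p.2 x * g p.2) -
              f (p.1, p.2, x) * (q p.1 p.2 x₀ * g p.2) =
              f (p.1, p.2, x) * (q p.1 p.2 x - q p.1 p.2 x₀) * g p.2 := by ring
          rw [h6, Real.norm_eq_abs, abs_mul, abs_mul, abs_of_nonneg (h.nonneg_freq _)]
          exact mul_le_mul_of_nonneg_right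
            (mul_le_mul (hc _) (h₄ _ _).le (abs_nonneg _) hc0) (h.nonneg_freq _)
      _ = c * J * ε / (2 * (c * J + 1)) := by rw [integral_const_mul, ← hJ]; ring
      _ ≤ ε / 2 := by
          rw [div_le_div_iff₀ (by positivity) two_pos]
          nlinarith
  rw [Real.dist_eq] at h₃ ⊢
  calc _ ≤ _ := abs_sub_le _ (∫ p, f (p.1, p.2, x) ∂(pairLaw g q x₀)) _
    _ < ε / 2 + ε / 2 := add_lt_add_of_le_of_lt h₅ h₃
    _ = ε := add_halves ε

end IsInitialDensity

theorem IsSampled.map_pair_eq {Ω : Type*} [MeasurableSpace Ω] {Pr : Measure Ω}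
    [IsProbabilityMeasure Pr] {g : ℝ → ℝ} {q : Phase → ℝ → I → ℝ} {ξ : (n : ℕ) → Fin n → I}
    {ω : ℕ → Ω → ℝ} {θ₀ : (n : ℕ) → Fin n → Ω → Phase} (h : IsInitialDensity g q)
    (hs : IsSampled Pr g q ξ ω θ₀) (n : ℕ) :
    Pr.map (fun z (i : Fin n) => (θ₀ n i z, ω i z)) =
      Measure.pi fun i : Fin n => pairLaw g q (ξ n i) := by
  have hω : Measurable fun z (i : Fin n) => ω i z :=
    measurable_pi_lambda _ fun i => hs.measurable_freq i
  have hθ : Measurable fun z (i : Fin n) => θ₀ n i z :=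
    measurable_pi_lambda _ fun i => hs.measurable_phase n i
  have := fun i : Fin n => h.isProbabilityMeasure_pairLaw (ξ n i)
  refine (Measure.pi_eq fun A hA => ?_).symm
  set D : Set ((Fin n → ℝ) × (Fin n → Phase)) := {p | ∀ i, (p.2 i, p.1 i) ∈ A i} with hD
  have hDm : MeasurableSet D := by
    rw [hD, Set.ofPred_forall]
    refine MeasurableSet.iInter fun i => ?_
    exact (by fun_prop : Measurable fun p : (Fin n → ℝ) × (Fin n → Phase) => (p.2 i, p.1 i)) (hA i)
  have h1 : Pr.map (fun z (i : Fin n) => (θ₀ n i z, ω i z)) (Set.univ.pi A) =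
      Pr.map (fun z => ((fun i : Fin n => ω i z), fun i : Fin n => θ₀ n i z)) D := by
    rw [Measure.map_apply (measurable_pi_lambda _ fun i =>
      (hs.measurable_phase n i).prodMk (hs.measurable_freq i)) (MeasurableSet.univ_pi hA),
      Measure.map_apply (hω.prodMk hθ) hDm]
    congr 1
    ext z
    simp [hD]
  rw [h1, ← compProd_map_condDistrib hθ.aemeasurable, Measure.compProd_apply hDm]
  have h2 : ∀ᵐ w ∂(Pr.map fun z (i : Fin n) => ω i z),
      condDistrib (fun z (i : Fin n) => θ₀ n i z) (fun z (i : Fin n) => ω i z) Pr w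
        (Prod.mk w ⁻¹' D) = ∏ i, phaseLaw q (ξ n i) (w i) {φ | (φ, w i) ∈ A i} := by
    filter_upwards [hs.condLaw_phase n] with w hw
    have := fun i : Fin n => h.isProbabilityMeasure_phaseLaw (ξ n i) (w i)
    have h3 : Prod.mk w ⁻¹' D = Set.univ.pi fun i => {φ | (φ, w i) ∈ A i} := by
      ext φ; simp [hD]
    rw [hw, h3]
    exact Measure.pi_pi (fun i => phaseLaw q (ξ n i) (w i)) _
  rw [lintegral_congr_ae h2]
  have hmeas : ∀ i : Fin n, Measurable fun s => phaseLaw q (ξ n i) s {φ | (φ, s) ∈ A i} :=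
    fun i => h.measurable_phaseLaw_apply _ (hA i)
  have hprod : Measurable fun w : Fin n → ℝ =>
      ∏ i, phaseLaw q (ξ n i) (w i) {φ | (φ, w i) ∈ A i} :=
    Finset.measurable_prod _ fun i _ => (hmeas i).comp (measurable_pi_apply i)
  rw [lintegral_map hprod hω]
  have hind : iIndepFun (fun (i : Fin n) z => phaseLaw q (ξ n i) (ω i z) {φ | (φ, ω i z) ∈ A i})
      Pr := (hs.indep_freq.precomp (Fin.val_injective (n := n))).comp
        (fun i s => phaseLaw q (ξ n i) s {φ | (φ, s) ∈ A i}) hmeas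
  rw [lintegral_prod_eq_prod_lintegral_of_indepFun Finset.univ _ hind
    fun i => (hmeas i).comp (hs.measurable_freq i)]
  refine Finset.prod_congr rfl fun i _ => ?_
  rw [h.pairLaw_apply _ (hA i), freqLaw, ← hs.law_freq i,
    lintegral_map (hmeas i) (hs.measurable_freq i)]

/-! ### Convergence of the initial empirical measures -/

/-- The bounded Lipschitz distance to a fixed probability measure is controlled by finitely many
continuous observables. -/
lemma exists_observables (m : Measure G) [IsProbabilityMeasure m] {ε : ℝ} (hε : 0 < ε) :
    ∃ (N : ℕ) (φ : Fin N → G → ℝ), (∀ j, Continuous (φ j)) ∧ (∀ j P, |φ j P| ≤ 1) ∧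
      ∀ ν : Measure G, IsProbabilityMeasure ν →
        blDist ν m ≤ 2 * ∑ j, |∫ P, φ j P ∂ν - ∫ P, φ j P ∂m| + ε := by
  obtain ⟨A, hA, hAm⟩ := isTightMeasureSet_iff_exists_isCompact_measure_compl_le.mp
    (isTightMeasureSet_singleton (μ := m)) (ENNReal.ofReal (ε / 4)) (by simpa using hε)
  replace hAm : m.real Aᶜ ≤ ε / 4 := by
    have := hAm m rfl
    rw [measureReal_def]
    exact ENNReal.toReal_le_of_le_ofReal (by positivity) this
  obtain ⟨t, -, ht⟩ := hA.elim_nhds_subcover (fun P => Metric.ball P (ε / 12))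
    fun P _ => Metric.ball_mem_nhds P (by positivity)
  set N := t.card with hN
  let p : Fin N → G := fun j => (t.equivFin.symm j : G)
  have hcov : A ⊆ ⋃ j, Metric.ball (p j) (ε / 12) := by
    intro P hP
    obtain ⟨Q, hQ, hPQ⟩ := Set.mem_iUnion₂.mp (ht hP)
    exact Set.mem_iUnion.mpr ⟨t.equivFin ⟨Q, hQ⟩, by simpa [p] using hPQ⟩
  obtain ⟨φ, hφ⟩ := PartitionOfUnity.exists_isSubordinate_of_locallyFinite hA.isClosed
    (fun j => Metric.ball (p j) (ε / 12)) (fun j => Metric.isOpen_ball) (locallyFinite_of_finite _)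
    hcov
  have hsum_le : ∀ P, ∑ j, φ j P ≤ 1 := fun P => by
    have := φ.sum_le_one P
    rwa [finsum_eq_sum_of_fintype] at this
  have hsum_eq : ∀ P ∈ A, ∑ j, φ j P = 1 := fun P hP => by
    have := φ.sum_eq_one hP
    rwa [finsum_eq_sum_of_fintype] at this
  have hφ1 : ∀ j P, |φ j P| ≤ 1 := fun j P => by
    rw [abs_of_nonneg (φ.nonneg j P)]; exact φ.le_one j P
  have hφi : ∀ j (ν : Measure G) [IsProbabilityMeasure ν], Integrable (φ j) ν := fun j ν _ =>
    integrable_of_abs_le (φ j).continuous.aestronglyMeasurable (hφ1 j)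
  refine ⟨N, fun j => φ j, fun j => (φ j).continuous, hφ1, fun ν hν => blDist_le fun f hf => ?_⟩
  have hfc := continuous_of_mem_lipClass hf
  have key : ∀ (ν : Measure G) [IsProbabilityMeasure ν],
      |∫ P, f P ∂ν - ∑ j, f (p j) * ∫ P, φ j P ∂ν| ≤ ε / 4 + (1 - ∑ j, ∫ P, φ j P ∂ν) := by
    intro ν _
    have hfi : Integrable f ν :=
      integrable_of_abs_le hfc.aestronglyMeasurable (abs_le_one_of_mem_lipClass hf)
    have hsi : Integrable (fun P => ∑ j, f (p j) * φ j P) ν :=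
      integrable_finsetSum _ fun j _ => (hφi j ν).const_mul _
    have hSi : Integrable (fun P => ∑ j, φ j P) ν := integrable_finsetSum _ fun j _ => hφi j ν
    have e1 : ∑ j, f (p j) * ∫ P, φ j P ∂ν = ∫ P, ∑ j, f (p j) * φ j P ∂ν := by
      rw [integral_finsetSum _ fun j _ => (hφi j ν).const_mul _]
      simp_rw [integral_const_mul]
    have e2 : ε / 4 + (1 - ∑ j, ∫ P, φ j P ∂ν) = ∫ P, (ε / 4 + (1 - ∑ j, φ j P)) ∂ν := by
      have hi : Integrable (fun P => 1 - ∑ j, φ j P) ν := (integrable_const _).sub hSi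
      rw [integral_add (integrable_const _) hi, integral_sub (integrable_const _) hSi,
        integral_finsetSum _ fun j _ => hφi j ν]
      simp
    rw [e1, e2, ← integral_sub hfi hsi, ← Real.norm_eq_abs]
    refine norm_integral_le_of_norm_le ((integrable_const _).add ((integrable_const _).sub hSi))
      (Eventually.of_forall fun P => ?_)
    have e3 : f P - ∑ j, f (p j) * φ j P =
        ∑ j, (f P - f (p j)) * φ j P + f P * (1 - ∑ j, φ j P) := by
      simp_rw [sub_mul]
      rw [Finset.sum_sub_distrib, ← Finset.mul_sum]
      ring
    rw [e3, Real.norm_eq_abs]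
    refine (abs_add_le _ _).trans (add_le_add ?_ ?_)
    · refine (Finset.abs_sum_le_sum_abs _ _).trans ?_
      calc _ ≤ ∑ j, ε / 4 * φ j P := Finset.sum_le_sum fun j _ => ?_
        _ = ε / 4 * ∑ j, φ j P := by rw [Finset.mul_sum]
        _ ≤ ε / 4 * 1 := mul_le_mul_of_nonneg_left (hsum_le P) (by positivity)
        _ = ε / 4 := mul_one _
      rw [abs_mul, abs_of_nonneg (φ.nonneg j P)]
      by_cases hz : φ j P = 0
      · simp [hz]
      · have hP : P ∈ Metric.ball (p j) (ε / 12) := hφ j (subset_tsupport _ hz)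
        refine mul_le_mul_of_nonneg_right ((hf.2 _ _).trans ?_) (φ.nonneg j P)
        have := distG_le_mul_dist P (p j)
        rw [Metric.mem_ball] at hP
        linarith
    · have h0 : 0 ≤ 1 - ∑ j, φ j P := by linarith [hsum_le P]
      rw [abs_mul, abs_of_nonneg h0]
      calc _ ≤ 1 * (1 - ∑ j, φ j P) :=
            mul_le_mul_of_nonneg_right (abs_le_one_of_mem_lipClass hf P) h0
        _ = _ := one_mul _
  have hm : 1 - ∑ j, ∫ P, φ j P ∂m ≤ ε / 4 := by
    refine le_trans ?_ hAm
    have hSi : Integrable (fun P => ∑ j, φ j P) m := integrable_finsetSum _ fun j _ => hφi j m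
    have e1 : 1 - ∑ j, ∫ P, φ j P ∂m = ∫ P, (1 - ∑ j, φ j P) ∂m := by
      rw [integral_sub (integrable_const _) hSi, integral_finsetSum _ fun j _ => hφi j m]
      simp
    have e2 : m.real Aᶜ = ∫ P, Aᶜ.indicator (fun _ => (1 : ℝ)) P ∂m := by
      rw [integral_indicator_const _ hA.measurableSet.compl]
      simp
    rw [e1, e2]
    refine integral_mono ((integrable_const _).sub hSi)
      ((integrable_const _).indicator hA.measurableSet.compl) fun P => ?_
    by_cases hP : P ∈ A
    · simp [hP, hsum_eq P hP]
    · have : 0 ≤ ∑ j, φ j P := Finset.sum_nonneg fun j _ => φ.nonneg j P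
      simp [hP, this]
  have h1 := key ν
  have h2 := key m
  have h3 : |∑ j, f (p j) * ∫ P, φ j P ∂ν - ∑ j, f (p j) * ∫ P, φ j P ∂m| ≤
      ∑ j, |∫ P, φ j P ∂ν - ∫ P, φ j P ∂m| := by
    rw [← Finset.sum_sub_distrib]
    refine (Finset.abs_sum_le_sum_abs _ _).trans (Finset.sum_le_sum fun j _ => ?_)
    rw [← mul_sub, abs_mul]
    calc _ ≤ 1 * |∫ P, φ j P ∂ν - ∫ P, φ j P ∂m| :=
          mul_le_mul_of_nonneg_right (abs_le_one_of_mem_lipClass hf _) (abs_nonneg _)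
      _ = _ := one_mul _
  have h4 : |∑ j, ∫ P, φ j P ∂ν - ∑ j, ∫ P, φ j P ∂m| ≤
      ∑ j, |∫ P, φ j P ∂ν - ∫ P, φ j P ∂m| := by
    rw [← Finset.sum_sub_distrib]
    exact Finset.abs_sum_le_sum_abs _ _
  rw [abs_le] at *
  constructor <;> linarith

lemma tendsto_of_forall_inv_lt {a : ℕ → ℝ}
    (h : ∀ k : ℕ, ∀ᶠ n in atTop, |a n| < 1 / (k + 1 : ℝ)) : Tendsto a atTop (𝓝 0) := by
  rw [Metric.tendsto_nhds]
  intro ε hε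
  obtain ⟨k, hk⟩ := exists_nat_one_div_lt hε
  filter_upwards [h k] with n hn
  rw [Real.dist_eq, sub_zero]
  exact hn.trans hk

section

variable {Ω : Type*} [MeasurableSpace Ω] {Pr : Measure Ω} [IsProbabilityMeasure Pr] {g : ℝ → ℝ}
  {q : Phase → ℝ → I → ℝ} {ξ : (n : ℕ) → Fin n → I} {ω : ℕ → Ω → ℝ}
  {θ₀ : (n : ℕ) → Fin n → Ω → Phase}

lemma map_eval_eq (h : IsInitialDensity g q) (hs : IsSampled Pr g q ξ ω θ₀) (n : ℕ) (i : Fin n) :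
    Pr.map (fun z => (θ₀ n i z, ω i z)) = pairLaw g q (ξ n i) := by
  have := fun i : Fin n => h.isProbabilityMeasure_pairLaw (ξ n i)
  have hm : Measurable fun z (i : Fin n) => (θ₀ n i z, ω i z) := measurable_pi_lambda _ fun i =>
    (hs.measurable_phase n i).prodMk (hs.measurable_freq i)
  rw [← (measurePreserving_eval (fun i : Fin n => pairLaw g q (ξ n i)) i).map_eq,
    ← hs.map_pair_eq h n, Measure.map_map (measurable_pi_apply i) hm]
  rfl

lemma iIndepFun_pair (h : IsInitialDensity g q) (hs : IsSampled Pr g q ξ ω θ₀) (n : ℕ) :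
    iIndepFun (fun (i : Fin n) z => (θ₀ n i z, ω i z)) Pr := by
  rw [iIndepFun_iff_map_fun_eq_pi_map fun i =>
    ((hs.measurable_phase n i).prodMk (hs.measurable_freq i)).aemeasurable, hs.map_pair_eq h n]
  congr 1
  funext i
  exact (map_eval_eq h hs n i).symm

lemma measure_deviation_le (h : IsInitialDensity g q) (hs : IsSampled Pr g q ξ ω θ₀) {f : G → ℝ}
    (hf : Continuous f) (hf1 : ∀ P, |f P| ≤ 1) (n : ℕ) {ε : ℝ} (hε : 0 ≤ ε) :
    Pr.real {z | ε * n ≤ ∑ i : Fin n, (f (θ₀ n i z, ω i z, ξ n i) -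
      ∫ p : Phase × ℝ, f (p.1, p.2, ξ n i) ∂(pairLaw g q (ξ n i)))} ≤
      Real.exp (-(ε ^ 2 / 2)) ^ n := by
  have hfx : ∀ i : Fin n, Continuous fun p : Phase × ℝ => f (p.1, p.2, ξ n i) :=
    fun i => hf.comp (by fun_prop)
  have hpm : ∀ i : Fin n, Measurable fun z => (θ₀ n i z, ω i z) := fun i =>
    (hs.measurable_phase n i).prodMk (hs.measurable_freq i)
  have hmean : ∀ i : Fin n, ∫ p : Phase × ℝ, f (p.1, p.2, ξ n i) ∂(pairLaw g q (ξ n i)) =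
      ∫ z, f (θ₀ n i z, ω i z, ξ n i) ∂Pr := fun i => by
    rw [← map_eval_eq h hs n i, integral_map (hpm i).aemeasurable
      (hfx i).aestronglyMeasurable]
  have hind : iIndepFun (fun (i : Fin n) z => f (θ₀ n i z, ω i z, ξ n i) -
      ∫ p : Phase × ℝ, f (p.1, p.2, ξ n i) ∂(pairLaw g q (ξ n i))) Pr :=
    (iIndepFun_pair h hs n).comp (fun i p => f (p.1, p.2, ξ n i) -
      ∫ p : Phase × ℝ, f (p.1, p.2, ξ n i) ∂(pairLaw g q (ξ n i)))
      fun i => ((hfx i).sub continuous_const).measurable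
  have hsub : ∀ i ∈ (Finset.univ : Finset (Fin n)), HasSubgaussianMGF
      (fun z => f (θ₀ n i z, ω i z, ξ n i) -
        ∫ p : Phase × ℝ, f (p.1, p.2, ξ n i) ∂(pairLaw g q (ξ n i))) 1 Pr := by
    intro i _
    have hX := hasSubgaussianMGF_of_mem_Icc (μ := Pr) (a := -1) (b := 1)
      (X := fun z => f (θ₀ n i z, ω i z, ξ n i)) ((hfx i).measurable.comp (hpm i)).aemeasurable
      (Eventually.of_forall fun z => abs_le.mp (hf1 _))
    rw [hmean i]
    convert hX using 1
    ext
    norm_num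
  refine (HasSubgaussianMGF.measure_sum_ge_le_of_iIndepFun hind hsub
    (by positivity : 0 ≤ ε * n)).trans (le_of_eq ?_)
  rw [← Real.exp_nat_mul]
  congr 1
  simp only [Finset.sum_const, Finset.card_univ, Fintype.card_fin, nsmul_eq_mul, mul_one,
    NNReal.coe_natCast]
  rcases eq_or_ne n 0 with rfl | hn
  · simp
  · have : (n : ℝ) ≠ 0 := by exact_mod_cast hn
    field_simp

lemma ae_eventually_deviation_lt (h : IsInitialDensity g q) (hs : IsSampled Pr g q ξ ω θ₀)
    {f : G → ℝ} (hf : Continuous f) (hf1 : ∀ P, |f P| ≤ 1) {ε : ℝ} (hε : 0 < ε) :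
    ∀ᵐ z ∂Pr, ∀ᶠ n : ℕ in atTop, ∑ i : Fin n, (f (θ₀ n i z, ω i z, ξ n i) -
      ∫ p : Phase × ℝ, f (p.1, p.2, ξ n i) ∂(pairLaw g q (ξ n i))) < ε * n := by
  have hr : Real.exp (-(ε ^ 2 / 2)) < 1 := by
    rw [Real.exp_lt_one_iff]
    have := pow_pos hε 2
    linarith
  have hsum := (summable_geometric_of_lt_one (Real.exp_pos _).le hr).tsum_ofReal_ne_top
  have := ae_eventually_notMem (μ := Pr) (s := fun n : ℕ => {z | ε * n ≤ ∑ i : Fin n,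
    (f (θ₀ n i z, ω i z, ξ n i) -
      ∫ p : Phase × ℝ, f (p.1, p.2, ξ n i) ∂(pairLaw g q (ξ n i)))}) (ne_top_of_le_ne_top hsum
    (ENNReal.tsum_le_tsum fun n => by
      rw [← ofReal_measureReal (measure_ne_top _ _)]
      exact ENNReal.ofReal_le_ofReal (measure_deviation_le h hs hf hf1 n hε.le)))
  filter_upwards [this] with z hz
  filter_upwards [hz] with n hn
  simpa using hn

/-- The law of large numbers for one observable. -/
theorem ae_tendsto_integral_empirical (h : IsInitialDensity g q) (hs : IsSampled Pr g q ξ ω θ₀)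
    (hξ : Equidistributed ξ) {f : G → ℝ} (hf : Continuous f) (hf1 : ∀ P, |f P| ≤ 1) :
    ∀ᵐ z ∂Pr, Tendsto (fun n : ℕ => ∫ P, f P
      ∂(empiricalMeasure fun i : Fin n => (θ₀ n i z, ω i z, ξ n i))) atTop
      (𝓝 (∫ P, f P ∂(initialLaw g q))) := by
  have hpos : ∀ᵐ z ∂Pr, ∀ k : ℕ, ∀ᶠ n : ℕ in atTop, ∑ i : Fin n, (f (θ₀ n i z, ω i z, ξ n i) -
      ∫ p : Phase × ℝ, f (p.1, p.2, ξ n i) ∂(pairLaw g q (ξ n i))) < 1 / (k + 1 : ℝ) * n :=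
    ae_all_iff.mpr fun k => ae_eventually_deviation_lt h hs hf hf1 (by positivity)
  have hneg : ∀ᵐ z ∂Pr, ∀ k : ℕ, ∀ᶠ n : ℕ in atTop, ∑ i : Fin n, (-f (θ₀ n i z, ω i z, ξ n i) -
      ∫ p : Phase × ℝ, -f (p.1, p.2, ξ n i) ∂(pairLaw g q (ξ n i))) < 1 / (k + 1 : ℝ) * n :=
    ae_all_iff.mpr fun k => ae_eventually_deviation_lt h hs (f := fun P => -f P) hf.neg
      (fun P => by rw [abs_neg]; exact hf1 P) (by positivity)
  have hF : Tendsto (fun n : ℕ => (n : ℝ)⁻¹ * ∑ i : Fin n,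
      ∫ p : Phase × ℝ, f (p.1, p.2, ξ n i) ∂(pairLaw g q (ξ n i))) atTop
      (𝓝 (∫ P, f P ∂(initialLaw g q))) := by
    rw [h.integral_initialLaw hf hf1]
    exact hξ ⟨_, h.continuous_integral_pairLaw hf hf1⟩
  filter_upwards [hpos, hneg] with z hz₁ hz₂
  have hd : Tendsto (fun n : ℕ => (n : ℝ)⁻¹ * ∑ i : Fin n, (f (θ₀ n i z, ω i z, ξ n i) -
      ∫ p : Phase × ℝ, f (p.1, p.2, ξ n i) ∂(pairLaw g q (ξ n i)))) atTop (𝓝 0) := by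
    refine tendsto_of_forall_inv_lt fun k => ?_
    filter_upwards [hz₁ k, hz₂ k, eventually_gt_atTop 0] with n h₁ h₂ hn
    have hn' : (0 : ℝ) < n := by exact_mod_cast hn
    simp only [integral_neg, ← neg_sub', Finset.sum_neg_distrib] at h₂
    rw [abs_mul, abs_of_pos (inv_pos.mpr hn'), inv_mul_lt_iff₀ hn', abs_lt]
    constructor <;> linarith
  have := hd.add hF
  rw [zero_add] at this
  refine this.congr fun n => ?_
  rw [integral_empiricalMeasure, ← mul_add, Finset.sum_sub_distrib, sub_add_cancel]

/-- The initial empirical measures converge in the bounded Lipschitz distance. -/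
theorem ae_tendsto_blDist_initial (h : IsInitialDensity g q) (hs : IsSampled Pr g q ξ ω θ₀)
    (hξ : Equidistributed ξ) :
    ∀ᵐ z ∂Pr, Tendsto (fun n : ℕ => blDist
      (empiricalMeasure fun i : Fin n => (θ₀ n i z, ω i z, ξ n i)) (initialLaw g q)) atTop
      (𝓝 0) := by
  have := h.isProbabilityMeasure_initialLaw
  choose N φ hφc hφ1 hφ using fun k : ℕ =>
    exists_observables (initialLaw g q) (ε := 1 / (2 * (k + 1 : ℝ))) (by positivity)
  have hall := ae_all_iff.mpr fun k => ae_all_iff.mpr fun j =>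
    ae_tendsto_integral_empirical h hs hξ (hφc k j) (hφ1 k j)
  filter_upwards [hall] with z hz
  refine tendsto_of_forall_inv_lt fun k => ?_
  have hk : Tendsto (fun n : ℕ => 2 * ∑ j, |∫ P, φ k j P
      ∂(empiricalMeasure fun i : Fin n => (θ₀ n i z, ω i z, ξ n i)) -
      ∫ P, φ k j P ∂(initialLaw g q)|) atTop (𝓝 0) := by
    have h1 := tendsto_finsetSum (s := (Finset.univ : Finset (Fin (N k)))) (fun j _ =>
      ((hz k j).sub_const (∫ P, φ k j P ∂(initialLaw g q))).abs)
    simpa using h1.const_mul 2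
  have hlt := hk.eventually_lt_const (by positivity : 0 < 1 / (2 * (k + 1 : ℝ)))
  filter_upwards [hlt, eventually_ne_atTop 0] with n hn hn0
  rw [abs_of_nonneg (blDist_nonneg _ _)]
  refine (hφ k _ (isProbabilityMeasure_empiricalMeasure hn0 _)).trans_lt ?_
  have e : 1 / (2 * (k + 1 : ℝ)) + 1 / (2 * (k + 1 : ℝ)) = 1 / (k + 1 : ℝ) := by
    field_simp
    norm_num
  linarith

end

/-! ### The mean-field flow -/

/-- The map that shifts the phases by `y`. -/
def shiftPhase (y : G → ℝ) (P : G) : G := (P.1 + (y P : Phase), P.2)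

lemma continuous_shiftPhase {y : G → ℝ} (hy : Continuous y) : Continuous (shiftPhase y) :=
  (continuous_fst.add ((AddCircle.continuous_mk' _).comp hy)).prodMk continuous_snd

lemma continuous_uncurry_shiftPhase {y : ℝ → G → ℝ} (hy : Continuous fun q : ℝ × G => y q.1 q.2) :
    Continuous fun q : ℝ × G => shiftPhase (y q.1) q.2 :=
  ((continuous_fst.comp continuous_snd).add ((AddCircle.continuous_mk' _).comp hy)).prodMk
    (continuous_snd.comp continuous_snd)

lemma abs_integral_le_of_abs_le_exp {f : ℝ → ℝ} {l c : ℝ} (hl : 0 < l)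
    (h : ∀ s, |f s| ≤ c * Real.exp (l * |s|)) (t : ℝ) :
    |∫ s in (0 : ℝ)..t, f s| ≤ c / l * Real.exp (l * |t|) := by
  have hc : 0 ≤ c := by simpa using (abs_nonneg _).trans (h 0)
  have key : ∀ f : ℝ → ℝ, (∀ s, |f s| ≤ c * Real.exp (l * |s|)) → ∀ t, 0 ≤ t →
      |∫ s in (0 : ℝ)..t, f s| ≤ c / l * Real.exp (l * t) := by
    intro f h t ht
    have hd : ∀ s ∈ Set.uIcc 0 t, HasDerivAt (fun s => c / l * Real.exp (l * s))
        (c * Real.exp (l * s)) s := fun s _ => by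
      refine ((((hasDerivAt_id s).const_mul l).exp).const_mul (c / l)).congr_deriv ?_
      simp only [id, mul_one]
      field_simp
    have hint : IntervalIntegrable (fun s => c * Real.exp (l * s)) volume 0 t :=
      (by fun_prop : Continuous fun s => c * Real.exp (l * s)).intervalIntegrable _ _
    have h1 := intervalIntegral.norm_integral_le_of_norm_le ht (f := f)
      (g := fun s => c * Real.exp (l * s)) (μ := volume) (Eventually.of_forall fun s hs => by
        have := h s
        rwa [abs_of_pos hs.1] at this) hint
    rw [intervalIntegral.integral_eq_sub_of_hasDerivAt hd hint] at h1
    refine h1.trans ?_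
    have : 0 ≤ c / l * Real.exp (l * 0) := by positivity
    linarith
  rcases le_total 0 t with ht | ht
  · rw [abs_of_nonneg ht]; exact key f h t ht
  · have h1 := key (fun s => f (-s)) (fun s => by simpa using h (-s)) (-t) (by linarith)
    rw [intervalIntegral.integral_comp_neg, neg_neg, neg_zero, intervalIntegral.integral_symm,
      abs_neg] at h1
    rwa [abs_of_nonpos ht]

section

variable {K : ℝ} {W : I → I → ℝ} {B : ℝ} {m : Measure G}

lemma drift_map_shiftPhase (hW : KernelBound W B) {y : G → ℝ} (hy : Continuous y) (P : G) :
    drift W (m.map (shiftPhase y)) P = ∫ Q, coupling W P (shiftPhase y Q) ∂m := by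
  have h1 := continuous_shiftPhase hy
  have h2 : Continuous (coupling W P) :=
    (continuous_coupling hW).comp (by fun_prop : Continuous fun Q : G => (P, Q))
  exact integral_map h1.aemeasurable h2.aestronglyMeasurable

variable [IsProbabilityMeasure m]

lemma continuous_drift_shiftPhase (hW : KernelBound W B) {y : ℝ → G → ℝ}
    (hy : Continuous fun q : ℝ × G => y q.1 q.2) : Continuous fun q : ℝ × G =>
      drift W (m.map (shiftPhase (y q.1))) (shiftPhase (y q.1) q.2) := by
  have hyt : ∀ t, Continuous (y t) := fun t => hy.comp (by fun_prop : Continuous fun P => (t, P))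
  have hs := continuous_uncurry_shiftPhase hy
  simp_rw [fun q : ℝ × G => drift_map_shiftPhase (m := m) hW (hyt q.1)]
  have hj : ∀ Q : G, Continuous fun q : ℝ × G =>
      coupling W (shiftPhase (y q.1) q.2) (shiftPhase (y q.1) Q) := fun Q =>
    (continuous_coupling hW).comp (hs.prodMk (hs.comp (by fun_prop :
      Continuous fun q : ℝ × G => (q.1, Q))))
  refine continuous_of_dominated (bound := fun _ => B) (fun q => ?_)
    (fun q => Eventually.of_forall fun Q => abs_coupling_le hW _ _) (integrable_const B)
    (Eventually.of_forall hj)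
  exact ((continuous_coupling hW).comp (continuous_const.prodMk (hs.comp (by fun_prop :
      Continuous fun Q : G => (q.1, Q))))).aestronglyMeasurable

lemma abs_drift_shiftPhase_le (hW : KernelBound W B) {y : G → ℝ} (hy : Continuous y) (P : G) :
    |drift W (m.map (shiftPhase y)) P| ≤ B := by
  rw [drift_map_shiftPhase hW hy]
  exact abs_integral_le_of_abs_le fun _ => abs_coupling_le hW _ _

lemma abs_drift_shiftPhase_sub_le (hW : KernelBound W B) {y y' : G → ℝ} (hy : Continuous y)
    (hy' : Continuous y') {d : ℝ} (h : ∀ P, |y P - y' P| ≤ d) (P : G) :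
    |drift W (m.map (shiftPhase y)) (shiftPhase y P) -
      drift W (m.map (shiftPhase y')) (shiftPhase y' P)| ≤ 2 * B * d := by
  have hi : ∀ y : G → ℝ, Continuous y →
      Integrable (fun Q => coupling W (shiftPhase y P) (shiftPhase y Q)) m := by
    intro y hy
    have h1 := continuous_shiftPhase hy
    exact integrable_of_abs_le ((continuous_coupling hW).comp
      (continuous_const.prodMk h1)).aestronglyMeasurable fun _ => abs_coupling_le hW _ _
  rw [drift_map_shiftPhase hW hy, drift_map_shiftPhase hW hy', ← integral_sub (hi y hy) (hi y' hy')]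
  refine abs_integral_le_of_abs_le fun Q => (abs_coupling_sub_le hW _ _ _ _).trans ?_
  have hd : ∀ P, dist (shiftPhase y P).1 (shiftPhase y' P).1 ≤ d := fun P => by
    have := dist_add_coe_le P.1 P.1 (y P) (y' P)
    rw [dist_self, zero_add] at this
    exact this.trans (h P)
  simp only [shiftPhase, sub_self, abs_zero, add_zero] at *
  nlinarith [hd P, hd Q, hW.nonneg]

/-- The characteristic flow of the mean-field equation. -/
theorem exists_flow (K : ℝ) (m : Measure G) [IsProbabilityMeasure m] (hW : KernelBound W B) :
    ∃ y : ℝ → G → ℝ, Continuous (fun q : ℝ × G => y q.1 q.2) ∧ (∀ P, y 0 P = 0) ∧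
      ∀ t P, HasDerivAt (fun t => y t P)
        (vel K W (m.map (shiftPhase (y t))) (shiftPhase (y t) P)) t := by
  have hB := hW.nonneg
  set l : ℝ := 4 * |K| * B + 1 with hl
  have hl0 : 0 < l := by positivity
  let Y : BoundedContinuousFunction (ℝ × G) ℝ → ℝ → G → ℝ :=
    fun u t P => t * P.2.1 + Real.exp (l * |t|) * u (t, P)
  have hY : ∀ u, Continuous fun q : ℝ × G => Y u q.1 q.2 := fun u => by
    have := u.continuous
    simp only [Y]
    fun_prop
  have hYt : ∀ u t, Continuous (Y u t) := fun u t =>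
    (hY u).comp (by fun_prop : Continuous fun P => (t, P))
  let H : BoundedContinuousFunction (ℝ × G) ℝ → ℝ → G → ℝ :=
    fun u t P => drift W (m.map (shiftPhase (Y u t))) (shiftPhase (Y u t) P)
  have hH : ∀ u, Continuous fun q : ℝ × G => H u q.1 q.2 := fun u =>
    continuous_drift_shiftPhase hW (hY u)
  have hHt : ∀ u P, Continuous fun t => H u t P := fun u P =>
    (hH u).comp (by fun_prop : Continuous fun t : ℝ => (t, P))
  have hHB : ∀ u t P, |H u t P| ≤ B := fun u t P => abs_drift_shiftPhase_le hW (hYt u t) _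
  let γ : BoundedContinuousFunction (ℝ × G) ℝ → ℝ × G → ℝ := fun u q =>
    Real.exp (-(l * |q.1|)) * (K * ∫ s in (0 : ℝ)..q.1, H u s q.2)
  have hγc : ∀ u, Continuous (γ u) := fun u => by
    have h1 : Continuous fun q : ℝ × G => ∫ s in (0 : ℝ)..q.1, H u s q.2 :=
      intervalIntegral.continuous_parametric_intervalIntegral_of_continuous
        (f := fun (q : ℝ × G) s => H u s q.2)
        ((hH u).comp (by fun_prop : Continuous fun r : (ℝ × G) × ℝ => (r.2, r.1.2)))
        continuous_fst
    simp only [γ]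
    fun_prop
  have hγb : ∀ u q, ‖γ u q‖ ≤ |K| * (B / l) := by
    intro u q
    have h1 := abs_integral_le_of_abs_le_exp (c := B) hl0 (f := fun s => H u s q.2) (fun s => by
      refine (hHB u s q.2).trans ?_
      have : 1 ≤ Real.exp (l * |s|) := Real.one_le_exp (by positivity)
      nlinarith) q.1
    simp only [γ]
    rw [Real.norm_eq_abs, abs_mul, abs_mul, abs_of_pos (Real.exp_pos _)]
    calc _ ≤ Real.exp (-(l * |q.1|)) * (|K| * (B / l * Real.exp (l * |q.1|))) := by gcongr
      _ = |K| * (B / l) * (Real.exp (-(l * |q.1|)) * Real.exp (l * |q.1|)) := by ring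
      _ = |K| * (B / l) := by rw [← Real.exp_add]; simp
  let Γ : BoundedContinuousFunction (ℝ × G) ℝ → BoundedContinuousFunction (ℝ × G) ℝ := fun u =>
    BoundedContinuousFunction.ofNormedAddCommGroup (γ u) (hγc u) _ (hγb u)
  have hΓ : ContractingWith (1 / 2) Γ := by
    refine ⟨by rw [← NNReal.coe_lt_coe]; norm_num, LipschitzWith.of_dist_le_mul fun u v => ?_⟩
    have hd : 0 ≤ dist u v := dist_nonneg
    refine (BoundedContinuousFunction.dist_le (by positivity)).mpr fun q => ?_
    have h0 : ∀ s, |H u s q.2 - H v s q.2| ≤ 2 * B * dist u v * Real.exp (l * |s|) := by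
      intro s
      have := abs_drift_shiftPhase_sub_le (m := m) hW (hYt u s) (hYt v s)
        (d := Real.exp (l * |s|) * dist u v) (fun P => by
          simp only [Y]
          rw [add_sub_add_left_eq_sub, ← mul_sub, abs_mul, abs_of_pos (Real.exp_pos _)]
          gcongr
          exact BoundedContinuousFunction.dist_coe_le_dist (f := u) (g := v) (s, P)) q.2
      exact this.trans (le_of_eq (by ring))
    have h1 := abs_integral_le_of_abs_le_exp hl0 h0 q.1
    rw [intervalIntegral.integral_sub ((hHt u q.2).intervalIntegrable _ _)
      ((hHt v q.2).intervalIntegrable _ _)] at h1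
    change |γ u q - γ v q| ≤ _
    simp only [γ]
    rw [← mul_sub, ← mul_sub, abs_mul, abs_mul, abs_of_pos (Real.exp_pos _)]
    calc _ ≤ Real.exp (-(l * |q.1|)) *
          (|K| * (2 * B * dist u v / l * Real.exp (l * |q.1|))) := by gcongr
      _ = 2 * |K| * B / l * dist u v * (Real.exp (-(l * |q.1|)) * Real.exp (l * |q.1|)) := by ring
      _ = 2 * |K| * B / l * dist u v := by rw [← Real.exp_add]; simp
      _ ≤ 1 / 2 * dist u v := by
          refine mul_le_mul_of_nonneg_right ?_ hd
          rw [div_le_div_iff₀ hl0 two_pos]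
          linarith
      _ = _ := by norm_num
  have : Nonempty (BoundedContinuousFunction (ℝ × G) ℝ) := ⟨0⟩
  set u := ContractingWith.fixedPoint Γ hΓ with hu
  have hfix : ∀ q, γ u q = u q := fun q =>
    congrArg (fun w : BoundedContinuousFunction (ℝ × G) ℝ => w q) hΓ.fixedPoint_isFixedPt
  have hYu : ∀ t P, Y u t P = t * P.2.1 + K * ∫ s in (0 : ℝ)..t, H u s P := by
    intro t P
    simp only [Y]
    rw [← hfix (t, P)]
    simp only [γ]
    rw [← mul_assoc, ← Real.exp_add]
    simp
  refine ⟨Y u, hY u, fun P => by simp [hYu], fun t P => ?_⟩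
  simp_rw [hYu _ P]
  have h1 : HasDerivAt (fun t => ∫ s in (0 : ℝ)..t, H u s P) (H u t P) t :=
    intervalIntegral.integral_hasDerivAt_right ((hHt u P).intervalIntegrable _ _)
      ((hHt u P).stronglyMeasurableAtFilter _ _) (hHt u P).continuousAt
  have h2 := ((hasDerivAt_id t).mul_const P.2.1).add (h1.const_mul K)
  rw [one_mul] at h2
  exact h2

end

/-! ### Existence of weak solutions -/

lemma volume_preimage_coe_eq_zero {A : Set Phase} (hA : volume A = 0) :
    volume ((fun r : ℝ => (r : Phase)) ⁻¹' A) = 0 := by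
  have h : ∀ a : ℝ, volume ((fun r : ℝ => (r : Phase)) ⁻¹' A ∩ Set.Ioc a (a + 2 * π)) = 0 := by
    intro a
    have h1 := (AddCircle.measurePreserving_mk (2 * π) a).quasiMeasurePreserving.preimage_null hA
    rwa [Measure.restrict_apply' measurableSet_Ioc] at h1
  have hU : (fun r : ℝ => (r : Phase)) ⁻¹' A =
      ⋃ n : ℤ, (fun r : ℝ => (r : Phase)) ⁻¹' A ∩ Set.Ioc (0 + n • (2 * π)) (0 + (n + 1) • (2 * π))
      := by
    rw [← Set.inter_iUnion, iUnion_Ioc_add_zsmul Real.two_pi_pos 0, Set.inter_univ]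
  rw [hU, measure_iUnion_null_iff]
  intro n
  have := h (0 + n • (2 * π))
  rwa [add_assoc, ← add_one_zsmul] at this

lemma volume_eq_zero_of_preimage_coe {A : Set Phase} (hA : MeasurableSet A)
    (h : volume ((fun r : ℝ => (r : Phase)) ⁻¹' A) = 0) : volume A = 0 := by
  rw [← (AddCircle.measurePreserving_mk (2 * π) 0).measure_preimage hA.nullMeasurableSet]
  exact measure_mono_null (Set.Subset.refl _) (Measure.restrict_le_self.absolutelyContinuous h)

lemma volume_preimage_eq_zero_of_antilipschitz {f : ℝ → ℝ} {c : NNReal}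
    (hf : AntilipschitzWith c f) {A : Set ℝ} (hA : volume A = 0) : volume (f ⁻¹' A) = 0 := by
  rw [← hausdorffMeasure_real] at *
  have := hf.hausdorffMeasure_preimage_le zero_le_one A
  rw [hA, mul_zero] at this
  exact le_antisymm this zero_le

section

variable {K : ℝ} {W : I → I → ℝ} {B : ℝ} {m : Measure G} [IsProbabilityMeasure m]
  {y : ℝ → G → ℝ}

lemma isProbabilityMeasure_map_shiftPhase {y : G → ℝ} (hy : Continuous y) :
    IsProbabilityMeasure (m.map (shiftPhase y)) :=
  Measure.isProbabilityMeasure_map (continuous_shiftPhase hy).aemeasurable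

lemma continuous_time_slice (hyc : Continuous fun q : ℝ × G => y q.1 q.2) (t : ℝ) :
    Continuous (y t) :=
  hyc.comp (by fun_prop : Continuous fun P : G => (t, P))

/-- The flow is bi-Lipschitz in the phase. -/
lemma antilipschitz_flow (hW : KernelBound W B) (hyc : Continuous fun q : ℝ × G => y q.1 q.2)
    (hy0 : ∀ P, y 0 P = 0) (hy : ∀ t P, HasDerivAt (fun t => y t P)
      (vel K W (m.map (shiftPhase (y t))) (shiftPhase (y t) P)) t) {t : ℝ} (ht : 0 ≤ t)
    (p : ℝ × I) : ∃ c, AntilipschitzWith c fun r : ℝ => r + y t ((r : Phase), p) := by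
  set L : NNReal := ⟨|K| * B, mul_nonneg (abs_nonneg K) hW.nonneg⟩ with hL
  have hlip : ∀ s, LipschitzWith L fun r : ℝ =>
      -vel K W (m.map (shiftPhase (y (t - s)))) ((r : Phase), p) := by
    intro s
    have := isProbabilityMeasure_map_shiftPhase (m := m) (continuous_time_slice hyc (t - s))
    refine LipschitzWith.of_dist_le_mul fun r r' => ?_
    have h1 := abs_drift_sub_le (m.map (shiftPhase (y (t - s)))) hW ((r : Phase), p)
      ((r' : Phase), p)
    have h2 : dist (r : Phase) (r' : Phase) ≤ |r - r'| := by
      rw [dist_eq_norm, ← AddCircle.coe_sub]; exact norm_coe_phase_le _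
    simp only [sub_self, abs_zero, add_zero] at h1
    rw [dist_neg_neg, Real.dist_eq, Real.dist_eq]
    have h3 : ∀ a b c : ℝ, a + K * b - (a + K * c) = K * (b - c) := fun a b c => by ring
    rw [vel, vel, h3, abs_mul]
    change _ ≤ |K| * B * _
    rw [mul_assoc]
    exact mul_le_mul_of_nonneg_left (h1.trans (mul_le_mul_of_nonneg_left h2 hW.nonneg))
      (abs_nonneg K)
  have hd : ∀ r s : ℝ, HasDerivAt (fun s => r + y (t - s) ((r : Phase), p))
      (-vel K W (m.map (shiftPhase (y (t - s))))
        (((r + y (t - s) ((r : Phase), p) : ℝ) : Phase), p)) s := by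
    intro r s
    have h1 := (hy (t - s) ((r : Phase), p)).comp s ((hasDerivAt_id s).const_sub t)
    refine (h1.const_add r).congr_deriv ?_
    rw [mul_neg_one]
    rfl
  refine ⟨Real.toNNReal (Real.exp (L * t)), AntilipschitzWith.of_le_mul_dist fun r r' => ?_⟩
  have hG := dist_le_of_trajectories_ODE (a := 0) (b := t) hlip
    (fun s _ => (hd r s).continuousAt.continuousWithinAt) (fun s _ => (hd r s).hasDerivWithinAt)
    (fun s _ => (hd r' s).continuousAt.continuousWithinAt) (fun s _ => (hd r' s).hasDerivWithinAt)
    le_rfl t ⟨ht, le_rfl⟩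
  simp only [sub_self, sub_zero, hy0, add_zero] at hG
  rw [Real.coe_toNNReal _ (Real.exp_pos _).le, mul_comm]
  exact hG

lemma absolutelyContinuous_flow (hW : KernelBound W B)
    (hyc : Continuous fun q : ℝ × G => y q.1 q.2) (hm : m ≪ volume)
    (hy0 : ∀ P, y 0 P = 0) (hy : ∀ t P, HasDerivAt (fun t => y t P)
      (vel K W (m.map (shiftPhase (y t))) (shiftPhase (y t) P)) t) {t : ℝ} (ht : 0 ≤ t) :
    m.map (shiftPhase (y t)) ≪ volume := by
  have hsm : Measurable (shiftPhase (y t)) :=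
    (continuous_shiftPhase (continuous_time_slice hyc t)).measurable
  refine Measure.AbsolutelyContinuous.mk fun A hA hA0 => ?_
  rw [Measure.map_apply hsm hA]
  refine hm ?_
  rw [Measure.volume_eq_prod, Measure.prod_apply_symm hA,
    lintegral_eq_zero_iff (measurable_measure_prodMk_right hA)] at hA0
  rw [Measure.volume_eq_prod, Measure.prod_apply_symm (hsm hA),
    lintegral_eq_zero_iff (measurable_measure_prodMk_right (hsm hA))]
  filter_upwards [hA0] with p hp
  obtain ⟨c, hc⟩ := antilipschitz_flow hW hyc hy0 hy ht p
  refine volume_eq_zero_of_preimage_coe (measurable_prodMk_right (hsm hA)) ?_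
  have h1 := volume_preimage_eq_zero_of_antilipschitz hc (volume_preimage_coe_eq_zero hp)
  exact h1

/-- The push-forward of the initial measure under the flow is a weak solution. -/
lemma isMeasureSolution_flow (hW : KernelBound W B) (hyc : Continuous fun q : ℝ × G => y q.1 q.2)
    (hy0 : ∀ P, y 0 P = 0) (hy : ∀ t P, HasDerivAt (fun t => y t P)
      (vel K W (m.map (shiftPhase (y t))) (shiftPhase (y t) P)) t) (T : ℝ) :
    IsMeasureSolution K W T m fun t => m.map (shiftPhase (y t)) where
  prob t _ := isProbabilityMeasure_map_shiftPhase (continuous_time_slice hyc t)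
  cont f := by
    have h : ∀ t, ∫ P, f P ∂(m.map (shiftPhase (y t))) = ∫ P, f (shiftPhase (y t) P) ∂m := fun t =>
      integral_map (continuous_shiftPhase (continuous_time_slice hyc t)).aemeasurable
        f.continuous.aestronglyMeasurable
    simp_rw [h]
    refine Continuous.continuousOn (continuous_of_dominated (bound := fun _ => ‖f‖) (fun t => ?_)
      (fun t => Eventually.of_forall fun P => f.norm_coe_le_norm _) (integrable_const _)
      (Eventually.of_forall fun P => ?_))
    · exact (f.continuous.comp
        (continuous_shiftPhase (continuous_time_slice hyc t))).aestronglyMeasurable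
    · exact f.continuous.comp ((continuous_uncurry_shiftPhase hyc).comp
        (by fun_prop : Continuous fun t : ℝ => (t, P)))
  weak ψ hψ τ hτ := by
    obtain ⟨R, hR⟩ := hψ.support
    have hs := continuous_uncurry_shiftPhase hyc
    have hst : ∀ t, Continuous (shiftPhase (y t)) := fun t =>
      continuous_shiftPhase (continuous_time_slice hyc t)
    have hψt : ∀ t, Continuous fun P : G => ψ t P.1 P.2.1 P.2.2 := fun t =>
      hψ.continuous.comp (f := fun P : G => (t, P)) (by fun_prop)
    let D : ℝ → G → ℝ := fun t P => deriv (fun s => ψ s P.1 P.2.1 P.2.2) t +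
      vel K W (m.map (shiftPhase (y t))) P * derivPhase (fun θ => ψ t θ P.2.1 P.2.2) P.1
    have hvel : Continuous fun q : ℝ × G =>
        vel K W (m.map (shiftPhase (y q.1))) (shiftPhase (y q.1) q.2) :=
      (by fun_prop : Continuous fun q : ℝ × G => q.2.2.1).add
        (continuous_const.mul (continuous_drift_shiftPhase hW hyc))
    have hgr : Continuous fun q : ℝ × G => (q.1, shiftPhase (y q.1) q.2) := continuous_fst.prodMk hs
    have hDc : Continuous fun q : ℝ × G => D q.1 (shiftPhase (y q.1) q.2) :=
      (hψ.continuous_deriv_time.comp hgr).add (hvel.mul (hψ.continuous_derivPhase.comp hgr))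
    have hD0 : ∀ t P, R < |P.2.1| → D t P = 0 := fun t P hP => by
      simp only [D]
      rw [IsTestFunction.deriv_time_eq_zero hR _ _ hP, IsTestFunction.derivPhase_eq_zero hR _ _ hP]
      simp
    obtain ⟨c, hc⟩ := exists_uniform_bound (T := τ) (R := R)
      (H := fun t P => D t (shiftPhase (y t) P)) hDc.continuousOn fun t P hP => hD0 _ _ hP
    have hftc : ∀ P, ψ τ (shiftPhase (y τ) P).1 P.2.1 P.2.2 - ψ 0 P.1 P.2.1 P.2.2 =
        ∫ t in (0 : ℝ)..τ, D t (shiftPhase (y t) P) := by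
      rintro ⟨a, s, x⟩
      induction a using QuotientAddGroup.induction_on with
      | H r =>
        have hd : ∀ t ∈ Set.uIcc 0 τ, HasDerivAt
            (fun t => ψ t ((r + y t ((r : Phase), s, x) : ℝ) : Phase) s x)
            (D t (shiftPhase (y t) ((r : Phase), s, x))) t := fun t _ =>
          hψ.hasDerivAt_comp ((hy t ((r : Phase), s, x)).const_add r) s x
        have hi : IntervalIntegrable (fun t => D t (shiftPhase (y t) ((r : Phase), s, x))) volume
            0 τ := (hDc.comp (by fun_prop : Continuous fun t : ℝ =>
              (t, (((r : Phase), s, x) : G)))).intervalIntegrable _ _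
        have := intervalIntegral.integral_eq_sub_of_hasDerivAt hd hi
        rw [hy0, add_zero] at this
        exact this.symm
    have hDt : ∀ t ∈ Set.Icc 0 τ, Continuous (D t) := by
      intro t ht
      have := isProbabilityMeasure_map_shiftPhase (m := m) (continuous_time_slice hyc t)
      have hg : Continuous fun P : G => (t, P) := by fun_prop
      exact (hψ.continuous_deriv_time.comp hg).add
        ((continuous_vel _ hW).mul (hψ.continuous_derivPhase.comp hg))
    have hmap : ∀ t ∈ Set.Icc 0 τ, ∫ P, D t P ∂(m.map (shiftPhase (y t))) =
        ∫ P, D t (shiftPhase (y t) P) ∂m := fun t ht =>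
      integral_map (hst t).aemeasurable (hDt t ht).aestronglyMeasurable
    have hintD : Integrable (Function.uncurry fun t P => D t (shiftPhase (y t) P))
        ((volume.restrict (Set.Ioc 0 τ)).prod m) := by
      refine Integrable.of_bound hDc.aestronglyMeasurable c ?_
      have h1 : ∀ᵐ t ∂(volume.restrict (Set.Ioc 0 τ)), t ∈ Set.Ioc 0 τ :=
        ae_restrict_mem measurableSet_Ioc
      filter_upwards [Measure.quasiMeasurePreserving_fst.ae h1] with q hq
      exact hc q.1 ⟨hq.1.le, hq.2⟩ q.2
    have hψint : ∀ t ∈ Set.Icc 0 τ, Integrable (fun P : G =>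
        ψ t (shiftPhase (y t) P).1 P.2.1 P.2.2) m := by
      intro t ht
      obtain ⟨c', hc'⟩ := exists_uniform_bound (T := τ) (R := R)
        (H := fun t P => ψ t P.1 P.2.1 P.2.2) hψ.continuous.continuousOn
        fun t P hP => hR _ _ _ _ hP
      exact integrable_of_abs_le ((hψt t).comp (hst t)).aestronglyMeasurable
        fun P => hc' t ht (shiftPhase (y t) P)
    have h0 : (0 : ℝ) ∈ Set.Icc 0 τ := ⟨le_rfl, hτ.1⟩
    have hτ' : τ ∈ Set.Icc 0 τ := ⟨hτ.1, le_rfl⟩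
    have hψ0 : Integrable (fun P : G => ψ 0 P.1 P.2.1 P.2.2) m := by
      simpa [shiftPhase, hy0] using hψint 0 h0
    have hright : ∫ t in (0 : ℝ)..τ, ∫ P, D t P ∂(m.map (shiftPhase (y t))) =
        ∫ P, (∫ t in (0 : ℝ)..τ, D t (shiftPhase (y t) P)) ∂m := by
      rw [intervalIntegral.integral_congr (g := fun t => ∫ P, D t (shiftPhase (y t) P) ∂m)
        fun t ht => hmap t (by rwa [Set.uIcc_of_le hτ.1] at ht)]
      simp_rw [intervalIntegral.integral_of_le hτ.1]
      exact integral_integral_swap hintD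
    have hleft : ∫ P : G, ψ τ P.1 P.2.1 P.2.2 ∂(m.map (shiftPhase (y τ))) =
        ∫ P : G, ψ τ (shiftPhase (y τ) P).1 P.2.1 P.2.2 ∂m :=
      integral_map (hst τ).aemeasurable (hψt τ).aestronglyMeasurable
    change _ = _ + ∫ t in (0 : ℝ)..τ, ∫ P, D t P ∂(m.map (shiftPhase (y t)))
    rw [hright, hleft, ← sub_eq_iff_eq_add', ← integral_sub (hψint τ hτ') hψ0]
    exact integral_congr_ae (Eventually.of_forall hftc)

end

lemma densityMeasure_rnDeriv {μ : Measure G} [IsProbabilityMeasure μ] (h : μ ≪ volume) :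
    densityMeasure (fun P => (μ.rnDeriv volume P).toReal) = μ := by
  rw [densityMeasure]
  conv_rhs => rw [← Measure.withDensity_rnDeriv_eq μ volume h]
  refine withDensity_congr_ae ?_
  filter_upwards [μ.rnDeriv_lt_top volume] with P hP
  exact ENNReal.ofReal_toReal hP.ne

/-- A measure-valued weak solution that is absolutely continuous has a density that is a weak
solution. -/
theorem IsMeasureSolution.exists_isWeakSolution {K : ℝ} {W : I → I → ℝ} {T : ℝ} {ρ₀ : G → ℝ}
    {μ : ℝ → Measure G} (hρ₀ : Measurable ρ₀) (hρ₀' : ∀ P, 0 ≤ ρ₀ P)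
    (h : IsMeasureSolution K W T (densityMeasure ρ₀) μ) (hac : ∀ t ∈ Set.Icc 0 T, μ t ≪ volume) :
    ∃ ρ : ℝ → G → ℝ, IsWeakSolution K W T ρ₀ ρ := by
  let ρ : ℝ → G → ℝ := fun t P => ((μ t).rnDeriv volume P).toReal
  have hm : ∀ t, Measurable (ρ t) := fun t => (Measure.measurable_rnDeriv _ _).ennreal_toReal
  have h0 : ∀ t P, 0 ≤ ρ t P := fun t P => ENNReal.toReal_nonneg
  have hd : ∀ t ∈ Set.Icc 0 T, densityMeasure (ρ t) = μ t := fun t ht => by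
    have := h.prob t ht
    exact densityMeasure_rnDeriv (hac t ht)
  have hint : ∀ t ∈ Set.Icc 0 T, ∀ f : G → ℝ, ∫ P, f P * ρ t P = ∫ P, f P ∂(μ t) :=
    fun t ht f => by rw [← integral_densityMeasure (hm t) (h0 t), hd t ht]
  refine ⟨ρ, fun t _ => hm t, fun t _ => h0 t, fun t ht => ?_, fun t ht => ?_, fun f => ?_,
    fun ψ hψ τ hτ => ?_⟩
  · have := h.prob t ht
    exact Measure.integrable_toReal_rnDeriv
  · have := h.prob t ht
    simpa using hint t ht fun _ => 1
  · exact (h.cont f).congr fun t ht => hint t ht _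
  · rw [hint τ hτ (fun P => ψ τ P.1 P.2.1 P.2.2), h.weak ψ hψ τ hτ,
      integral_densityMeasure hρ₀ hρ₀']
    congr 1
    refine intervalIntegral.integral_congr fun t ht => ?_
    rw [Set.uIcc_of_le hτ.1] at ht
    have ht' : t ∈ Set.Icc 0 T := ⟨ht.1, ht.2.trans hτ.2⟩
    simp_rw [velocity_eq_vel (hm t) (h0 t), hd t ht']
    exact (hint t ht' _).symm

/-! ### The mean-field limit -/

/-- A cutoff of the frequencies at `R + 2`. -/
def freqCutoff (R : ℕ) : ContDiffBump (0 : ℝ) := ⟨R + 1, R + 2, by positivity, by linarith⟩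

lemma isCutoff_freqCutoff (R : ℕ) : IsCutoff (freqCutoff R) where
  contDiff := (freqCutoff R).contDiff
  nonneg _ := (freqCutoff R).nonneg
  le_one _ := (freqCutoff R).le_one
  support := ⟨R + 2, by positivity, fun s hs => (freqCutoff R).zero_of_le_dist (by
    rw [Real.dist_eq, sub_zero]; exact hs.le)⟩

lemma tendsto_integral_freqCutoff (m : Measure G) [IsProbabilityMeasure m] :
    Tendsto (fun R : ℕ => ∫ P, freqCutoff R P.2.1 ∂m) atTop (𝓝 1) := by
  have h1 : ∫ _ : G, (1 : ℝ) ∂m = 1 := by simp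
  rw [← h1]
  refine tendsto_integral_of_dominated_convergence (fun _ => 1)
    (fun R => (isCutoff_freqCutoff R).continuous_freq.aestronglyMeasurable) (integrable_const _)
    (fun R => Eventually.of_forall fun P => ?_) (Eventually.of_forall fun P => ?_)
  · rw [Real.norm_of_nonneg (freqCutoff R).nonneg]
    exact (freqCutoff R).le_one
  · refine tendsto_const_nhds.congr' ?_
    obtain ⟨N, hN⟩ := exists_nat_ge |P.2.1|
    filter_upwards [eventually_ge_atTop N] with R hR
    refine ((freqCutoff R).one_of_mem_closedBall ?_).symm
    have h2 : (N : ℝ) ≤ R := by exact_mod_cast hR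
    have h3 : (freqCutoff R).rIn = R + 1 := rfl
    rw [Metric.mem_closedBall, Real.dist_eq, sub_zero, h3]
    linarith

lemma blDist_comm (μ ν : Measure G) : blDist μ ν = blDist ν μ := by
  unfold blDist
  simp_rw [abs_sub_comm]

/-- Quantitative stability of the mean-field equation with respect to the particle system. -/
lemma blDist_empirical_le {K : ℝ} {W : I → I → ℝ} {B T : ℝ} (hW : KernelBound W B)
    {m : Measure G} [IsProbabilityMeasure m] {μ : ℝ → Measure G}
    (hμ : IsMeasureSolution K W T m μ) {χ : ℝ → ℝ} (hχ : IsCutoff χ) {n : ℕ} (hn : n ≠ 0)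
    {ξ : Fin n → I} {w : Fin n → ℝ} {θ₀ : Fin n → Phase} {θ : Fin n → ℝ → Phase}
    (hθ : IsKuramotoSolution K W T ξ w θ₀ θ) {t : ℝ} (ht : t ∈ Set.Icc 0 T) :
    blDist (empiricalMeasure fun i => (θ i t, w i, ξ i)) (μ t) ≤
      Real.exp (2 * (1 + 2 * |K| * B) * T) *
        (blDist (empiricalMeasure fun i => (θ₀ i, w i, ξ i)) m +
          (1 + T * (2 * (1 + 2 * |K| * B))) * ((1 - ∫ P, χ P.2.1 ∂m) +
            (1 - ∫ P, χ P.2.1 ∂(empiricalMeasure fun i => (θ₀ i, w i, ξ i))))) +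
      ((1 - ∫ P, χ P.2.1 ∂m) +
        (1 - ∫ P, χ P.2.1 ∂(empiricalMeasure fun i => (θ₀ i, w i, ξ i)))) := by
  have hB := hW.nonneg
  have hT : 0 ≤ T := ht.1.trans ht.2
  have h0 : (0 : ℝ) ∈ Set.Icc 0 T := ⟨le_rfl, hT⟩
  set ν : ℝ → Measure G := fun t => empiricalMeasure fun i => (θ i t, w i, ξ i) with hν
  have hν0 : (empiricalMeasure fun i => (θ₀ i, w i, ξ i)) = ν 0 := by
    simp only [hν, hθ.1]
  rw [hν0]
  have hνp : ∀ t, IsProbabilityMeasure (ν t) := fun t =>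
    isProbabilityMeasure_empiricalMeasure hn _
  have htail : ∀ (η : Measure G) [IsProbabilityMeasure η], 0 ≤ 1 - ∫ P, χ P.2.1 ∂η := fun η _ => by
    have := abs_integral_le_of_abs_le (μ := η) (F := fun P => χ P.2.1) (c := 1) fun P => by
      rw [abs_of_nonneg (hχ.nonneg _)]; exact hχ.le_one _
    linarith [(abs_le.mp this).2]
  have hνt : ∀ t, ∫ P, χ P.2.1 ∂(ν t) = ∫ P, χ P.2.1 ∂(ν 0) := fun t => by
    simp only [hν, integral_empiricalMeasure]
  set κ := (1 - ∫ P, χ P.2.1 ∂m) + (1 - ∫ P, χ P.2.1 ∂(ν 0)) with hκ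
  have hm0 := htail m
  have hn0 := htail (ν 0)
  have := hμ.prob t ht
  have := hμ.prob 0 h0
  have key := cutDist_le_of_eulerConsistent (κ := κ) hW hχ hμ.prob (fun t _ => hνp t)
    (hμ.eulerConsistent hW hχ) (hθ.eulerConsistent hχ hn)
    (fun t ht => by rw [hμ.integral_cutoff_eq hχ ht]; linarith)
    (fun t _ => by rw [hνt t]; linarith) ht
  have e1 : cutDist χ (μ 0) (ν 0) = cutDist χ m (ν 0) := by
    unfold cutDist
    congr 1
    funext f
    rw [hμ.integral_initial_eq hT hχ f.2]
  have e2 := cutDist_le_blDist_add hχ m (ν 0)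
  have e3 := blDist_le_cutDist_add hχ (μ t) (ν t)
  rw [hμ.integral_cutoff_eq hχ ht, hνt t] at e3
  rw [blDist_comm (ν t), blDist_comm (ν 0)]
  refine e3.trans (add_le_add_left (key.trans ?_) _)
  have hC : 0 ≤ 2 * (1 + 2 * |K| * B) := by positivity
  have hκ0 : 0 ≤ κ := add_nonneg hm0 hn0
  refine mul_le_mul (Real.exp_le_exp.mpr (mul_le_mul_of_nonneg_left ht.2 hC)) ?_ ?_
    (Real.exp_pos _).le
  · rw [e1]
    have := mul_le_mul_of_nonneg_right ht.2 (mul_nonneg hC hκ0)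
    linarith
  · exact add_nonneg (cutDist_nonneg _ _) (mul_nonneg ht.1 (mul_nonneg hC hκ0))

lemma tendsto_iSup_blDist {K : ℝ} {W : I → I → ℝ} {B T : ℝ} (hT : 0 ≤ T) (hW : KernelBound W B)
    {m : Measure G} [IsProbabilityMeasure m] {μ : ℝ → Measure G}
    (hμ : IsMeasureSolution K W T m μ) {ξ : (n : ℕ) → Fin n → I} {w : ℕ → ℝ}
    {θ₀ : (n : ℕ) → Fin n → Phase} {θ : (n : ℕ) → Fin n → ℝ → Phase}
    (hθ : ∀ n, IsKuramotoSolution K W T (ξ n) (fun i => w i) (θ₀ n) (θ n))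
    (hd : Tendsto (fun n : ℕ => blDist (empiricalMeasure fun i : Fin n => (θ₀ n i, w i, ξ n i)) m)
      atTop (𝓝 0))
    (hχ : ∀ R : ℕ, Tendsto (fun n : ℕ => ∫ P, freqCutoff R P.2.1
      ∂(empiricalMeasure fun i : Fin n => (θ₀ n i, w i, ξ n i))) atTop
      (𝓝 (∫ P, freqCutoff R P.2.1 ∂m))) :
    Tendsto (fun n : ℕ => ⨆ t : Set.Icc (0 : ℝ) T,
      blDist (empiricalMeasure fun i : Fin n => (θ n i t, w i, ξ n i)) (μ t)) atTop (𝓝 0) := by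
  have : Nonempty (Set.Icc (0 : ℝ) T) := ⟨⟨0, le_rfl, hT⟩⟩
  set E := Real.exp (2 * (1 + 2 * |K| * B) * T)
  set C := 1 + T * (2 * (1 + 2 * |K| * B))
  have hlim : Tendsto (fun R : ℕ => E * (0 + C * ((1 - ∫ P, freqCutoff R P.2.1 ∂m) +
      (1 - ∫ P, freqCutoff R P.2.1 ∂m))) + ((1 - ∫ P, freqCutoff R P.2.1 ∂m) +
      (1 - ∫ P, freqCutoff R P.2.1 ∂m))) atTop (𝓝 0) := by
    have h1 := (tendsto_integral_freqCutoff m).const_sub 1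
    have h2 := h1.add h1
    have h3 := (((h2.const_mul C).const_add 0).const_mul E).add h2
    simpa using h3
  rw [Metric.tendsto_nhds]
  intro ε hε
  obtain ⟨R, hR⟩ := (hlim.eventually_lt_const hε).exists
  have h4 := (hχ R).const_sub 1
  have h5 := h4.const_add (1 - ∫ P, freqCutoff R P.2.1 ∂m)
  have h6 := ((hd.add (h5.const_mul C)).const_mul E).add h5
  filter_upwards [h6.eventually_lt_const hR, eventually_ne_atTop 0] with n hn hn0
  rw [Real.dist_eq, sub_zero, abs_of_nonneg (Real.iSup_nonneg fun _ => blDist_nonneg _ _)]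
  refine lt_of_le_of_lt (ciSup_le fun t => ?_) hn
  exact blDist_empirical_le hW hμ (isCutoff_freqCutoff R) hn0 (hθ n) t.2

end

end KuramotoMF

open KuramotoMF in
theorem corollary2p2
    (K : ℝ) (W : I → I → ℝ) (LW : ℝ)
    (hWsymm : ∀ x y, W x y = W y x)
    (hWlip : ∀ x₁ y₁ x₂ y₂ : I, |W x₁ y₁ - W x₂ y₂| ≤
      LW * √(((x₁ : ℝ) - (x₂ : ℝ)) ^ 2 + ((y₁ : ℝ) - (y₂ : ℝ)) ^ 2))
    (ξ : (n : ℕ) → Fin n → I) (hξ : Equidistributed ξ)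
    (g : ℝ → ℝ) (hg : Continuous g) (hg0 : ∀ s, 0 ≤ g s)
    (q : Phase → ℝ → I → ℝ)
    (hq : Continuous (fun P : G => q P.1 P.2.1 P.2.2))
    (hq0 : ∀ φ s x, 0 ≤ q φ s x)
    (hqunif : ∀ ε > 0, ∃ δ > 0, ∀ x₁ x₂ : I, |(x₁ : ℝ) - (x₂ : ℝ)| < δ →
      ∀ φ s, |q φ s x₁ - q φ s x₂| < ε)
    (hq1 : ∀ s x, ∫ φ, q φ s x = 1)
    {Ω : Type*} [MeasurableSpace Ω] (Pr : Measure Ω) [IsProbabilityMeasure Pr]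
    (ω : ℕ → Ω → ℝ) (θ₀ : (n : ℕ) → Fin n → Ω → Phase)
    (hsample : IsSampled Pr g q ξ ω θ₀)
    (T : ℝ) (hT : 0 < T)
    (θ : (n : ℕ) → Ω → Fin n → ℝ → Phase)
    (hθ : ∀ n z, IsKuramotoSolution K W T (ξ n) (fun i => ω i z) (fun i => θ₀ n i z) (θ n z)) :
    (∃ ρ : ℝ → G → ℝ,
      IsWeakSolution K W T (fun P => q P.1 P.2.1 P.2.2 * g P.2.1) ρ) ∧
    ∀ ρ : ℝ → G → ℝ,
      IsWeakSolution K W T (fun P => q P.1 P.2.1 P.2.2 * g P.2.1) ρ →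
      ∀ᵐ z ∂Pr, Tendsto
        (fun n : ℕ => ⨆ t : Set.Icc (0 : ℝ) T,
          blDist (empiricalMeasure (fun i : Fin n => (θ n z i t, ω i z, ξ n i)))
            (densityMeasure (ρ t)))
        atTop (𝓝 0) := by
  obtain ⟨B, hW⟩ := exists_kernelBound W LW hWlip
  have hprob : IsProbabilityMeasure
      ((volume : Measure ℝ).withDensity fun s => ENNReal.ofReal (g s)) := by
    rw [← hsample.law_freq 0]
    exact Measure.isProbabilityMeasure_map (hsample.measurable_freq 0).aemeasurable
  have h : IsInitialDensity g q := ⟨hg, hg0, hq, hq0, hqunif, hq1, hprob⟩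
  have hm : IsProbabilityMeasure (initialLaw g q) := h.isProbabilityMeasure_initialLaw
  have hρm : Measurable fun P : G => q P.1 P.2.1 P.2.2 * g P.2.1 := h.continuous_density.measurable
  refine ⟨?_, fun ρ hρ => ?_⟩
  · obtain ⟨y, hyc, hy0, hy⟩ := exists_flow K (initialLaw g q) hW
    exact (isMeasureSolution_flow hW hyc hy0 hy T).exists_isWeakSolution hρm h.density_nonneg
      fun t ht => absolutelyContinuous_flow (m := initialLaw g q) hW hyc
        (withDensity_absolutelyContinuous volume _) hy0 hy ht.1
  · have hμ : IsMeasureSolution K W T (initialLaw g q) fun t => densityMeasure (ρ t) :=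
      hρ.isMeasureSolution hρm h.density_nonneg
    have hcut := ae_all_iff.mpr fun R : ℕ => ae_tendsto_integral_empirical h hsample hξ
      (isCutoff_freqCutoff R).continuous_freq fun P => by
        rw [abs_of_nonneg (freqCutoff R).nonneg]
        exact (freqCutoff R).le_one
    filter_upwards [ae_tendsto_blDist_initial h hsample hξ, hcut] with z hz₁ hz₂
    exact tendsto_iSup_blDist (θ₀ := fun n i => θ₀ n i z) (w := fun i => ω i z) hT.le hW hμ
      (fun n => hθ n z) hz₁ hz₂
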